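/- Graphs are finite multigraphs: parallel edges are allowed, loops are not. A cycle has at least two vertices, and two parallel edges form a cycle of length two. A cactus is a connected graph in which every edge belongs to at most one cycle; a cactus forest is a graph each of whose connected components is a cactus. Disjoint Cactus Vertex Deletion is the following problem: given a graph $G=(V,E)$, an integer $k\ge 0$ and a set $S\subseteq V$ such that $G[V\setminus S]$ is a cactus forest, find a set $X\subseteq V\setminus S$ with $|X|\le k$ such that $G[V\setminus X]$ is a cactus forest, or report that no such set exists. Lemma. On instances with $|S|\le k+1$, Disjoint Cactus Vertex Deletion can be solved in time $O^*(16.64^k)$; that is, there are a deterministic algorithm and a polynomial $p$ such that on every instance $(G,S,k)$ with $|S|\le k+1$ the algorithm gives a correct answer after at most $16.64^k\cdot p(|V|+|E|)$ steps. -/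

import Mathlib

namespace CactusDeletion

/-! ### Multigraphs and cactus forests

Multigraphs are Mathlib's `Graph α β` (parallel edges are allowed; loops are excluded in the
theorem by a hypothesis). -/

section Multigraphs

variable {α β : Type*}

/-- `F` is the edge set of a cycle of `G`: there are `l + 2 ≥ 2` distinct vertices and as many
distinct edges, the `i`-th edge joining the `i`-th vertex to the next one (cyclically). In
particular two parallel edges form a cycle of length two. A cycle is identified with its edge
set. -/
def IsCycle (G : Graph α β) (F : Set β) : Prop :=
  ∃ (l : ℕ) (v : Fin (l + 2) → α) (e : Fin (l + 2) → β),
    Function.Injective v ∧ Function.Injective e ∧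
      (∀ i, G.IsLink (e i) (v i) (v (i + 1))) ∧ F = Set.range e

/-- `G` is connected (and has a vertex). -/
def IsConnected (G : Graph α β) : Prop :=
  G.vertexSet.Nonempty ∧
    ∀ x ∈ G.vertexSet, ∀ y ∈ G.vertexSet, Relation.ReflTransGen G.Adj x y

/-- The connected component of `x` in `G`, as a subgraph. -/
def component (G : Graph α β) (x : α) : Graph α β :=
  G.induce {y | Relation.ReflTransGen G.Adj x y}

/-- A cactus is a connected graph each of whose edges belongs to at most one cycle. -/
def IsCactus (G : Graph α β) : Prop :=
  IsConnected G ∧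
    ∀ e ∈ G.edgeSet, ∀ F F' : Set β,
      IsCycle G F → IsCycle G F' → e ∈ F → e ∈ F' → F = F'

/-- A cactus forest is a graph each of whose connected components is a cactus. -/
def IsCactusForest (G : Graph α β) : Prop :=
  ∀ x ∈ G.vertexSet, IsCactus (component G x)

end Multigraphs

/-- The multigraph with vertex set `{0, …, n - 1}` given by a list of edges; the edges are the
positions in the list, so that repeated entries are parallel edges. -/
def multigraph {n : ℕ} (E : List (Fin n × Fin n)) : Graph (Fin n) (Fin E.length) where
  vertexSet := Set.univ
  IsLink i x y := E.get i = (x, y) ∨ E.get i = (y, x)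
  edgeSet := Set.univ
  isLink_symm := fun _ _ => ⟨fun _ _ h => h.symm⟩
  eq_or_eq_of_isLink_of_isLink := by
    intro i x y v w h h'
    rcases h with h | h <;> rcases h' with h' | h' <;> rw [h] at h' <;> simp at h' <;> tauto
  edge_mem_iff_exists_isLink := fun i =>
    ⟨fun _ => ⟨(E.get i).1, (E.get i).2, Or.inl rfl⟩, fun _ => Set.mem_univ i⟩
  left_mem_of_isLink := fun _ _ _ _ => Set.mem_univ _

/-- `X` is a solution of the instance `(G, S, k)`, where `G` is given by the edge list `E`:
a set of at most `k` vertices outside `S` whose deletion leaves a cactus forest. -/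
def IsSolution {n : ℕ} (E : List (Fin n × Fin n)) (S : Finset (Fin n)) (k : ℕ)
    (X : Finset (Fin n)) : Prop :=
  Disjoint X S ∧ X.card ≤ k ∧ IsCactusForest ((multigraph E).deleteVerts (X : Set (Fin n)))

/-! ### The model of computation

Deterministic first-order recursive programs over binary trees, with unit cost per operation.
Trees are held by pointers, so each operation (reading a variable, allocating a pair, testing
and opening a pair, binding a local variable, calling one of the finitely many functions of
the program) takes a constant number of steps of a pointer machine or RAM, the constant depending
on the program only; and up to a polynomial the model is equivalent to Turing machines. -/

/-- The values: binary trees (pairs built from a single atom). -/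
inductive Val : Type
  | nil : Val
  | cons (a b : Val) : Val

/-- Expressions. Variables are de Bruijn indices into the list of local variables. -/
inductive Expr : Type
  /-- the local variable with index `i` -/
  | var (i : ℕ) : Expr
  /-- the atom -/
  | nil : Expr
  /-- build a pair -/
  | cons (e₁ e₂ : Expr) : Expr
  /-- evaluate `e`; if it is the atom continue with `e₁`, and if it is a pair continue with
  `e₂`, where variables `0` and `1` are now the two components of the pair -/
  | case (e e₁ e₂ : Expr) : Expr
  /-- evaluate `e` and continue with `e'`, where variable `0` is now the value of `e` -/
  | bind (e e' : Expr) : Expr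
  /-- call the function with number `f` with the value of `e` as its argument -/
  | call (f : ℕ) (e : Expr) : Expr

/-- A program is a finite list of function bodies. Each function has one argument, which is
variable `0` of its body. -/
abbrev Program : Type := List Expr

/-- `Eval P env e v t`: with the functions of `P` and the local variables `env`, the expression
`e` evaluates (call by value) to `v` in exactly `t` steps. -/
inductive Eval (P : Program) : List Val → Expr → Val → ℕ → Prop
  | var (env : List Val) (i : ℕ) : Eval P env (Expr.var i) (env.getD i Val.nil) 1
  | nil (env : List Val) : Eval P env Expr.nil Val.nil 1
  | cons {env : List Val} {e₁ e₂ : Expr} {v₁ v₂ : Val} {t₁ t₂ : ℕ} :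
      Eval P env e₁ v₁ t₁ → Eval P env e₂ v₂ t₂ →
        Eval P env (Expr.cons e₁ e₂) (Val.cons v₁ v₂) (t₁ + t₂ + 1)
  | caseNil {env : List Val} {e e₁ e₂ : Expr} {w : Val} {t t' : ℕ} :
      Eval P env e Val.nil t → Eval P env e₁ w t' →
        Eval P env (Expr.case e e₁ e₂) w (t + t' + 1)
  | caseCons {env : List Val} {e e₁ e₂ : Expr} {a b w : Val} {t t' : ℕ} :
      Eval P env e (Val.cons a b) t → Eval P (a :: b :: env) e₂ w t' →
        Eval P env (Expr.case e e₁ e₂) w (t + t' + 1)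
  | bind {env : List Val} {e e' : Expr} {v w : Val} {t t' : ℕ} :
      Eval P env e v t → Eval P (v :: env) e' w t' →
        Eval P env (Expr.bind e e') w (t + t' + 1)
  | call {env : List Val} {f : ℕ} {e body : Expr} {v w : Val} {t t' : ℕ} :
      P[f]? = some body → Eval P env e v t → Eval P [v] body w t' →
        Eval P env (Expr.call f e) w (t + t' + 1)

/-- The program is deterministic: its result and its number of steps are determined. -/
theorem Eval.unique {P : Program} {env : List Val} {e : Expr} {v v' : Val} {t t' : ℕ}
    (h : Eval P env e v t) (h' : Eval P env e v' t') : v = v' ∧ t = t' := by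
  induction h generalizing v' t' with
  | var => cases h'; exact ⟨rfl, rfl⟩
  | nil => cases h'; exact ⟨rfl, rfl⟩
  | cons _ _ ih₁ ih₂ =>
    cases h' with
    | cons g₁ g₂ =>
      obtain ⟨rfl, rfl⟩ := ih₁ g₁
      obtain ⟨rfl, rfl⟩ := ih₂ g₂
      exact ⟨rfl, rfl⟩
  | caseNil _ _ ih₁ ih₂ =>
    cases h' with
    | caseNil g₁ g₂ =>
      obtain ⟨-, rfl⟩ := ih₁ g₁
      obtain ⟨rfl, rfl⟩ := ih₂ g₂
      exact ⟨rfl, rfl⟩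
    | caseCons g₁ g₂ => exact absurd (ih₁ g₁).1 (by simp)
  | caseCons _ _ ih₁ ih₂ =>
    cases h' with
    | caseNil g₁ g₂ => exact absurd (ih₁ g₁).1 (by simp)
    | caseCons g₁ g₂ =>
      obtain ⟨h, rfl⟩ := ih₁ g₁
      obtain ⟨rfl, rfl⟩ := Val.cons.inj h
      obtain ⟨rfl, rfl⟩ := ih₂ g₂
      exact ⟨rfl, rfl⟩
  | bind _ _ ih₁ ih₂ =>
    cases h' with
    | bind g₁ g₂ =>
      obtain ⟨rfl, rfl⟩ := ih₁ g₁
      obtain ⟨rfl, rfl⟩ := ih₂ g₂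
      exact ⟨rfl, rfl⟩
  | call hf _ _ ih₁ ih₂ =>
    cases h' with
    | call gf g₁ g₂ =>
      obtain rfl := Option.some.inj (hf.symm.trans gf)
      obtain ⟨rfl, rfl⟩ := ih₁ g₁
      obtain ⟨rfl, rfl⟩ := ih₂ g₂
      exact ⟨rfl, rfl⟩

/-- Started on the input `x`, the program `P` (its main function is number `0`) halts with output
`y` after exactly `t` steps. -/
def Program.RunsTo (P : Program) (x y : Val) (t : ℕ) : Prop :=
  Eval P [x] (Expr.call 0 (Expr.var 0)) y t

/-! ### Encoding of instances and answers -/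

/-- Lists of trees as trees. -/
def Val.ofList : List Val → Val
  | [] => Val.nil
  | a :: l => Val.cons a (Val.ofList l)

/-- Natural numbers in unary. -/
def Val.ofNat : ℕ → Val
  | 0 => Val.nil
  | n + 1 => Val.cons Val.nil (Val.ofNat n)

/-- Truth values. -/
def Val.ofBool : Bool → Val
  | false => Val.nil
  | true => Val.cons Val.nil Val.nil

/-- A set of vertices as its list of `n` membership bits. -/
def Val.ofFinset {n : ℕ} (S : Finset (Fin n)) : Val :=
  Val.ofList (List.ofFn fun i : Fin n => Val.ofBool (decide (i ∈ S)))

/-- The instance `(G, S, k)`: the list of the edges of `G`, each given by its two end vertices,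
the membership bits of `S` (one for each vertex, so that `n` can be read off), and `k`. -/
def encodeInstance {n : ℕ} (E : List (Fin n × Fin n)) (S : Finset (Fin n)) (k : ℕ) : Val :=
  Val.cons
    (Val.ofList (E.map fun e => Val.cons (Val.ofNat (e.1 : ℕ)) (Val.ofNat (e.2 : ℕ))))
    (Val.cons (Val.ofFinset S) (Val.ofNat k))

/-- The answer: the atom for "there is no solution", and a pair holding the membership bits
of `X` for the solution `X`. -/
def encodeAnswer {n : ℕ} : Option (Finset (Fin n)) → Val
  | none => Val.nil
  | some X => Val.cons Val.nil (Val.ofFinset X)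

end CactusDeletion

/-! Cactus forests are recognised by edge cuts: a multigraph is a cactus forest exactly when any two
distinct vertices are separated by a cut of at most two edges, that is, when no two vertices are
3-edge-connected (`isCactusForest_deleteVerts_iff`). In this form the property visibly passes to
subgraphs. It is also testable in polynomial time: `EC 2` reduces to `EC 0` by deleting edges, and
`EC 0` is decided by contracting edges.

The algorithm explores a search tree. A node holds a graph, undecided vertices `R`, kept vertices
`F`, deleted vertices and a budget `k`. The first applicable rule is used. (1) If three undecided
vertices, together with `F`, do not induce a cactus forest, one of them is deleted. (2) An undecided
vertex with at most one neighbour is discarded. (3) An undecided vertex with two neighbours, one of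
them undecided, is replaced by edges between these neighbours. (4) An undecided vertex with two kept
neighbours is deleted or kept. (5) For adjacent undecided vertices with neighbours in different
components of `F`, one is deleted or both are kept. The combinatorial core is `eq_empty_of_no_rule`:
when no rule applies, `R` is empty. A minimal part of `R` hanging on a single vertex would otherwise
yield two disjoint connected sets joined by three edges, which no cactus forest contains
(`not_cactus_of_three`).

The size of the tree is bounded by the weight `6^k * (54/25)^c * (6/5)^b * (|R| + 1)`, where `c` and
`b` count the components and the 2-edge-connected components of `F`. A deletion costs a factor
`1/6`. Keeping a vertex in (4) either joins components, creating at most one new 2-edge-connected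
component, or merges 2-edge-connected components, because the result is still a cactus forest; the
factor is at most `5/6`. Keeping both vertices in (5) gives `(6/5)^2 / (54/25) = 2/3`. So the
branching sums are `3/6`, `1/6 + 5/6` and `2/6 + 2/3`, none above 1, and the factor `|R| + 1` leaves
a surplus that pays for the node itself. At the root `c, b ≤ |S| ≤ k + 1`, so the weight is of order
`(6 * 54/25 * 6/5)^k * n = 15.552^k * n`. The gap to `16.64` absorbs the powers of `k` in the cost
of a node.

It remains to realise the search in the machine model. The functions computed in polynomial time
(`PT`) are closed under the list operations that a node needs, and `exists_search_program` turns a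
polynomial-time step with such a weight into a program with the required time bound. -/

namespace CactusDeletion

/-! ### Edge cuts -/

/-- Loops are ignored throughout: they cross no cut. -/
abbrev Edges : Type := List (ℕ × ℕ)

/-- The number of edges joining the two sides of the bipartition `U`. -/
def cut (L : Edges) (U : ℕ → Bool) : ℕ := L.countP fun e => U e.1 != U e.2

/-- `x` and `y` are not separated by any cut of at most `j` edges. -/
def EC (j : ℕ) (L : Edges) (x y : ℕ) : Prop := ∀ U, cut L U ≤ j → U x = U y

/-- Any two vertices are separated by a cut of at most two edges. -/
def Cactus (L : Edges) : Prop := ∀ x y, EC 2 L x y → x = y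

/-- The edges of the subgraph induced by `p`. -/
def ind (p : ℕ → Bool) (L : Edges) : Edges := L.filter fun e => p e.1 && p e.2

/-- Whether the distinct vertices `a` and `b` are adjacent. -/
def adj (L : Edges) (a b : ℕ) : Bool := !(a == b) && L.any fun e => e == (a, b) || e == (b, a)

/-- The number of edges between `a` and `b`. -/
def mult (L : Edges) (a b : ℕ) : ℕ := L.countP fun e => e == (a, b) || e == (b, a)

/-- The indicator of `a` and `b` being on different sides of `U`. -/
def sep (U : ℕ → Bool) (a b : ℕ) : ℕ := if U a = U b then 0 else 1

theorem sep_triangle (U : ℕ → Bool) (a b c : ℕ) : sep U a c ≤ sep U a b + sep U b c := by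
  unfold sep; split_ifs <;> simp_all

theorem sep_comm (U : ℕ → Bool) (a b : ℕ) : sep U a b = sep U b a := by
  unfold sep; simp only [eq_comm]

theorem sep_of_ne {U : ℕ → Bool} {a b : ℕ} (h : U a ≠ U b) : sep U a b = 1 := if_neg h

theorem sep_le_one (U : ℕ → Bool) (a b : ℕ) : sep U a b ≤ 1 := by unfold sep; split_ifs <;> simp

theorem adj_iff {L : Edges} {a b : ℕ} :
    adj L a b = true ↔ a ≠ b ∧ ((a, b) ∈ L ∨ (b, a) ∈ L) := by
  simp only [adj, Bool.and_eq_true, Bool.not_eq_true', beq_eq_false_iff_ne, List.any_eq_true,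
    Bool.or_eq_true, beq_iff_eq]
  constructor
  · rintro ⟨h, e, he, rfl | rfl⟩ <;> tauto
  · rintro ⟨h, he | he⟩
    · exact ⟨h, _, he, Or.inl rfl⟩
    · exact ⟨h, _, he, Or.inr rfl⟩

theorem adj_comm {L : Edges} {a b : ℕ} : adj L a b = true ↔ adj L b a = true := by
  simp only [adj_iff]; tauto

theorem cut_cons (e : ℕ × ℕ) (L : Edges) (U : ℕ → Bool) :
    cut (e :: L) U = cut L U + sep U e.1 e.2 := by
  unfold cut sep
  rw [List.countP_cons]
  by_cases h : U e.1 = U e.2 <;> simp [h]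

theorem cut_append (L L' : Edges) (U : ℕ → Bool) : cut (L ++ L') U = cut L U + cut L' U :=
  List.countP_append

theorem cut_mono {L L' : Edges} (h : L'.Sublist L) (U : ℕ → Bool) : cut L' U ≤ cut L U :=
  h.countP_le

theorem sep_le_cut {L : Edges} {a b : ℕ} (h : (a, b) ∈ L ∨ (b, a) ∈ L) (U : ℕ → Bool) :
    sep U a b ≤ cut L U := by
  unfold sep
  split_ifs with hU
  · exact Nat.zero_le _
  · rcases h with h | h
    · exact List.countP_pos_iff.2 ⟨_, h, by simpa using hU⟩
    · exact List.countP_pos_iff.2 ⟨_, h, by simpa using Ne.symm hU⟩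

theorem cut_erase {L : Edges} {e : ℕ × ℕ} (h : e ∈ L) (U : ℕ → Bool) :
    cut L U = cut (L.erase e) U + sep U e.1 e.2 := by
  rw [← cut_cons]
  exact (List.perm_cons_erase h).countP_eq _

theorem cut_eq_zero {L : Edges} {U : ℕ → Bool} : cut L U = 0 ↔ ∀ e ∈ L, U e.1 = U e.2 := by
  simp [cut, List.countP_eq_zero]

theorem cut_replicate (m a b : ℕ) (U : ℕ → Bool) :
    cut (List.replicate m (a, b)) U = m * sep U a b := by
  induction m with
  | zero => simp [cut]
  | succ m ih => rw [List.replicate_succ, cut_cons, ih]; ring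

theorem cut_congr {L : Edges} {U U' : ℕ → Bool} (h : ∀ e ∈ L, U e.1 = U' e.1 ∧ U e.2 = U' e.2) :
    cut L U = cut L U' := by
  refine List.countP_congr fun e he => ?_
  rw [(h e he).1, (h e he).2]

theorem cut_le_of_imp {L : Edges} {U U' : ℕ → Bool}
    (h : ∀ e ∈ L, U e.1 ≠ U e.2 → U' e.1 ≠ U' e.2) : cut L U ≤ cut L U' := by
  refine List.countP_mono_left fun e he => ?_
  simpa using h e he

theorem cut_not (L : Edges) (U : ℕ → Bool) : cut L (fun z => !U z) = cut L U :=
  le_antisymm (cut_le_of_imp fun e _ => by simp) (cut_le_of_imp fun e _ => by simp)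

/-! ### Vertices that small cuts do not separate -/

theorem EC.refl (j : ℕ) (L : Edges) (x : ℕ) : EC j L x x := fun _ _ => rfl

theorem EC.symm {j : ℕ} {L : Edges} {x y : ℕ} (h : EC j L x y) : EC j L y x :=
  fun U hU => (h U hU).symm

theorem EC.trans {j : ℕ} {L : Edges} {x y z : ℕ} (h : EC j L x y) (h' : EC j L y z) :
    EC j L x z := fun U hU => (h U hU).trans (h' U hU)

theorem EC.mono {j : ℕ} {L L' : Edges} (hL : L'.Sublist L) {x y : ℕ} (h : EC j L' x y) :
    EC j L x y := fun U hU => h U ((cut_mono hL U).trans hU)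

theorem EC.of_adj {L : Edges} {a b : ℕ} (h : adj L a b = true) : EC 0 L a b := by
  intro U hU
  by_contra hne
  have := sep_le_cut (adj_iff.1 h).2 U
  rw [sep_of_ne hne] at this
  omega

theorem Cactus.mono {L L' : Edges} (hL : L'.Sublist L) (h : Cactus L) : Cactus L' :=
  fun x y hxy => h x y (hxy.mono hL)

/-- A nonempty cut loses an edge when one of its own edges is deleted from the graph. Applied twice,
this reduces the test for `EC 2` to `EC 0`. -/
theorem EC_succ_iff {j : ℕ} {L : Edges} {x y : ℕ} :
    EC (j + 1) L x y ↔ EC j L x y ∧ ∀ e ∈ L, EC j (L.erase e) x y := by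
  constructor
  · intro h
    refine ⟨fun U hU => h U (by omega), fun e he U hU => h U ?_⟩
    have := sep_le_one U e.1 e.2
    rw [cut_erase he]
    omega
  · rintro ⟨h0, h⟩ U hU
    by_cases hz : cut L U = 0
    · exact h0 U (by omega)
    · obtain ⟨e, he, hne⟩ := List.countP_pos_iff.1 (Nat.pos_of_ne_zero hz)
      have := cut_erase he U
      rw [sep_of_ne (by simpa using hne)] at this
      exact h e he U (by omega)

/-- Contraction of `b` into `a`. -/
def contract (a b z : ℕ) : ℕ := if z == b then a else z

/-- An empty cut cannot separate the ends of an edge, so it factors through the contraction of that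
edge. Iterating this decides `EC 0`. -/
theorem EC_zero_cons_iff {a b x y : ℕ} {L : Edges} :
    EC 0 ((a, b) :: L) x y ↔
      EC 0 (L.map fun e => (contract a b e.1, contract a b e.2)) (contract a b x)
        (contract a b y) := by
  have key : ∀ U : ℕ → Bool, cut (L.map fun e => (contract a b e.1, contract a b e.2)) U
      = cut L (U ∘ contract a b) := by
    intro U
    simp only [cut, List.countP_map]
    rfl
  constructor
  · intro h U hU
    refine h (U ∘ contract a b) ?_
    rw [cut_cons, ← key]
    have : sep (U ∘ contract a b) a b = 0 := by
      simp [sep, contract]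
    simp only [this]
    omega
  · intro h U hU
    rw [cut_cons] at hU
    have hab : U a = U b := by
      by_contra hne
      have := sep_of_ne hne
      simp only at hU
      omega
    have hU' : U ∘ contract a b = U := by
      funext z
      simp only [Function.comp, contract, beq_iff_eq]
      split_ifs with hz
      · rw [hz, hab]
      · rfl
    have := h U (by rw [key, hU']; omega)
    exact (congrFun hU' x) ▸ (congrFun hU' y) ▸ this

theorem EC_nil_iff {j x y : ℕ} : EC j [] x y ↔ x = y := by
  constructor
  · intro h
    have := h (fun z => z == x) (by simp [cut])
    simp only [beq_self_eq_true] at this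
    exact (beq_iff_eq.1 this.symm).symm
  · rintro rfl; exact EC.refl _ _ _

/-! ### Induced subgraphs -/

theorem ind_ind (p q : ℕ → Bool) (L : Edges) : ind p (ind q L) = ind (fun z => p z && q z) L := by
  simp only [ind, List.filter_filter]
  refine List.filter_congr fun e _ => ?_
  cases p e.1 <;> cases p e.2 <;> cases q e.1 <;> cases q e.2 <;> rfl

theorem ind_sublist (p : ℕ → Bool) (L : Edges) : (ind p L).Sublist L := List.filter_sublist

theorem mem_ind {p : ℕ → Bool} {L : Edges} {e : ℕ × ℕ} :
    e ∈ ind p L ↔ e ∈ L ∧ p e.1 = true ∧ p e.2 = true := by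
  simp [ind]

theorem ind_sublist_ind {p q : ℕ → Bool} {L : Edges} (h : ∀ e ∈ L, p e.1 = true → p e.2 = true →
    q e.1 = true ∧ q e.2 = true) : (ind p L).Sublist (ind q L) := by
  have : ind p L = ind p (ind q L) := by
    rw [ind_ind]
    refine List.filter_congr fun e he => ?_
    have := h e he
    cases hp1 : p e.1 <;> cases hp2 : p e.2 <;> simp_all
  rw [this]
  exact ind_sublist _ _

/-! ### Vertices with at most two neighbours -/

theorem mult_cons (e : ℕ × ℕ) (L : Edges) (a b : ℕ) :
    mult (e :: L) a b = mult L a b + if e = (a, b) ∨ e = (b, a) then 1 else 0 := by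
  simp [mult, List.countP_cons]

theorem cut_remove {L : Edges} {v u w : ℕ} (huw : u ≠ w) (hu : v ≠ u) (hw : v ≠ w)
    (h : ∀ z, adj L v z = true → z = u ∨ z = w) (U : ℕ → Bool) :
    cut L U = cut (ind (fun z => !(z == v)) L) U + mult L v u * sep U v u
      + mult L v w * sep U v w := by
  induction L with
  | nil => simp [cut, ind, mult]
  | cons e L ih =>
    obtain ⟨a, b⟩ := e
    have ih := ih fun z hz => h z (by
      rw [adj_iff] at hz ⊢; simp only [List.mem_cons]; tauto)
    rw [cut_cons, ih, mult_cons, mult_cons]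
    have hab : (a = v → b = v ∨ b = u ∨ b = w) ∧ (b = v → a = v ∨ a = u ∨ a = w) := by
      constructor
      · rintro rfl
        by_cases hb : b = a
        · exact Or.inl hb
        · exact Or.inr (h b (adj_iff.2 ⟨Ne.symm hb, by simp⟩))
      · rintro rfl
        by_cases hb : a = b
        · exact Or.inl hb
        · exact Or.inr (h a (adj_iff.2 ⟨Ne.symm hb, by simp⟩))
    by_cases hav : a = v ∨ b = v
    · have hi : ind (fun z => !(z == v)) ((a, b) :: L) = ind (fun z => !(z == v)) L := by
        unfold ind; rw [List.filter_cons_of_neg]; simp; tauto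
      rw [hi]
      have hself : sep U v v = 0 := by simp [sep]
      rcases hav with rfl | rfl
      · rcases hab.1 rfl with rfl | rfl | rfl
        · simp [hself, hu, hw]
        · simp [huw, hu, Ne.symm hu]; ring
        · simp [huw.symm, hw, Ne.symm hw]; ring
      · rcases hab.2 rfl with rfl | rfl | rfl
        · simp [hself, hu, hw]
        · simp [huw, hu, Ne.symm hu, sep_comm U a b]; ring
        · simp [huw.symm, hw, Ne.symm hw, sep_comm U a b]; ring
    · push Not at hav
      have hi : ind (fun z => !(z == v)) ((a, b) :: L) = (a, b) :: ind (fun z => !(z == v)) L := by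
        unfold ind; rw [List.filter_cons_of_pos]; simp [hav]
      rw [hi, cut_cons]
      simp [hav.1, hav.2]
      ring

theorem cut_ind_ne_update {L : Edges} {v : ℕ} {U U' : ℕ → Bool} (h : ∀ z, z ≠ v → U z = U' z) :
    cut (ind (fun z => !(z == v)) L) U = cut (ind (fun z => !(z == v)) L) U' := by
  refine cut_congr fun e he => ?_
  have := mem_ind.1 he
  simp at this
  exact ⟨h _ this.2.1, h _ this.2.2⟩

/-- Adding a pendant vertex (with at most two edges) to a cactus gives a cactus. -/
theorem Cactus.of_remove_pendant {L : Edges} {v u : ℕ}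
    (h : ∀ z, adj L v z = true → z = u) (hm : mult L v u ≤ 2)
    (hC : Cactus (ind (fun z => !(z == v)) L)) : Cactus L := by
  -- If `u = v`, then `v` is isolated and any other vertex can take the role of `u`.
  obtain ⟨u', huv, hm', h'⟩ : ∃ u', v ≠ u' ∧ mult L v u' ≤ 2 ∧ ∀ z, adj L v z = true → z = u' := by
    by_cases huv : v = u
    · subst huv
      have hz : ∀ z, ¬ adj L v z = true := fun z hz => (adj_iff.1 hz).1 (h z hz).symm
      refine ⟨v + 1, by omega, ?_, fun z hzz => absurd hzz (hz z)⟩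
      have : mult L v (v + 1) = 0 := by
        unfold mult
        rw [List.countP_eq_zero]
        intro e he hee
        refine hz (v + 1) (adj_iff.2 ⟨by omega, ?_⟩)
        simp only [Bool.or_eq_true, beq_iff_eq] at hee
        rcases hee with rfl | rfl
        · exact Or.inl he
        · exact Or.inr he
      omega
    · exact ⟨u, huv, hm, h⟩
  -- A dummy second neighbour of multiplicity zero makes `cut_remove` applicable.
  obtain ⟨w, hw, hw'⟩ : ∃ w, u' ≠ w ∧ v ≠ w := by
    refine ⟨u' + v + 1, by omega, by omega⟩
  have hmw : mult L v w = 0 := by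
    unfold mult
    rw [List.countP_eq_zero]
    intro e he hee
    refine hw (h' w (adj_iff.2 ⟨hw', ?_⟩)).symm
    simp only [Bool.or_eq_true, beq_iff_eq] at hee
    rcases hee with rfl | rfl
    · exact Or.inl he
    · exact Or.inr he
  have hcut := cut_remove hw huv hw' (fun z hz => Or.inl (h' z hz)) (L := L)
  simp only [hmw, Nat.zero_mul, Nat.add_zero] at hcut
  have hiso : ∀ x, x ≠ v → ¬ EC 2 L v x := by
    intro x hx hE
    have := hE (fun z => z == v) (by
      rw [hcut]
      have h1 : cut (ind (fun z => !(z == v)) L) (fun z => z == v) = 0 := by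
        rw [cut_eq_zero]
        intro e he
        have := mem_ind.1 he
        simp only [Bool.not_eq_true', beq_eq_false_iff_ne] at this
        simp [this]
      have := sep_le_one (fun z => z == v) v u'
      nlinarith)
    simp [hx] at this
  intro x y hxy
  by_cases hx : x = v
  · subst hx
    by_contra hne
    exact hiso y (Ne.symm hne) hxy
  by_cases hy : y = v
  · subst hy
    by_contra hne
    exact hiso x hne hxy.symm
  refine hC x y fun U hU => ?_
  -- A cut of the smaller graph extends to `v` at no cost when `v` is placed beside its only
  -- neighbour.
  have := hxy (fun z => if z = v then U u' else U z) (by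
    rw [hcut, cut_ind_ne_update (U' := U)]
    · simp [sep, Ne.symm huv]; omega
    · intro z hz; simp [hz])
  simpa [hx, hy] using this

/-- Replace the vertex `v` by edges between its neighbours `u` and `w`. -/
def bypass (L : Edges) (v u w : ℕ) : Edges :=
  ind (fun z => !(z == v)) L ++ List.replicate (max (mult L v u) (mult L v w)) (u, w)

theorem mult_pos {L : Edges} {a b : ℕ} (h : adj L a b = true) : 0 < mult L a b := by
  rcases (adj_iff.1 h).2 with h | h
  · exact List.countP_pos_iff.2 ⟨_, h, by simp⟩
  · exact List.countP_pos_iff.2 ⟨_, h, by simp⟩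

/-- A cut of the bypassed graph extends to `v` by placing `v` beside the neighbour of larger
multiplicity, so that only the lighter bundle at `v` is crossed. Conversely, the only cuts of `L`
that become more expensive are those crossing just the lighter bundle. If the multiplicities differ,
the cactus property separates `v` from the heavier neighbour; this forces `u` and `w` to be
disconnected apart from `v`, and the cut can be repaired along that separation. -/
theorem cactus_bypass_iff {L : Edges} {v u w : ℕ} (huw : u ≠ w) (hu : adj L v u = true)
    (hw : adj L v w = true) (h : ∀ z, adj L v z = true → z = u ∨ z = w) :
    Cactus (bypass L v u w) ↔ Cactus L := by
  have hvu := (adj_iff.1 hu).1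
  have hvw := (adj_iff.1 hw).1
  have h1 := mult_pos hu
  have h2 := mult_pos hw
  have hcut := cut_remove huw hvu hvw h
  have hcut' : ∀ U, cut (bypass L v u w) U = cut (ind (fun z => !(z == v)) L) U
      + max (mult L v u) (mult L v w) * sep U u w := by
    intro U; rw [bypass, cut_append, cut_replicate]
  set m1 := mult L v u
  set m2 := mult L v w
  set L0 := ind (fun z => !(z == v)) L with hL0
  have hupd : ∀ {U U' : ℕ → Bool}, (∀ z, z ≠ v → U z = U' z) → cut L0 U = cut L0 U' :=
    fun h => cut_ind_ne_update h
  have hiso : cut L0 (fun z => z == v) = 0 := by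
    rw [cut_eq_zero]
    intro e he
    have := (mem_ind.1 he).2
    simp only [Bool.not_eq_true', beq_eq_false_iff_ne] at this
    simp [this]
  constructor
  · intro hC
    have main : ∀ x y, x ≠ v → y ≠ v → EC 2 L x y → x = y := by
      intro x y hx hy hxy
      refine hC x y fun U hU => ?_
      rw [hcut'] at hU
      by_cases huv : m1 ≤ m2
      · have := hxy (fun z => if z = v then U w else U z) (by
          rw [hcut, hupd (U' := U) (fun z hz => by simp [hz])]
          simp only [sep, if_true, if_neg hvu.symm, if_neg hvw.symm] at hU ⊢
          rw [max_eq_right huv] at hU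
          by_cases hUU : U u = U w
          · simp [hUU] at hU ⊢; omega
          · simp [hUU, Ne.symm hUU] at hU ⊢; omega)
        simpa [hx, hy] using this
      · have := hxy (fun z => if z = v then U u else U z) (by
          rw [hcut, hupd (U' := U) (fun z hz => by simp [hz])]
          simp only [sep, if_true, if_neg hvu.symm, if_neg hvw.symm] at hU ⊢
          rw [max_eq_left (by omega)] at hU
          by_cases hUU : U u = U w
          · simp [hUU] at hU ⊢; omega
          · simp [hUU] at hU ⊢; omega)
        simpa [hx, hy] using this
    have hv : ∀ y, EC 2 L v y → v = y := by
      intro y hvy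
      by_contra hne
      -- Since `u ≠ w`, some small cut separates `u` from `w`, or keeps them together and separates
      -- them from `y`.
      obtain ⟨U, hU, hUuw⟩ : ∃ U, cut (bypass L v u w) U ≤ 2 ∧ (U u = U w → U u ≠ U y) := by
        by_contra hcon
        push Not at hcon
        by_cases hyu : y = u
        · subst hyu
          exact huw (hC y w fun U hU => (hcon U hU).1)
        · exact hyu (hC u y fun U hU => (hcon U hU).2).symm
      rw [hcut'] at hU
      by_cases hUU : U u = U w
      · have := hvy (fun z => if z = v then U u else U z) (by
          rw [hcut, hupd (U' := U) (fun z hz => by simp [hz])]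
          simp only [sep, if_true, if_neg hvu.symm, if_neg hvw.symm] at hU ⊢
          simp [hUU] at hU ⊢; omega)
        simp [Ne.symm hne] at this
        exact hUuw hUU this
      -- Either bundle at `v` has at most `max m1 m2` edges, so `v` may be placed on either side. It
      -- would have to agree with `y` both times.
      · have hmx1 := le_max_left m1 m2
        have hmx2 := le_max_right m1 m2
        simp only [sep, if_neg hUU, Nat.mul_one] at hU
        have e1 := hvy (fun z => if z = v then U u else U z) (by
          rw [hcut, hupd (U' := U) (fun z hz => by simp [hz])]
          simp only [sep, if_true, if_neg hvu.symm, if_neg hvw.symm]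
          simp [hUU]; omega)
        have e2 := hvy (fun z => if z = v then U w else U z) (by
          rw [hcut, hupd (U' := U) (fun z hz => by simp [hz])]
          simp only [sep, if_true, if_neg hvu.symm, if_neg hvw.symm]
          simp [Ne.symm hUU]; omega)
        simp [Ne.symm hne] at e1 e2
        exact hUU (e1.trans e2.symm)
    intro x y hxy
    by_cases hx : x = v
    · subst hx; exact hv y hxy
    by_cases hy : y = v
    · subst hy; exact (hv x hxy.symm).symm
    exact main x y hx hy hxy
  · intro hC x y hxy
    have hvx : ∀ y, EC 2 (bypass L v u w) v y → v = y := by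
      intro y hy
      have := hy (fun z => z == v) (by
        rw [hcut', hiso]; simp [sep, hvu.symm, hvw.symm])
      simp only [beq_self_eq_true] at this
      exact (beq_iff_eq.1 this.symm).symm
    by_cases hx : x = v
    · subst hx; exact hvx y hxy
    by_cases hy : y = v
    · subst hy; exact (hvx x hxy.symm).symm
    -- the case where the heavier link is the one to `w`
    have key : ∀ (u w m1 m2 : ℕ), v ≠ u → v ≠ w → u ≠ w → 0 < m1 → 0 < m2 → m1 ≤ m2 →
        (∀ U, cut L U = cut L0 U + m1 * sep U v u + m2 * sep U v w) →
        (∀ U, cut L0 U + m2 * sep U u w ≤ 2 → U x = U y) → x = y := by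
      intro u w m1 m2 hvu hvw huw h1 h2 hle hcut hxy
      refine hC x y fun U hU => ?_
      rw [hcut] at hU
      by_cases hUU : U u = U w
      · exact hxy U (by simp only [sep, if_pos hUU]; omega)
      by_cases hUv : U v = U u
      · refine hxy U ?_
        have : U v ≠ U w := fun h => hUU (hUv ▸ h)
        simp only [sep, if_pos hUv, if_neg hUU, if_neg this] at hU ⊢
        omega
      have hUvw : U v = U w := by
        revert hUU hUv
        cases U u <;> cases U v <;> cases U w <;> simp
      simp only [sep, if_neg hUv, if_pos hUvw] at hU
      by_cases hm : m1 = m2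
      · exact hxy U (by simp only [sep, if_neg hUU]; omega)
      -- Now `m1 < m2` and `U` crosses only the lighter bundle. A small cut `W` between `v` and `w`
      -- crosses the `m2 ≥ 2` edges of the heavier bundle and hence nothing else: no edge of `L0`
      -- crosses it, and `u` and `w` lie on different sides.
      obtain ⟨W, hW, hWvw⟩ : ∃ W, cut L W ≤ 2 ∧ W v ≠ W w := by
        by_contra hcon
        push Not at hcon
        exact hvw (hC v w hcon)
      rw [hcut] at hW
      have hWvu : W v = W u := by
        by_contra hne
        simp only [sep, if_neg hne, if_neg hWvw] at hW
        omega
      simp only [sep, if_pos hWvu, if_neg hWvw] at hW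
      have hW0 : cut L0 W = 0 := by omega
      have hWuw : W u ≠ W w := hWvu ▸ hWvw
      -- If `W` leaves `x` and `y` on one side, `U` is made constant on the other side: no edge of
      -- `L0` becomes crossing, and `u` and `w` are no longer separated. Otherwise `W` itself is a
      -- small cut of the bypassed graph.
      by_cases hWxy : W x = W y
      · by_cases hWx : W x = W u
        · have := hxy (fun z => if W z = W u then U z else U u) (by
            have h1 : cut L0 (fun z => if W z = W u then U z else U u) ≤ cut L0 U := by
              refine cut_le_of_imp fun e he => ?_
              have := cut_eq_zero.1 hW0 e he
              simp only [this]
              split_ifs <;> simp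
            have h2 : sep (fun z => if W z = W u then U z else U u) u w = 0 := by
              simp [sep, hWuw.symm]
            rw [h2]; omega)
          simpa [hWx, ← hWxy] using this
        · have hWx' : W x = W w := by
            revert hWx hWuw
            cases W x <;> cases W u <;> cases W w <;> simp
          have := hxy (fun z => if W z = W w then U z else U w) (by
            have h1 : cut L0 (fun z => if W z = W w then U z else U w) ≤ cut L0 U := by
              refine cut_le_of_imp fun e he => ?_
              have := cut_eq_zero.1 hW0 e he
              simp only [this]
              split_ifs <;> simp
            have h2 : sep (fun z => if W z = W w then U z else U w) u w = 0 := by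
              simp [sep, hWuw]
            rw [h2]; omega)
          simpa [hWx', ← hWxy] using this
      · exact absurd (hxy W (by
          have := sep_le_one W u w
          have : m2 * sep W u w ≤ m2 * 1 := Nat.mul_le_mul_left _ this
          omega)) hWxy
    rcases le_total m1 m2 with hle | hle
    · refine key u w m1 m2 hvu hvw huw h1 h2 hle hcut fun U hU => hxy U ?_
      rw [hcut', max_eq_right hle]; exact hU
    · refine key w u m2 m1 hvw hvu huw.symm h2 h1 hle (fun U => by rw [hcut]; ring) fun U hU => hxy U ?_
      rw [hcut', max_eq_left hle, sep_comm]; exact hU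

/-! ### Connected vertex sets joined by three edges -/

/-- The edges of the subgraph induced by the finite set `A`. -/
def indSet (A : Finset ℕ) (L : Edges) : Edges := ind (fun z => decide (z ∈ A)) L

theorem mem_indSet {A : Finset ℕ} {L : Edges} {e : ℕ × ℕ} :
    e ∈ indSet A L ↔ e ∈ L ∧ e.1 ∈ A ∧ e.2 ∈ A := by
  simp [indSet, mem_ind]

theorem indSet_sublist {A B : Finset ℕ} (h : A ⊆ B) (L : Edges) :
    (indSet A L).Sublist (indSet B L) :=
  ind_sublist_ind fun e _ h1 h2 => by
    simp only [decide_eq_true_eq] at h1 h2 ⊢; exact ⟨h h1, h h2⟩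

/-- `A` induces a connected subgraph. -/
def Conn (L : Edges) (A : Finset ℕ) : Prop :=
  ∀ U, cut (indSet A L) U = 0 → ∀ x ∈ A, ∀ y ∈ A, U x = U y

theorem Conn.singleton (L : Edges) (a : ℕ) : Conn L {a} := by
  intro U _ x hx y hy
  rw [Finset.mem_singleton.1 hx, Finset.mem_singleton.1 hy]

theorem Conn.insert {L : Edges} {A : Finset ℕ} (hA : Conn L A) {l p : ℕ} (hp : p ∈ A)
    (he : adj L l p = true) : Conn L (insert l A) := by
  intro U hU
  have h0 := Nat.le_zero.1 (hU ▸ cut_mono (indSet_sublist (Finset.subset_insert l A) L) U)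
  have hl : U l = U p := by
    by_contra hne
    have := sep_le_cut (L := indSet (Insert.insert l A) L) (a := l) (b := p) (by
      rcases (adj_iff.1 he).2 with h | h
      · exact Or.inl (mem_indSet.2 ⟨h, by simp [hp]⟩)
      · exact Or.inr (mem_indSet.2 ⟨h, by simp [hp]⟩)) U
    rw [sep_of_ne hne] at this
    omega
  have : ∀ x ∈ Insert.insert l A, U x = U p := by
    intro x hx
    rcases Finset.mem_insert.1 hx with rfl | hx
    · exact hl
    · exact hA U h0 x hx p hp
  intro x hx y hy
  rw [this x hx, this y hy]

/-- Any three vertices of `A` are joined to a common vertex by edge-disjoint paths in `A`,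
expressed by cuts. -/
def Fan (L : Edges) (A : Finset ℕ) : Prop :=
  ∀ f : Fin 3 → ℕ, (∀ i, f i ∈ A) → ∃ z ∈ A, ∀ U, ∑ i, sep U (f i) z ≤ cut (indSet A L) U

theorem Fan.singleton (L : Edges) (a : ℕ) : Fan L {a} := by
  intro f hf
  refine ⟨a, by simp, fun U => ?_⟩
  have : ∀ i, f i = a := fun i => Finset.mem_singleton.1 (hf i)
  simp [this, sep]

/-- If two of the three vertices are the new leaf `l`, then `l` itself is the common vertex, by
connectedness. If just one is `l`, it is replaced by `p`, and the pendant edge `lp`, which is not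
used inside `A`, extends its path. Otherwise nothing changes. -/
theorem Fan.insert {L : Edges} {A : Finset ℕ} (hA : Conn L A) (hF : Fan L A) {l p : ℕ}
    (hl : l ∉ A) (hp : p ∈ A) (he : adj L l p = true) : Fan L (insert l A) := by
  intro f hf
  have hconn := hA.insert hp he
  have hsep : ∀ U x, x ∈ Insert.insert l A → sep U x l ≤ cut (indSet (Insert.insert l A) L) U := by
    intro U x hx
    unfold sep
    split_ifs with h
    · exact Nat.zero_le _
    · by_contra hc
      exact h (hconn U (by omega) x hx l (Finset.mem_insert_self _ _))
  have hcut : ∀ U, cut (indSet A L) U + sep U l p ≤ cut (indSet (Insert.insert l A) L) U := by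
    intro U
    obtain ⟨e, heL, he1, he2⟩ : ∃ e ∈ L, (e = (l, p) ∨ e = (p, l)) ∧ sep U e.1 e.2 = sep U l p := by
      rcases (adj_iff.1 he).2 with h | h
      · exact ⟨_, h, Or.inl rfl, rfl⟩
      · exact ⟨_, h, Or.inr rfl, sep_comm _ _ _⟩
    have hmem : e ∈ indSet (Insert.insert l A) L := by
      rcases he1 with rfl | rfl <;> exact mem_indSet.2 ⟨heL, by simp [hp]⟩
    rw [cut_erase hmem, he2]
    refine Nat.add_le_add_right (cut_mono ?_ U) _
    have h1 := (indSet_sublist (Finset.subset_insert l A) L).erase e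
    rwa [List.erase_of_not_mem] at h1
    intro hmem'
    rcases he1 with rfl | rfl
    · exact hl (mem_indSet.1 hmem').2.1
    · exact hl (mem_indSet.1 hmem').2.2
  by_cases htwo : ∃ j, ∀ i, i ≠ j → f i = l
  · obtain ⟨j, hj⟩ := htwo
    refine ⟨l, Finset.mem_insert_self _ _, fun U => ?_⟩
    rw [Finset.sum_eq_single j]
    · exact hsep U _ (hf j)
    · intro i _ hi; simp [hj i hi, sep]
    · simp
  · have hone : ∃ j, ∀ i, i ≠ j → f i ≠ l := by
      by_cases h0 : f 0 = l
      · refine ⟨0, fun i hi hil => htwo ?_⟩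
        by_cases h1 : f 1 = l
        · exact ⟨2, by intro i hi; fin_cases i <;> simp_all⟩
        · by_cases h2 : f 2 = l
          · exact ⟨1, by intro i hi; fin_cases i <;> simp_all⟩
          · fin_cases i <;> simp_all
      · by_cases h1 : f 1 = l
        · refine ⟨1, fun i hi hil => htwo ⟨0, ?_⟩⟩
          intro j hj; fin_cases i <;> fin_cases j <;> simp_all
        · exact ⟨2, by intro i hi; fin_cases i <;> simp_all⟩
    obtain ⟨j, hj⟩ := hone
    have hmem : ∀ i, i ≠ j → f i ∈ A := fun i hi =>
      (Finset.mem_insert.1 (hf i)).resolve_left (hj i hi)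
    by_cases hjl : f j = l
    · obtain ⟨z, hz, hzU⟩ := hF (Function.update f j p) (by
        intro i
        by_cases hi : i = j
        · subst hi; simpa using hp
        · simpa [hi] using hmem i hi)
      refine ⟨z, Finset.mem_insert_of_mem hz, fun U => le_trans ?_ (hcut U)⟩
      refine le_trans ?_ (Nat.add_le_add_right (hzU U) _)
      rw [← Finset.add_sum_erase _ _ (Finset.mem_univ j),
        ← Finset.add_sum_erase (a := j) _ _ (Finset.mem_univ j)]
      have : ∑ i ∈ Finset.univ.erase j, sep U (f i) z
          = ∑ i ∈ Finset.univ.erase j, sep U (Function.update f j p i) z := by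
        refine Finset.sum_congr rfl fun i hi => ?_
        rw [Function.update_of_ne (Finset.ne_of_mem_erase hi)]
      rw [this, Function.update_self, hjl]
      have := sep_triangle U l p z
      omega
    · obtain ⟨z, hz, hzU⟩ := hF f fun i => by
        by_cases hi : i = j
        · subst hi; exact (Finset.mem_insert.1 (hf i)).resolve_left hjl
        · exact hmem i hi
      exact ⟨z, Finset.mem_insert_of_mem hz, fun U =>
        (hzU U).trans (cut_mono (indSet_sublist (Finset.subset_insert l A) L) U)⟩

/-- A connected set is built from one vertex by successively attaching adjacent vertices. The common
vertex is the median of the three vertices in the resulting spanning tree. -/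
theorem Conn.fan {L : Edges} {A : Finset ℕ} (hA : Conn L A) (hne : A.Nonempty) : Fan L A := by
  have grow : ∀ n (T : Finset ℕ), T ⊆ A → T.Nonempty → (A \ T).card = n → Conn L T → Fan L T →
      Fan L A := by
    intro n
    induction n with
    | zero =>
      intro T hT _ hc _ hF
      have : A = T := Finset.Subset.antisymm (Finset.sdiff_eq_empty_iff_subset.1
        (Finset.card_eq_zero.1 hc)) hT
      rwa [this]
    | succ n ih =>
      intro T hT hTne hc hconn hF
      obtain ⟨t, ht⟩ := hTne
      obtain ⟨a, ha⟩ := Finset.card_pos.1 (by omega : 0 < (A \ T).card)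
      obtain ⟨haA, haT⟩ := Finset.mem_sdiff.1 ha
      have : cut (indSet A L) (fun z => decide (z ∈ T)) ≠ 0 := fun h0 => by
        simpa [ht, haT] using hA _ h0 t (hT ht) a haA
      obtain ⟨e, he, hne⟩ := List.countP_pos_iff.1 (Nat.pos_of_ne_zero this)
      obtain ⟨heL, he1, he2⟩ := mem_indSet.1 he
      obtain ⟨l, p, hlA, hl, hp, hadj⟩ : ∃ l p, l ∈ A ∧ l ∉ T ∧ p ∈ T ∧ adj L l p = true := by
        by_cases h1 : e.1 ∈ T
        · have h2 : e.2 ∉ T := by simpa [h1] using hne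
          exact ⟨e.2, e.1, he2, h2, h1, adj_iff.2 ⟨fun h => h2 (h ▸ h1), Or.inr heL⟩⟩
        · have h2 : e.2 ∈ T := by simpa [h1] using hne
          exact ⟨e.1, e.2, he1, h1, h2, adj_iff.2 ⟨fun h => h1 (h ▸ h2), Or.inl heL⟩⟩
      refine ih (Insert.insert l T) (Finset.insert_subset hlA hT) (Finset.insert_nonempty _ _) ?_
        (hconn.insert hp hadj) (hF.insert hconn hl hp hadj)
      rw [Finset.sdiff_insert, Finset.card_erase_of_mem (Finset.mem_sdiff.2 ⟨hlA, hl⟩), hc]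
      rfl
  obtain ⟨a, ha⟩ := hne
  exact grow _ {a} (by simpa using ha) (by simp) rfl (Conn.singleton L a) (Fan.singleton L a)

/-! ### Edges between two disjoint vertex sets -/

theorem countP_le_of_nodup {es L : Edges} (hes : es.Nodup) (h : es ⊆ L) (p : ℕ × ℕ → Bool) :
    es.countP p ≤ L.countP p :=
  (List.subperm_of_subset hes h).countP_le p

theorem cut_split {L : Edges} {A B : Finset ℕ} (hAB : Disjoint A B) (U : ℕ → Bool) :
    cut (indSet A L) U + cut (indSet B L) U
      + cut (L.filter fun e => decide ((e.1 ∈ A ∧ e.2 ∈ B) ∨ (e.1 ∈ B ∧ e.2 ∈ A))) U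
      ≤ cut (indSet (A ∪ B) L) U := by
  induction L with
  | nil => simp [cut, indSet, ind]
  | cons e L ih =>
    have h1 : ∀ (T : Finset ℕ), cut (indSet T (e :: L)) U
        = cut (indSet T L) U + if e.1 ∈ T ∧ e.2 ∈ T then sep U e.1 e.2 else 0 := by
      intro T
      unfold indSet ind
      rw [List.filter_cons]
      split_ifs with h h' h' <;> simp_all [cut_cons]
    rw [h1, h1, h1, List.filter_cons]
    have hA : ∀ x, x ∈ A → x ∉ B := fun x hx hx' => Finset.disjoint_left.1 hAB hx hx'
    have hA1 := hA e.1
    have hA2 := hA e.2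
    by_cases a1 : e.1 ∈ A <;> by_cases a2 : e.2 ∈ A <;> by_cases b1 : e.1 ∈ B <;>
      by_cases b2 : e.2 ∈ B <;> simp_all [cut_cons] <;> omega

theorem cut_ofFn {n : ℕ} (e : Fin n → ℕ × ℕ) (U : ℕ → Bool) :
    cut (List.ofFn e) U = ∑ i, sep U (e i).1 (e i).2 := by
  induction n with
  | zero => simp [cut]
  | succ n ih => rw [List.ofFn_succ, cut_cons, ih, Fin.sum_univ_succ, Nat.add_comm]

theorem sum_sep_le_cut_between {L : Edges} {A B : Finset ℕ} (hAB : Disjoint A B) {n : ℕ}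
    (a b : Fin n → ℕ) (ha : ∀ i, a i ∈ A) (hb : ∀ i, b i ∈ B) (he : ∀ i, adj L (a i) (b i) = true)
    (hinj : ∀ i j, a i = a j → b i = b j → i = j) (U : ℕ → Bool) :
    ∑ i, sep U (a i) (b i)
      ≤ cut (L.filter fun e => decide ((e.1 ∈ A ∧ e.2 ∈ B) ∨ (e.1 ∈ B ∧ e.2 ∈ A))) U := by
  have hchoose : ∀ i, ∃ e ∈ L, (e = (a i, b i) ∨ e = (b i, a i)) := by
    intro i
    rcases (adj_iff.1 (he i)).2 with h | h
    · exact ⟨_, h, Or.inl rfl⟩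
    · exact ⟨_, h, Or.inr rfl⟩
  choose e heL hab using hchoose
  have hdis : ∀ i j, a i ≠ b j := fun i j h => Finset.disjoint_left.1 hAB (ha i) (h ▸ hb j)
  have heinj : Function.Injective e := by
    intro i j hij
    have h1 := hdis i j
    have h2 := hdis j i
    rcases hab i with hi | hi <;> rcases hab j with hj | hj <;> rw [hi, hj] at hij <;>
      simp only [Prod.mk.injEq] at hij
    · exact hinj i j hij.1 hij.2
    · exact absurd hij.1 h1
    · exact absurd hij.1.symm h2
    · exact hinj i j hij.2 hij.1
  have h1 := countP_le_of_nodup (es := List.ofFn e) (List.nodup_ofFn.2 heinj)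
    (L := L.filter fun e => decide ((e.1 ∈ A ∧ e.2 ∈ B) ∨ (e.1 ∈ B ∧ e.2 ∈ A))) (by
      intro f hf
      obtain ⟨i, rfl⟩ := List.mem_ofFn.1 hf
      rw [List.mem_filter]
      refine ⟨heL i, ?_⟩
      rcases hab i with h | h <;> simp [h, ha i, hb i]) (fun e => U e.1 != U e.2)
  refine le_trans (le_of_eq ?_) h1
  refine Eq.trans (Finset.sum_congr rfl fun i _ => ?_) (cut_ofFn e U).symm
  rcases hab i with h | h <;> rw [h]
  exact sep_comm _ _ _

/-- Disjoint connected sets joined by three edges do not induce a cactus. -/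
theorem not_cactus_of_three {L : Edges} {A B : Finset ℕ} (hAB : Disjoint A B) (hA : Conn L A)
    (hB : Conn L B) (a b : Fin 3 → ℕ) (ha : ∀ i, a i ∈ A) (hb : ∀ i, b i ∈ B)
    (he : ∀ i, adj L (a i) (b i) = true) (hinj : ∀ i j, a i = a j → b i = b j → i = j) :
    ¬ Cactus (indSet (A ∪ B) L) := by
  intro hC
  -- With the hubs `x` of `A` and `y` of `B`, the three routes from `x` through `a i` and `b i` to
  -- `y` behave as edge-disjoint paths: every cut between `x` and `y` has at least three edges.
  obtain ⟨x, hx, hxU⟩ := hA.fan ⟨_, ha 0⟩ a ha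
  obtain ⟨y, hy, hyU⟩ := hB.fan ⟨_, hb 0⟩ b hb
  refine Finset.disjoint_left.1 hAB hx (?_ : x ∈ B)
  rw [hC x y fun U hU => ?_]
  · exact hy
  by_contra hne
  have hbetween := sum_sep_le_cut_between hAB a b ha hb he hinj U
  have hsplit := cut_split (L := L) hAB U
  have h1 := hxU U
  have h2 := hyU U
  rw [Fin.sum_univ_three] at h1 h2 hbetween
  have tri : ∀ i, 1 ≤ sep U (a i) x + sep U (b i) y + sep U (a i) (b i) := by
    intro i
    have e1 := sep_triangle U x (a i) y
    have e2 := sep_triangle U (a i) (b i) y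
    rw [sep_of_ne hne, sep_comm U x] at e1
    omega
  have t0 := tri 0
  have t1 := tri 1
  have t2 := tri 2
  omega

/-! ### Numbers of components and of 2-edge-connected components -/

/-- The number of classes of `EC j L` that meet `A`. -/
noncomputable def rank (j : ℕ) (L : Edges) (A : Finset ℕ) : ℕ :=
  sInf {m | ∃ T : Finset ℕ, T.card = m ∧ ∀ x ∈ A, ∃ t ∈ T, EC j L x t}

theorem rank_spec (j : ℕ) (L : Edges) (A : Finset ℕ) :
    ∃ T : Finset ℕ, T.card = rank j L A ∧ ∀ x ∈ A, ∃ t ∈ T, EC j L x t :=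
  Nat.sInf_mem (s := {m | ∃ T : Finset ℕ, T.card = m ∧ ∀ x ∈ A, ∃ t ∈ T, EC j L x t})
    ⟨A.card, A, rfl, fun x hx => ⟨x, hx, EC.refl _ _ _⟩⟩

theorem rank_le {j : ℕ} {L : Edges} {A T : Finset ℕ} (h : ∀ x ∈ A, ∃ t ∈ T, EC j L x t) :
    rank j L A ≤ T.card := Nat.sInf_le ⟨T, rfl, h⟩

theorem rank_le_card (j : ℕ) (L : Edges) (A : Finset ℕ) : rank j L A ≤ A.card :=
  rank_le fun x hx => ⟨x, hx, EC.refl _ _ _⟩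

theorem rank_union_le {j : ℕ} {L L' : Edges} (hL : L.Sublist L') (A W : Finset ℕ) :
    rank j L' (A ∪ W) ≤ rank j L A + W.card := by
  obtain ⟨T, hT, hTA⟩ := rank_spec j L A
  rw [← hT]
  refine (rank_le (T := T ∪ W) fun x hx => ?_).trans (Finset.card_union_le _ _)
  rcases Finset.mem_union.1 hx with hx | hx
  · obtain ⟨t, ht, h⟩ := hTA x hx
    exact ⟨t, Finset.mem_union_left _ ht, h.mono hL⟩
  · exact ⟨x, Finset.mem_union_right _ hx, EC.refl _ _ _⟩

theorem rank_absorb_le {j : ℕ} {L L' : Edges} (hL : L.Sublist L') {A A' : Finset ℕ}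
    (h : ∀ x ∈ A', ∃ a ∈ A, EC j L' x a) : rank j L' A' ≤ rank j L A := by
  obtain ⟨T, hT, hTA⟩ := rank_spec j L A
  rw [← hT]
  refine rank_le fun x hx => ?_
  obtain ⟨a, ha, hxa⟩ := h x hx
  obtain ⟨t, ht, hat⟩ := hTA a ha
  exact ⟨t, ht, hxa.trans (hat.mono hL)⟩

/-- Once the classes of `f` and `g` coincide, the representative of `g` can be dropped in favour of
that of `f`. -/
theorem rank_merge_le {j : ℕ} {L L' : Edges} (hL : L.Sublist L') {A A' : Finset ℕ}
    (h : ∀ x ∈ A', ∃ a ∈ A, EC j L' x a) {f g : ℕ} (hf : f ∈ A) (hg : g ∈ A)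
    (hfg : ¬ EC j L f g) (hfg' : EC j L' f g) : rank j L' A' + 1 ≤ rank j L A := by
  obtain ⟨T, hT, hTA⟩ := rank_spec j L A
  obtain ⟨tf, htf, hftf⟩ := hTA f hf
  obtain ⟨tg, htg, hgtg⟩ := hTA g hg
  have hne : tf ≠ tg := by
    rintro rfl
    exact hfg (hftf.trans hgtg.symm)
  rw [← hT, ← Finset.card_erase_add_one htg]
  refine Nat.add_le_add_right (rank_le fun x hx => ?_) 1
  obtain ⟨a, ha, hxa⟩ := h x hx
  obtain ⟨t, ht, hat⟩ := hTA a ha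
  by_cases htt : t = tg
  · subst htt
    exact ⟨tf, Finset.mem_erase.2 ⟨hne, htf⟩, hxa.trans <| (hat.mono hL).trans <|
      (hgtg.mono hL).symm.trans <| hfg'.symm.trans (hftf.mono hL)⟩
  · exact ⟨t, Finset.mem_erase.2 ⟨htt, ht⟩, hxa.trans (hat.mono hL)⟩

theorem adj_indSet {L : Edges} {A : Finset ℕ} {a b : ℕ} (ha : a ∈ A) (hb : b ∈ A)
    (h : adj L a b = true) : adj (indSet A L) a b = true := by
  rw [adj_iff] at h ⊢
  refine ⟨h.1, ?_⟩
  rcases h.2 with h | h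
  · exact Or.inl (mem_indSet.2 ⟨h, ha, hb⟩)
  · exact Or.inr (mem_indSet.2 ⟨h, hb, ha⟩)

/-- If `f` and `g` lie in different components of `F`, then `v` joins these and adds at most one
2-edge-connected component. Otherwise `v` closes a cycle, which puts `v`, `f` and `g` into one
2-edge-connected component. Here `f` and `g` were in different ones before: the additional path
through `v` would otherwise make them 3-edge-connected, against `hC`. -/
theorem rank_keep_one {L : Edges} {F : Finset ℕ} {v f g : ℕ} (hv : v ∉ F) (hf : f ∈ F)
    (hg : g ∈ F) (hfg : f ≠ g) (hvf : adj L v f = true) (hvg : adj L v g = true)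
    (hC : Cactus (indSet (F ∪ {v}) L)) :
    (rank 0 (indSet (F ∪ {v}) L) (F ∪ {v}) + 1 ≤ rank 0 (indSet F L) F ∧
      rank 1 (indSet (F ∪ {v}) L) (F ∪ {v}) ≤ rank 1 (indSet F L) F + 1) ∨
    (rank 0 (indSet (F ∪ {v}) L) (F ∪ {v}) ≤ rank 0 (indSet F L) F ∧
      rank 1 (indSet (F ∪ {v}) L) (F ∪ {v}) + 1 ≤ rank 1 (indSet F L) F) := by
  have hL : (indSet F L).Sublist (indSet (F ∪ {v}) L) := indSet_sublist Finset.subset_union_left L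
  have hvf' : EC 0 (indSet (F ∪ {v}) L) v f :=
    EC.of_adj (adj_indSet (by simp) (by simp [hf]) hvf)
  have hvg' : EC 0 (indSet (F ∪ {v}) L) v g :=
    EC.of_adj (adj_indSet (by simp) (by simp [hg]) hvg)
  have habs : ∀ {j}, EC j (indSet (F ∪ {v}) L) v f →
      ∀ x ∈ F ∪ {v}, ∃ a ∈ F, EC j (indSet (F ∪ {v}) L) x a := by
    intro j h x hx
    rcases Finset.mem_union.1 hx with hx | hx
    · exact ⟨x, hx, EC.refl _ _ _⟩
    · rw [Finset.mem_singleton.1 hx]; exact ⟨f, hf, h⟩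
  by_cases hE : EC 0 (indSet F L) f g
  · refine Or.inr ⟨rank_absorb_le hL (habs hvf'), ?_⟩
    have hcut : ∀ U, cut (indSet F L) U + sep U f v + sep U g v
        ≤ cut (indSet (F ∪ {v}) L) U := by
      intro U
      have hdis : Disjoint F {v} := Finset.disjoint_singleton_right.2 hv
      have h1 := cut_split (L := L) hdis U
      have h2 := sum_sep_le_cut_between (L := L) hdis ![f, g] ![v, v]
        (by intro i; fin_cases i <;> simp [hf, hg]) (by intro i; fin_cases i <;> simp)
        (by intro i; fin_cases i <;> simp [adj_comm.1 hvf, adj_comm.1 hvg])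
        (by intro i j; fin_cases i <;> fin_cases j <;> simp [hfg, hfg.symm]) U
      simp only [Fin.sum_univ_two, Matrix.cons_val_zero, Matrix.cons_val_one] at h2
      omega
    have key : ∀ U, cut (indSet (F ∪ {v}) L) U ≤ 1 → U v = U f ∧ U v = U g := by
      intro U hU
      have h1 := hcut U
      by_cases h2 : U f = U v
      · by_cases h3 : U g = U v
        · exact ⟨h2.symm, h3.symm⟩
        · rw [sep_of_ne h3] at h1
          exact ⟨h2.symm, h2.symm.trans (hE U (by omega))⟩
      · rw [sep_of_ne h2] at h1
        have h4 := hE U (by omega)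
        rw [sep_of_ne (fun h => h2 (h4.trans h))] at h1
        omega
    refine rank_merge_le hL (habs fun U hU => (key U hU).1) hf hg ?_
      fun U hU => (key U hU).1.symm.trans (key U hU).2
    intro h1
    refine hfg (hC f g fun U hU => ?_)
    by_contra hne
    have h2 := hcut U
    have h3 := sep_triangle U f v g
    rw [sep_of_ne hne, sep_comm U v] at h3
    exact hne (h1 U (by omega))
  · exact Or.inl ⟨rank_merge_le hL (habs hvf') hf hg hE (hvf'.symm.trans hvg'),
      (rank_union_le hL F {v}).trans (by simp)⟩

theorem rank_keep_two {L : Edges} {F : Finset ℕ} {v w f g : ℕ} (hf : f ∈ F) (hg : g ∈ F)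
    (hvw : adj L v w = true) (hvf : adj L v f = true) (hwg : adj L w g = true)
    (hE : ¬ EC 0 (indSet F L) f g) :
    rank 0 (indSet (F ∪ {v, w}) L) (F ∪ {v, w}) + 1 ≤ rank 0 (indSet F L) F ∧
      rank 1 (indSet (F ∪ {v, w}) L) (F ∪ {v, w}) ≤ rank 1 (indSet F L) F + 2 := by
  have hL : (indSet F L).Sublist (indSet (F ∪ {v, w}) L) :=
    indSet_sublist Finset.subset_union_left L
  have h1 : EC 0 (indSet (F ∪ {v, w}) L) v f :=
    EC.of_adj (adj_indSet (by simp) (by simp [hf]) hvf)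
  have h2 : EC 0 (indSet (F ∪ {v, w}) L) w g :=
    EC.of_adj (adj_indSet (by simp) (by simp [hg]) hwg)
  have h3 : EC 0 (indSet (F ∪ {v, w}) L) v w :=
    EC.of_adj (adj_indSet (by simp) (by simp) hvw)
  refine ⟨rank_merge_le hL ?_ hf hg hE (h1.symm.trans (h3.trans h2)),
    (rank_union_le hL F {v, w}).trans (Nat.add_le_add_left Finset.card_le_two _)⟩
  intro x hx
  simp only [Finset.mem_union, Finset.mem_insert, Finset.mem_singleton] at hx
  rcases hx with hx | rfl | rfl
  · exact ⟨x, hx, EC.refl _ _ _⟩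
  · exact ⟨f, hf, h1⟩
  · exact ⟨g, hg, h2⟩

/-! ### Some rule always applies -/

theorem conn_component (L : Edges) (F : Finset ℕ) (f : ℕ) (A : Finset ℕ)
    (hA : ∀ z, z ∈ A ↔ z ∈ F ∧ EC 0 (indSet F L) f z) : Conn L A := by
  intro U hU
  have : ∀ x ∈ A, U x = (if f ∈ A then U f else true) := by
    intro x hx
    -- No edge inside `F` leaves `A`, so `U` on `A`, extended by a constant, is still an empty cut.
    have h := (hA x).1 hx |>.2 (fun z => if z ∈ A then U z else if f ∈ A then U f else true) (by
      rw [Nat.le_zero, cut_eq_zero]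
      intro e he
      obtain ⟨heL, h1, h2⟩ := mem_indSet.1 he
      by_cases hee : e.1 = e.2
      · rw [hee]
      have hadj : EC 0 (indSet F L) e.1 e.2 :=
        EC.of_adj (adj_indSet h1 h2 (adj_iff.2 ⟨hee, Or.inl heL⟩))
      have hiff : e.1 ∈ A ↔ e.2 ∈ A := by
        rw [hA, hA]
        exact ⟨fun h => ⟨h2, h.2.trans hadj⟩, fun h => ⟨h1, h.2.trans hadj.symm⟩⟩
      by_cases h3 : e.1 ∈ A
      · simp only [h3, hiff.1 h3, if_true]
        exact cut_eq_zero.1 hU e (mem_indSet.2 ⟨heL, h3, hiff.1 h3⟩)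
      · simp only [h3, mt hiff.2 h3, if_false])
    simp only [hx, if_true] at h
    rw [← h]
    by_cases hfA : f ∈ A <;> simp [hfA]
  intro x hx y hy
  rw [this x hx, this y hy]

/-- The hypotheses `hD`, `hA1`, `hA2`, `hB` and `hC` say that the five rules fail. The proof
examines a minimal nonempty set `D` of undecided vertices whose edges to the rest of `R` all end in
one vertex `c`. It plays the part of a leaf of the cactus induced by `R`: its vertices have exactly
two undecided neighbours and one kept neighbour, which forces a forbidden triple. -/
theorem eq_empty_of_no_rule {L : Edges} {R F : Finset ℕ} (hdis : Disjoint R F)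
    (hends : ∀ v ∈ R, ∀ z, adj L v z = true → z ∈ R ∪ F) (hR : Cactus (indSet R L))
    (hD : ∀ u ∈ R, ∀ v ∈ R, ∀ w ∈ R, Cactus (indSet (F ∪ {u, v, w}) L))
    (hA1 : ∀ v ∈ R, ∀ u ∈ R ∪ F, ∃ z, adj L v z = true ∧ z ≠ u)
    (hA2 : ∀ v ∈ R, ∀ u ∈ R, ∀ w ∈ R ∪ F, adj L v u = true → adj L v w = true → u ≠ w →
      ∃ z, adj L v z = true ∧ z ≠ u ∧ z ≠ w)
    (hB : ∀ v ∈ R, ∀ f ∈ F, ∀ g ∈ F, adj L v f = true → adj L v g = true → f = g)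
    (hC : ∀ v ∈ R, ∀ w ∈ R, ∀ f ∈ F, ∀ g ∈ F, adj L v w = true → adj L v f = true →
      adj L w g = true → EC 0 (indSet F L) f g) : R = ∅ := by
  -- By `hA1` there are at least two neighbours, and by `hB` at most one of them is kept. If one of
  -- two is kept, `hA2` supplies a third, which is undecided.
  have two : ∀ v ∈ R, ∃ a ∈ R, ∃ b ∈ R, a ≠ b ∧ adj L v a = true ∧ adj L v b = true := by
    intro v hv
    have step : ∀ z1 ∈ R, adj L v z1 = true →
        ∃ a ∈ R, ∃ b ∈ R, a ≠ b ∧ adj L v a = true ∧ adj L v b = true := by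
      intro z1 hz1 h1
      obtain ⟨z2, h2, hne⟩ := hA1 v hv z1 (Finset.mem_union_left _ hz1)
      rcases Finset.mem_union.1 (hends v hv z2 h2) with hz2 | hz2
      · exact ⟨z1, hz1, z2, hz2, hne.symm, h1, h2⟩
      · obtain ⟨z3, h3, h31, h32⟩ :=
          hA2 v hv z1 hz1 z2 (Finset.mem_union_right _ hz2) h1 h2 hne.symm
        rcases Finset.mem_union.1 (hends v hv z3 h3) with hz3 | hz3
        · exact ⟨z1, hz1, z3, hz3, h31.symm, h1, h3⟩
        · exact absurd (hB v hv z3 hz3 z2 hz2 h3 h2) h32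
    obtain ⟨z1, h1, -⟩ := hA1 v hv v (Finset.mem_union_left _ hv)
    rcases Finset.mem_union.1 (hends v hv z1 h1) with hz1 | hz1
    · exact step z1 hz1 h1
    · obtain ⟨z2, h2, hne⟩ := hA1 v hv z1 (Finset.mem_union_right _ hz1)
      rcases Finset.mem_union.1 (hends v hv z2 h2) with hz2 | hz2
      · exact step z2 hz2 h2
      · exact absurd (hB v hv z2 hz2 z1 hz1 h2 h1) hne
  have hdisj : ∀ x ∈ R, x ∉ F := fun x hx hx' => Finset.disjoint_left.1 hdis hx hx'
  -- a set `D` all of whose edges to other undecided vertices go to the vertex `c`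
  have pod : ∀ n (D : Finset ℕ) (c : ℕ), D.card = n → D ⊆ R → c ∈ R → c ∉ D → D.Nonempty →
      (∀ z ∈ D, ∀ z' ∈ R, adj L z z' = true → z' ∈ D ∨ z' = c) → False := by
    intro n
    induction n using Nat.strong_induction_on with
    | _ n ih =>
    intro D c hn hDR hcR hcD hne hpod
    -- The vertices that deleting `x` cuts off from `c` would form a smaller set of the same kind,
    -- hanging on `x`.
    have conn : ∀ x ∈ D, Conn L ((insert c D).erase x) := by
      intro x hx U hU
      by_cases hex : ∃ z ∈ D.erase x, U z ≠ U c
      · exfalso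
        refine ih ((D.erase x).filter fun z => U z ≠ U c).card ?_ _ x rfl ?_ (hDR hx) ?_ ?_ ?_
        · rw [← hn]
          exact lt_of_le_of_lt (Finset.card_filter_le _ _) (Finset.card_erase_lt_of_mem hx)
        · exact (Finset.filter_subset _ _).trans ((Finset.erase_subset _ _).trans hDR)
        · simp
        · obtain ⟨z, hz, h⟩ := hex
          exact ⟨z, Finset.mem_filter.2 ⟨hz, h⟩⟩
        · intro z hz z' hz' hadj
          obtain ⟨hz, hUz⟩ := Finset.mem_filter.1 hz
          obtain ⟨hzx, hzD⟩ := Finset.mem_erase.1 hz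
          by_cases hzx' : z' = x
          · exact Or.inr hzx'
          have hz'A : z' ∈ (insert c D).erase x := by
            refine Finset.mem_erase.2 ⟨hzx', Finset.mem_insert.2 ?_⟩
            exact (hpod z hzD z' hz' hadj).symm
          have hzA : z ∈ (insert c D).erase x :=
            Finset.mem_erase.2 ⟨hzx, Finset.mem_insert_of_mem hzD⟩
          have hUzz : U z = U z' :=
            EC.of_adj (adj_indSet hzA hz'A hadj) U (Nat.le_zero.2 hU)
          refine Or.inl (Finset.mem_filter.2 ⟨Finset.mem_erase.2 ⟨hzx', ?_⟩, hUzz ▸ hUz⟩)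
          rcases hpod z hzD z' hz' hadj with h | h
          · exact h
          · exact absurd (hUzz.trans (h ▸ rfl)) hUz
      · push Not at hex
        have : ∀ y ∈ (insert c D).erase x, U y = U c := by
          intro y hy
          obtain ⟨hyx, hy⟩ := Finset.mem_erase.1 hy
          rcases Finset.mem_insert.1 hy with rfl | hy
          · rfl
          · exact hex y (Finset.mem_erase.2 ⟨hyx, hy⟩)
        intro y hy y' hy'
        rw [this y hy, this y' hy']
    -- A third undecided neighbour would give three edges from `x` to the connected set `D ∪ {c}`
    -- without `x`, although `R` induces a cactus forest.
    have deg : ∀ x ∈ D, ∀ a ∈ R, ∀ b ∈ R, a ≠ b → adj L x a = true → adj L x b = true →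
        ∀ z ∈ R, adj L x z = true → z = a ∨ z = b := by
      intro x hx a ha b hb hab hxa hxb z hz hxz
      by_contra hcon
      push Not at hcon
      have hmem : ∀ y ∈ R, adj L x y = true → y ∈ (insert c D).erase x := by
        intro y hy hxy
        refine Finset.mem_erase.2 ⟨fun h => (adj_iff.1 hxy).1 h.symm, Finset.mem_insert.2 ?_⟩
        exact (hpod x hx y hy hxy).symm
      refine not_cactus_of_three (L := L) (A := (insert c D).erase x) (B := {x}) (by simp)
        (conn x hx) (Conn.singleton L x) ![a, b, z] ![x, x, x]
        (by intro i; fin_cases i <;> simp only [] <;> [exact hmem a ha hxa; exact hmem b hb hxb;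
              exact hmem z hz hxz])
        (by intro i; fin_cases i <;> simp)
        (by intro i; fin_cases i <;> simp [adj_comm.1 hxa, adj_comm.1 hxb, adj_comm.1 hxz])
        (by intro i j; fin_cases i <;> fin_cases j <;>
              simp [hab, hab.symm, hcon.1, hcon.2, hcon.1.symm, hcon.2.symm])
        (hR.mono (indSet_sublist ?_ L))
      intro y hy
      simp only [Finset.mem_union, Finset.mem_erase, Finset.mem_insert,
        Finset.mem_singleton] at hy
      rcases hy with ⟨_, rfl | hy⟩ | rfl
      · exact hcR
      · exact hDR hy
      · exact hDR hx
    -- The third neighbour supplied by `hA2` cannot be undecided, by `deg`.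
    have attach : ∀ x ∈ D, ∃ f ∈ F, adj L x f = true := by
      intro x hx
      obtain ⟨a, ha, b, hb, hab, hxa, hxb⟩ := two x (hDR hx)
      obtain ⟨z, hz, hza, hzb⟩ := hA2 x (hDR hx) a ha b (Finset.mem_union_left _ hb) hxa hxb hab
      rcases Finset.mem_union.1 (hends x (hDR hx) z hz) with h | h
      · rcases deg x hx a ha b hb hab hxa hxb z h hz with h | h <;> contradiction
      · exact ⟨z, h, hz⟩
    -- For a path `a`, `x`, `b` inside `D`, the kept neighbours of its three vertices lie in one
    -- component of `F` by `hC`. Three edges then join this component to the path, against `hD`.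
    by_cases hinner : ∃ x ∈ D, ∃ a ∈ D, ∃ b ∈ D, a ≠ b ∧ adj L x a = true ∧ adj L x b = true
    · obtain ⟨x, hx, a, ha, b, hb, hab, hxa, hxb⟩ := hinner
      obtain ⟨f, hf, hxf⟩ := attach x hx
      obtain ⟨fa, hfa, hafa⟩ := attach a ha
      obtain ⟨fb, hfb, hbfb⟩ := attach b hb
      have e1 := hC x (hDR hx) a (hDR ha) f hf fa hfa hxa hxf hafa
      have e2 := hC x (hDR hx) b (hDR hb) f hf fb hfb hxb hxf hbfb
      classical
      let A := F.filter fun z => EC 0 (indSet F L) f z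
      have hA : ∀ z, z ∈ A ↔ z ∈ F ∧ EC 0 (indSet F L) f z := fun z => Finset.mem_filter
      have hxa' := (adj_iff.1 hxa).1
      have hxb' := (adj_iff.1 hxb).1
      refine not_cactus_of_three (L := L) (A := A) (B := {a, b, x}) ?_
        (conn_component L F f A hA)
        (((Conn.singleton L x).insert (Finset.mem_singleton_self x) (adj_comm.1 hxb)).insert
          (by simp) (adj_comm.1 hxa)) ![f, fa, fb] ![x, a, b]
        (by intro i; fin_cases i <;> simp [hA, hf, hfa, hfb, e1, e2, EC.refl])
        (by intro i; fin_cases i <;> simp)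
        (by intro i; fin_cases i <;> simp [adj_comm.1 hxf, adj_comm.1 hafa, adj_comm.1 hbfb])
        (by intro i j; fin_cases i <;> fin_cases j <;>
              simp [hab, hab.symm, hxa', hxb', hxa'.symm, hxb'.symm])
        ((hD a (hDR ha) b (hDR hb) x (hDR hx)).mono (indSet_sublist
          (Finset.union_subset_union (Finset.filter_subset _ _) le_rfl) L))
      rw [Finset.disjoint_left]
      intro z hz hz'
      have hzF := ((hA z).1 hz).1
      simp only [Finset.mem_insert, Finset.mem_singleton] at hz'
      rcases hz' with rfl | rfl | rfl
      · exact hdisj _ (hDR ha) hzF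
      · exact hdisj _ (hDR hb) hzF
      · exact hdisj _ (hDR hx) hzF
    -- Otherwise every vertex of `D` is adjacent to `c` and to a vertex of `D`. Adjacent `x` and `y`
    -- in `D` form a triangle with `c`, and three edges join `x` to the connected set made of `c`,
    -- `y` and a component of `F`.
    · push Not at hinner
      have nbrs : ∀ x ∈ D, adj L x c = true ∧ ∃ y ∈ D, adj L x y = true := by
        intro x hx
        obtain ⟨a, ha, b, hb, hab, hxa, hxb⟩ := two x (hDR hx)
        rcases hpod x hx a ha hxa with haD | rfl
        · rcases hpod x hx b hb hxb with hbD | rfl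
          · exact absurd hxb (by simpa using hinner x hx a haD b hbD hab hxa)
          · exact ⟨hxb, a, haD, hxa⟩
        · rcases hpod x hx b hb hxb with hbD | rfl
          · exact ⟨hxa, b, hbD, hxb⟩
          · exact absurd rfl hab
      obtain ⟨x, hx⟩ := hne
      obtain ⟨hxc, y, hy, hxy⟩ := nbrs x hx
      obtain ⟨hyc, -⟩ := nbrs y hy
      obtain ⟨f, hf, hxf⟩ := attach x hx
      obtain ⟨g, hg, hyg⟩ := attach y hy
      have e1 := hC x (hDR hx) y (hDR hy) f hf g hg hxy hxf hyg
      classical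
      let A := F.filter fun z => EC 0 (indSet F L) f z
      have hA : ∀ z, z ∈ A ↔ z ∈ F ∧ EC 0 (indSet F L) f z := fun z => Finset.mem_filter
      have hgA : g ∈ A := (hA g).2 ⟨hg, e1⟩
      have hyf : y ≠ f := fun h => hdisj y (hDR hy) (h ▸ hf)
      have hcf : c ≠ f := fun h => hdisj c hcR (h ▸ hf)
      have hyc' := (adj_iff.1 hyc).1
      refine not_cactus_of_three (L := L) (A := insert c (insert y A)) (B := {x}) ?_
        (((conn_component L F f A hA).insert hgA hyg).insert (Finset.mem_insert_self _ _)
          (adj_comm.1 hyc)) (Conn.singleton L x) ![y, c, f] ![x, x, x]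
        (by intro i; fin_cases i <;> simp [hA, hf, EC.refl])
        (by intro i; fin_cases i <;> simp)
        (by intro i; fin_cases i <;> simp [adj_comm.1 hxy, adj_comm.1 hxc, adj_comm.1 hxf])
        (by intro i j; fin_cases i <;> fin_cases j <;>
              simp [hyf, hcf, hyc', hyf.symm, hcf.symm, hyc'.symm])
        ((hD c hcR y (hDR hy) x (hDR hx)).mono (indSet_sublist ?_ L))
      · rw [Finset.disjoint_singleton_right]
        simp only [Finset.mem_insert, hA, not_or, not_and]
        exact ⟨(adj_iff.1 hxc).1, (adj_iff.1 hxy).1, fun h => absurd h (hdisj x (hDR hx))⟩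
      · intro z hz
        simp only [Finset.mem_union, Finset.mem_insert, Finset.mem_singleton, hA] at hz ⊢
        tauto
  by_contra hne
  -- If `R` had a vertex `c`, then `R` without `c` would be such a set; it contains a neighbour of
  -- `c`.
  obtain ⟨c, hc⟩ := Finset.nonempty_iff_ne_empty.2 hne
  obtain ⟨a, ha, -, -, -, hca, -⟩ := two c hc
  exact pod _ (R.erase c) c rfl (Finset.erase_subset _ _) hc (by simp)
    ⟨a, Finset.mem_erase.2 ⟨fun h => (adj_iff.1 hca).1 h.symm, ha⟩⟩
    fun z _ z' hz' _ => by
      by_cases h : z' = c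
      · exact Or.inr h
      · exact Or.inl (Finset.mem_erase.2 ⟨h, hz'⟩)

/-! ### Cactus forests and edge cuts -/

section Translation

variable {α β : Type*}

theorem rotate_succ {l : ℕ} (c k : ℕ) :
    (⟨(c + (k + 1)) % (l + 2), Nat.mod_lt _ (by omega)⟩ : Fin (l + 2))
      = ⟨(c + k) % (l + 2), Nat.mod_lt _ (by omega)⟩ + 1 := by
  apply Fin.ext
  rw [Fin.val_add]
  simp only [← Nat.add_assoc]
  rw [Nat.add_mod (c + k) 1]
  simp

theorem rotate_inj {l : ℕ} (c : ℕ) {k k' : ℕ} (hk : k < l + 2) (hk' : k' < l + 2)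
    (h : (c + k) % (l + 2) = (c + k') % (l + 2)) : k = k' := by
  have h1 : k ≡ k' [MOD l + 2] := Nat.ModEq.add_left_cancel' c h
  exact Nat.ModEq.eq_of_lt_of_lt h1 hk hk'

theorem rotate_surj {l : ℕ} (c : ℕ) (i : Fin (l + 2)) :
    ∃ k < l + 2, (⟨(c + k) % (l + 2), Nat.mod_lt _ (by omega)⟩ : Fin (l + 2)) = i := by
  have hinj : Function.Injective fun k : Fin (l + 2) =>
      (⟨(c + k) % (l + 2), Nat.mod_lt _ (by omega)⟩ : Fin (l + 2)) := by
    intro k k' h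
    exact Fin.ext (rotate_inj c k.2 k'.2 (Fin.mk.inj_iff.1 h))
  obtain ⟨k, hk⟩ := Finite.injective_iff_surjective.1 hinj i
  exact ⟨k, k.2, hk⟩

theorem cyclic_induction {l : ℕ} {P : Fin (l + 2) → Prop} {i : Fin (l + 2)} (hi : P i)
    (h : ∀ j, P j → P (j + 1)) (j : Fin (l + 2)) : P j := by
  obtain ⟨k, -, rfl⟩ := rotate_surj i j
  induction k with
  | zero => convert hi using 1; exact Fin.ext (by simp [Nat.mod_eq_of_lt i.2])
  | succ k ih => rw [rotate_succ]; exact h _ ih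

/-- Two cycles with a common edge are equal. -/
def UniqueCycles (G : Graph α β) : Prop :=
  ∀ e F F', IsCycle G F → IsCycle G F' → e ∈ F → e ∈ F' → F = F'

theorem component_isLink {G : Graph α β} {x a b : α} {e : β} :
    (component G x).IsLink e a b ↔ G.IsLink e a b ∧ Relation.ReflTransGen G.Adj x a
      ∧ Relation.ReflTransGen G.Adj x b := Iff.rfl

theorem reach_symm {G : Graph α β} {x y : α} (h : Relation.ReflTransGen G.Adj x y) :
    Relation.ReflTransGen G.Adj y x := by
  induction h with
  | refl => exact .refl
  | tail _ h ih => exact .head h.symm ih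

/-- A cycle stays inside one component, so the division into components plays no role for the
condition on cycles. -/
theorem isCactusForest_iff_uniqueCycles {G : Graph α β} :
    IsCactusForest G ↔ UniqueCycles G := by
  constructor
  · rintro h e F F' ⟨l, v, f, hv, hf, hl, rfl⟩ hF' ⟨i, rfl⟩ he'
    have lift : ∀ F, f i ∈ F → IsCycle G F → IsCycle (component G (v i)) F := by
      rintro F hi ⟨l', v', f', hv', hf', hl', rfl⟩
      refine ⟨l', v', f', hv', hf', ?_, rfl⟩
      obtain ⟨j, hj⟩ := hi
      have h0 : Relation.ReflTransGen G.Adj (v i) (v' j) := by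
        rcases (hj ▸ hl' j).eq_and_eq_or_eq_and_eq (hl i) with h | h
        · rw [h.1]
        · rw [h.1]; exact .single ⟨_, hl i⟩
      have h1 : ∀ j, Relation.ReflTransGen G.Adj (v i) (v' j) :=
        cyclic_induction h0 fun j hj => hj.tail ⟨_, hl' j⟩
      exact fun j => component_isLink.2 ⟨hl' j, h1 j, h1 (j + 1)⟩
    exact (h (v i) (hl i).left_mem).2 (f i)
      ⟨_, _, component_isLink.2 ⟨hl i, .refl, .single ⟨_, hl i⟩⟩⟩ _ F'
      (lift _ ⟨i, rfl⟩ ⟨l, v, f, hv, hf, hl, rfl⟩) (lift _ he' hF') ⟨i, rfl⟩ he'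
  · intro h x _
    have lower : ∀ F, IsCycle (component G x) F → IsCycle G F := by
      rintro F ⟨l, v, f, hv, hf, hl, rfl⟩
      exact ⟨l, v, f, hv, hf, fun i => (component_isLink.1 (hl i)).1, rfl⟩
    refine ⟨⟨⟨x, Relation.ReflTransGen.refl⟩, ?_⟩,
      fun e _ F F' hF hF' => h e F F' (lower F hF) (lower F' hF')⟩
    have from_x : ∀ y, Relation.ReflTransGen G.Adj x y →
        Relation.ReflTransGen (component G x).Adj x y := by
      intro y hy
      induction hy with
      | refl => exact .refl
      | tail hab hbc ih =>
        obtain ⟨e, he⟩ := hbc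
        exact ih.tail ⟨e, component_isLink.2 ⟨he, hab, hab.tail ⟨e, he⟩⟩⟩
    intro y hy z hz
    exact (reach_symm (from_x y hy)).trans (from_x z hz)

/-- The edges leaving `U`. -/
def cross (G : Graph α β) (U : Set α) : Set β := {e | ∃ x y, G.IsLink e x y ∧ x ∈ U ∧ y ∉ U}

/-- An edge closing a walk lies on a cycle. -/
theorem exists_cycle {G : Graph α β} {e : β} {a b : α} {D : Set β} (he : G.IsLink e a b)
    (hab : a ≠ b) (heD : e ∉ D)
    (h : Relation.ReflTransGen (fun u v => ∃ f ∈ D, G.IsLink f u v) b a) :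
    ∃ F, IsCycle G F ∧ e ∈ F ∧ F ⊆ insert e D := by
  have hwalk : ∃ n, ∃ (v : ℕ → α) (f : ℕ → β), v 0 = b ∧ v n = a ∧
      ∀ i < n, f i ∈ D ∧ G.IsLink (f i) (v i) (v (i + 1)) := by
    clear he hab
    induction h with
    | refl => exact ⟨0, fun _ => b, fun _ => e, rfl, rfl, by omega⟩
    | @tail y z _ hyz ih =>
      obtain ⟨n, v, f, h0, hn, hs⟩ := ih
      obtain ⟨g, hg, hgl⟩ := hyz
      refine ⟨n + 1, fun i => if i ≤ n then v i else z, fun i => if i < n then f i else g,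
        by simp [h0], by simp, fun i hi => ?_⟩
      by_cases hin : i < n
      · have h1 : i + 1 ≤ n := hin
        simpa [hin, hin.le, h1] using hs i hin
      · have : i = n := by omega
        subst this
        simp [hg, hn, hgl]
  classical
  -- In a walk of minimal length the vertices are distinct, since the part between two visits of a
  -- vertex could be cut out. Then the edges are distinct as well, and `e` closes the walk to a
  -- cycle.
  obtain ⟨v, f, h0, hn, hs⟩ := Nat.find_spec hwalk
  have hmin := fun m hm => Nat.find_min hwalk (m := m) hm
  set n := Nat.find hwalk
  have hvinj : ∀ i j, i < j → j ≤ n → v i ≠ v j := by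
    intro i j hij hj hvij
    refine hmin (n - (j - i)) (by omega) ⟨fun k => if k ≤ i then v k else v (k + (j - i)),
      fun k => if k < i then f k else f (k + (j - i)), by simp [h0], ?_, fun k hk => ?_⟩
    · by_cases hni : n - (j - i) ≤ i
      · have e1 : n - (j - i) = i := by omega
        have e2 : j = n := by omega
        simp only [e1, le_refl, if_true]
        rw [hvij, e2, hn]
      · simp only [hni, if_false]
        rw [show n - (j - i) + (j - i) = n by omega, hn]
    · rcases lt_trichotomy k i with h | h | h
      · have h1 : k + 1 ≤ i := h
        simpa [h, h.le, h1] using hs k (by omega)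
      · subst h
        simp only [lt_irrefl, if_false, le_refl, if_true, Nat.not_succ_le_self]
        rw [show k + 1 + (j - k) = k + (j - k) + 1 by omega, hvij,
          show v j = v (k + (j - k)) by congr 1; omega]
        exact hs _ (by omega)
      · simp only [not_lt.2 h.le, not_le.2 h, if_false, not_le.2 (show i < k + 1 by omega)]
        rw [show k + 1 + (j - i) = k + (j - i) + 1 by omega]
        exact hs _ (by omega)
  have hv : ∀ i j, i ≤ n → j ≤ n → v i = v j → i = j := by
    intro i j hi hj h
    rcases lt_trichotomy i j with hij | hij | hij
    · exact absurd h (hvinj i j hij hj)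
    · exact hij
    · exact absurd h.symm (hvinj j i hij hi)
  have hfinj : ∀ i j, i < n → j < n → f i = f j → i = j := by
    intro i j hi hj h
    rcases (h ▸ (hs i hi).2).eq_and_eq_or_eq_and_eq (hs j hj).2 with h1 | h1
    · exact hv i j hi.le hj.le h1.1
    · have e1 := hv i (j + 1) hi.le hj h1.1
      have e2 := hv (i + 1) j hi hj.le h1.2
      omega
  obtain ⟨m, hm⟩ : ∃ m, n = m + 1 := by
    refine Nat.exists_eq_succ_of_ne_zero fun hz => hab ?_
    rw [← hn, ← h0, hz]
  refine ⟨Set.range fun i : Fin (m + 2) => if i.val = m + 1 then e else f i,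
    ⟨m, fun i => v i, fun i => if i.val = m + 1 then e else f i, ?_, ?_, ?_, rfl⟩,
    ⟨Fin.last (m + 1), by simp⟩, ?_⟩
  · intro i j hij
    exact Fin.ext (hv i j (by omega) (by omega) hij)
  · intro i j hij
    have hi := i.2
    have hj := j.2
    apply Fin.ext
    simp only at hij
    split_ifs at hij with h1 h2 h2
    · omega
    · exact absurd (hij ▸ (hs j (by omega)).1) heD
    · exact absurd (hij ▸ (hs i (by omega)).1) heD
    · exact hfinj i j (by omega) (by omega) hij
  · intro i
    have hi := i.2
    by_cases h1 : i.val = m + 1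
    · have : i = Fin.last (m + 1) := Fin.ext h1
      subst this
      simpa [h0, ← hm, hn] using he
    · have h2 : (i + 1).val = i.val + 1 := Fin.val_add_one_of_lt (Fin.lt_def.2 (by simp; omega))
      simp only [h1, if_false, h2]
      exact (hs i (by omega)).2
  · rintro _ ⟨i, rfl⟩
    have hi := i.2
    by_cases h1 : i.val = m + 1
    · simp [h1]
    · simp only [h1, if_false]
      exact Set.mem_insert_of_mem _ (hs i (by omega)).1

/-- The last departure from `x` on a walk to `y` is what is needed: the rest of the walk avoids `x`.
-/
theorem exists_departure {G : Graph α β} {x y : α} (h : Relation.ReflTransGen G.Adj x y)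
    (hxy : y ≠ x) : ∃ p, p ≠ x ∧ G.Adj x p ∧
      Relation.ReflTransGen (fun u v => G.Adj u v ∧ u ≠ x ∧ v ≠ x) p y := by
  induction h with
  | refl => exact absurd rfl hxy
  | @tail z y _ hzy ih =>
    by_cases hz : z = x
    · subst hz; exact ⟨y, hxy, hzy, .refl⟩
    · obtain ⟨p, hp, hxp, hpz⟩ := ih hz
      exact ⟨p, hp, hxp, hpz.tail ⟨hzy, hz, hxy⟩⟩

theorem IsCycle.exists_other_edge {G : Graph α β} {F : Set β} (hF : IsCycle G F) {e : β}
    {x p : α} (he : G.IsLink e x p) (heF : e ∈ F) : ∃ g ∈ F, g ≠ e ∧ ∃ q, G.IsLink g x q := by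
  obtain ⟨l, v, f, hv, hf, hl, rfl⟩ := hF
  obtain ⟨i, rfl⟩ := heF
  have hne : ∀ i : Fin (l + 2), i + 1 ≠ i := fun i h => by simp at h
  rcases he.left_eq_or_eq (hl i) with rfl | rfl
  · refine ⟨f (i - 1), ⟨_, rfl⟩, fun h => ?_, v (i - 1), ?_⟩
    · have := hf h
      exact hne (i - 1) (by rw [sub_add_cancel]; exact this.symm)
    · have := (hl (i - 1)).symm
      rwa [sub_add_cancel] at this
  · exact ⟨f (i + 1), ⟨_, rfl⟩, fun h => hne i (hf h), _, hl (i + 1)⟩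

/-- Let `e` be the edge of the last departure from `x` towards `y`, and `g` the other edge at `x` of
the only cycle through `e`. If `x` still reached `y` without `e` and `g`, then so would the far end
of `e`, and `e` would lie on a cycle avoiding `g`. So the vertices reachable from `x` without these
two edges form the desired side. -/
theorem UniqueCycles.exists_cut {G : Graph α β} (hG : UniqueCycles G) {x y : α} (hxy : x ≠ y) :
    ∃ U : Set α, x ∈ U ∧ y ∉ U ∧ (cross G U).encard ≤ 2 := by
  by_cases hreach : Relation.ReflTransGen G.Adj x y
  · obtain ⟨p, hpx, ⟨e, he⟩, hpy⟩ := exists_departure hreach hxy.symm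
    -- If `e` lies on no cycle, `g = e` serves.
    obtain ⟨g, ⟨q, hgq⟩, hg⟩ : ∃ g, (∃ q, G.IsLink g x q) ∧
        ∀ F, IsCycle G F → e ∈ F → ¬ F ⊆ insert e {f | f ≠ e ∧ f ≠ g} := by
      by_cases hC : ∃ C, IsCycle G C ∧ e ∈ C
      · obtain ⟨C, hC, heC⟩ := hC
        obtain ⟨g, hgC, hge, hgx⟩ := hC.exists_other_edge he heC
        refine ⟨g, hgx, fun F hF heF hsub => ?_⟩
        rcases hsub (hG e C F hC hF heC heF ▸ hgC) with h | h
        · exact hge h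
        · exact h.2 rfl
      · exact ⟨e, ⟨p, he⟩, fun F hF heF => absurd ⟨F, hF, heF⟩ hC⟩
    have hsymm : ∀ {u v}, Relation.ReflTransGen
        (fun u v => ∃ f ∈ {f | f ≠ e ∧ f ≠ g}, G.IsLink f u v) u v → Relation.ReflTransGen
        (fun u v => ∃ f ∈ {f | f ≠ e ∧ f ≠ g}, G.IsLink f u v) v u := by
      intro u v h
      induction h with
      | refl => exact .refl
      | tail _ h ih => exact .head (h.imp fun f hf => ⟨hf.1, hf.2.symm⟩) ih
    refine ⟨{u | Relation.ReflTransGen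
      (fun u v => ∃ f ∈ {f | f ≠ e ∧ f ≠ g}, G.IsLink f u v) x u}, .refl, fun hy => ?_, ?_⟩
    · have hpy' : Relation.ReflTransGen
          (fun u v => ∃ f ∈ {f | f ≠ e ∧ f ≠ g}, G.IsLink f u v) p y := by
        refine Relation.ReflTransGen.mono ?_ _ _ hpy
        rintro u v ⟨⟨f, hf⟩, hu, hv⟩
        refine ⟨f, ⟨?_, ?_⟩, hf⟩
        · rintro rfl
          rcases he.left_eq_or_eq hf with h | h
          · exact hu h.symm
          · exact hv h.symm
        · rintro rfl
          rcases hgq.left_eq_or_eq hf with h | h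
          · exact hu h.symm
          · exact hv h.symm
      obtain ⟨F, hF, heF, hsub⟩ := exists_cycle he hpx.symm (D := {f | f ≠ e ∧ f ≠ g})
        (fun h => h.1 rfl) (hpy'.trans (hsymm hy))
      exact hg F hF heF hsub
    · refine (Set.encard_le_encard (t := {e, g}) ?_).trans (by
        refine (Set.encard_insert_le _ _).trans ?_
        rw [Set.encard_singleton]; rfl)
      rintro f ⟨u, v, hf, hu, hv⟩
      by_contra hcon
      simp only [Set.mem_insert_iff, Set.mem_singleton_iff, not_or] at hcon
      exact hv (hu.tail ⟨f, hcon, hf⟩)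
  · refine ⟨{u | Relation.ReflTransGen G.Adj x u}, .refl, hreach, ?_⟩
    have : cross G {u | Relation.ReflTransGen G.Adj x u} = ∅ := by
      refine Set.eq_empty_of_forall_notMem ?_
      rintro f ⟨u, v, hf, hu, hv⟩
      exact hv (hu.tail ⟨f, hf⟩)
    rw [this]
    simp

/-- A cycle that shares an edge with `F` and is not contained in `F` would run outside `F` from one
vertex of `F` to another. Together with the two arcs of `F` this would join the two vertices by
three edge-disjoint paths. -/
theorem uniqueCycles_of_cuts {G : Graph α β} (hG : ∀ x ∈ G.vertexSet, ∀ y ∈ G.vertexSet, x ≠ y →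
    ∃ U : Set α, x ∈ U ∧ y ∉ U ∧ (cross G U).encard ≤ 2) : UniqueCycles G := by
  have sub : ∀ e F F', IsCycle G F → IsCycle G F' → e ∈ F → e ∈ F' → F' ⊆ F := by
    rintro e F F' ⟨l, v, f, hv, hf, hl, rfl⟩ ⟨l', v', f', hv', hf', hl', rfl⟩ he ⟨i, rfl⟩
    -- A cut between two vertices of the cycle `F` contains an edge of each arc of `F`. With at most
    -- two edges it contains no others, so no walk that avoids the edges of `F` crosses it.
    have sepd : ∀ a b, Relation.ReflTransGen
        (fun u w => ∃ g ∉ Set.range f, G.IsLink g u w) (v a) (v b) → v a = v b := by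
      intro a b hab
      by_contra hne
      obtain ⟨U, ha, hb, hU⟩ := hG _ (hl a).left_mem _ (hl b).left_mem hne
      obtain ⟨c, hc, hc'⟩ : ∃ c, v c ∈ U ∧ v (c + 1) ∉ U := by
        by_contra hcon
        push Not at hcon
        exact hb (cyclic_induction (P := fun i => v i ∈ U) ha hcon b)
      obtain ⟨d, hd, hd'⟩ : ∃ d, v d ∉ U ∧ v (d + 1) ∈ U := by
        by_contra hcon
        push Not at hcon
        exact cyclic_induction (P := fun i => v i ∉ U) hb hcon a ha
      have hcd : f c ≠ f d := fun h => hd (hf h ▸ hc)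
      have hsub : {f c, f d} ⊆ cross G U := by
        rintro g (rfl | rfl)
        · exact ⟨_, _, hl c, hc, hc'⟩
        · exact ⟨_, _, (hl d).symm, hd', hd⟩
      have heq : {f c, f d} = cross G U :=
        Set.Finite.eq_of_subset_of_encard_le (by simp) hsub (by rwa [Set.encard_pair hcd])
      refine hb ?_
      have hall : ∀ w, Relation.ReflTransGen
          (fun u w => ∃ g ∉ Set.range f, G.IsLink g u w) (v a) w → w ∈ U := by
        intro w hw
        induction hw with
        | refl => exact ha
        | tail _ h ih =>
          obtain ⟨g, hg, hgl⟩ := h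
          by_contra hw
          have : g ∈ ({f c, f d} : Set β) := heq ▸ ⟨_, _, hgl, ih, hw⟩
          rcases this with rfl | rfl <;> exact hg ⟨_, rfl⟩
      exact hall _ hab
    have onF : ∀ {g u w}, g ∈ Set.range f → G.IsLink g u w → ∃ a, v a = u := by
      rintro _ u w ⟨a, rfl⟩ h
      rcases h.left_eq_or_eq (hl a) with h | h
      · exact ⟨a, h.symm⟩
      · exact ⟨a + 1, h.symm⟩
    -- The second cycle is followed from the far end of the common edge `f' i`; at position `l' + 1`
    -- it has returned to the other end of that edge.
    let idx : ℕ → Fin (l' + 2) := fun k => ⟨(i + 1 + k) % (l' + 2), Nat.mod_lt _ (by omega)⟩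
    have hidx : ∀ k, idx (k + 1) = idx k + 1 := fun k => rotate_succ _ k
    have hidx0 : idx (l' + 1) = i := by
      apply Fin.ext
      change (i.val + 1 + (l' + 1)) % (l' + 2) = i
      rw [show i.val + 1 + (l' + 1) = i.val + (l' + 2) by ring, Nat.add_mod_right,
        Nat.mod_eq_of_lt i.2]
    have hlink : ∀ k, G.IsLink (f' (idx k)) (v' (idx k)) (v' (idx (k + 1))) := by
      intro k; rw [hidx]; exact hl' _
    have hinj : ∀ k k', k < l' + 2 → k' < l' + 2 → v' (idx k) = v' (idx k') → k = k' := by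
      intro k k' hk hk' h
      exact rotate_inj _ hk hk' (Fin.mk.inj_iff.1 (hv' h))
    -- Either all edges so far belong to the first cycle, or the walk left it at an earlier position
    -- `t` and has avoided its edges since. In the second case `sepd` excludes a return to the first
    -- cycle at a vertex other than that of `t`.
    have walk : ∀ k, k ≤ l' + 1 →
        ((∀ t < k, f' (idx t) ∈ Set.range f) ∧ ∃ a, v a = v' (idx k)) ∨
        ∃ t < k, (∃ a, v a = v' (idx t)) ∧ Relation.ReflTransGen
          (fun u w => ∃ g ∉ Set.range f, G.IsLink g u w) (v' (idx t)) (v' (idx k)) := by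
      intro k
      induction k with
      | zero =>
        intro _
        refine Or.inl ⟨by omega, ?_⟩
        have h := (hl' i).symm
        have h2 : idx 0 = i + 1 := by
          apply Fin.ext
          change (i.val + 1 + 0) % (l' + 2) = _
          rw [Fin.val_add]; simp
        rw [h2]
        exact onF he h
      | succ k ih =>
        intro hk
        by_cases hmem : f' (idx k) ∈ Set.range f
        · rcases ih (by omega) with ⟨h1, _⟩ | ⟨t, ht, ⟨a, ha⟩, hw⟩
          · refine Or.inl ⟨fun t ht => ?_, onF hmem (hlink k).symm⟩
            rcases Nat.lt_succ_iff_lt_or_eq.1 ht with ht | rfl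
            · exact h1 t ht
            · exact hmem
          · obtain ⟨b, hb⟩ := onF hmem (hlink k)
            rw [← ha, ← hb] at hw
            have := sepd a b hw
            rw [ha, hb] at this
            have := hinj t k (by omega) (by omega) this
            omega
        · rcases ih (by omega) with ⟨_, h2⟩ | ⟨t, ht, ha, hw⟩
          · exact Or.inr ⟨k, by omega, h2, .single ⟨_, hmem, hlink k⟩⟩
          · exact Or.inr ⟨t, by omega, ha, hw.tail ⟨_, hmem, hlink k⟩⟩
    have hall : ∀ t < l' + 1, f' (idx t) ∈ Set.range f := by
      rcases walk (l' + 1) le_rfl with h | ⟨t, ht, ⟨a, ha⟩, hw⟩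
      · exact h.1
      · obtain ⟨b, hb⟩ := onF he (hl' i)
        rw [hidx0, ← ha, ← hb] at hw
        have h3 := sepd a b hw
        rw [ha, hb, ← hidx0] at h3
        have := hinj t _ (by omega) (by omega) h3
        omega
    rintro _ ⟨j, rfl⟩
    obtain ⟨k, hk, rfl⟩ := rotate_surj (i.val + 1) j
    rcases Nat.lt_succ_iff_lt_or_eq.1 hk with hk | rfl
    · exact hall k hk
    · change f' (idx (l' + 1)) ∈ _
      rw [hidx0]; exact he
  exact fun e F F' hF hF' he he' =>
    Set.Subset.antisymm (sub e F' F hF' hF he' he) (sub e F F' hF hF' he he')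

end Translation

/-- The edge list with vertices renamed to natural numbers. -/
def natEdges {n : ℕ} (E : List (Fin n × Fin n)) : Edges := E.map fun e => (e.1.val, e.2.val)

theorem cut_ind_ofFn {m : ℕ} (p : ℕ → Bool) (e : Fin m → ℕ × ℕ) (U : ℕ → Bool) :
    cut (ind p (List.ofFn e)) U
      = (Finset.univ.filter fun i => (p (e i).1 = true ∧ p (e i).2 = true) ∧
          U (e i).1 ≠ U (e i).2).card := by
  rw [Finset.card_filter]
  induction m with
  | zero => simp [cut, ind]
  | succ m ih =>
    rw [List.ofFn_succ, Fin.sum_univ_succ, ← ih, ind, List.filter_cons]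
    split_ifs with h1 h2 h2 <;> simp_all [cut_cons, sep, ind, Nat.add_comm]

theorem encard_cross {n : ℕ} (E : List (Fin n × Fin n)) (X : Set (Fin n)) (p U : ℕ → Bool)
    (V : Set (Fin n)) (hp : ∀ x : Fin n, p x = true ↔ x ∉ X) (hU : ∀ x : Fin n, U x = true ↔ x ∈ V) :
    (cross ((multigraph E).deleteVerts X) V).encard = cut (ind p (natEdges E)) U := by
  have h1 : natEdges E = List.ofFn fun i => ((E.get i).1.val, (E.get i).2.val) := by
    rw [natEdges]
    conv_lhs => rw [← List.ofFn_get E]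
    rw [List.map_ofFn]; rfl
  rw [h1, cut_ind_ofFn, ← Set.encard_coe_eq_coe_finsetCard]
  congr 1
  ext i
  simp only [cross, Graph.deleteVerts_isLink, Set.mem_ofPred_eq, Finset.coe_filter,
    Finset.mem_univ, true_and, hp]
  have hb : ∀ x y : Fin n, U x ≠ U y ↔ ((x ∈ V ∧ y ∉ V) ∨ (y ∈ V ∧ x ∉ V)) := by
    intro x y
    rw [← hU, ← hU]
    cases U x <;> cases U y <;> simp
  rw [hb]
  constructor
  · rintro ⟨x, y, ⟨h | h, hx, hy⟩, hxV, hyV⟩ <;> rw [h] <;> tauto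
  · rintro ⟨⟨h1, h2⟩, h | h⟩
    · exact ⟨_, _, ⟨Or.inl rfl, h1, h2⟩, h⟩
    · exact ⟨_, _, ⟨Or.inr rfl, h2, h1⟩, h⟩

theorem isCactusForest_deleteVerts_iff {n : ℕ} (E : List (Fin n × Fin n)) (X : Set (Fin n))
    (p : ℕ → Bool) (hp : ∀ x : Fin n, p x = true ↔ x ∉ X) :
    IsCactusForest ((multigraph E).deleteVerts X) ↔ Cactus (ind p (natEdges E)) := by
  rw [isCactusForest_iff_uniqueCycles]
  constructor
  · intro h x y hxy
    by_contra hne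
    -- A number that is not a vertex meets no edge, so an empty cut separates it from everything
    -- else.
    have iso : ∀ x y, x ≠ y → EC 2 (ind p (natEdges E)) x y → ∃ h : x < n, True := by
      intro x y hne hxy
      by_contra hx
      simp only [exists_prop, and_true] at hx
      have := hxy (fun z => z == x) (by
        refine le_trans (le_of_eq ?_) (Nat.zero_le 2)
        rw [cut_eq_zero]
        intro e he
        obtain ⟨e', -, rfl⟩ := List.mem_map.1 (mem_ind.1 he).1
        have h1 : e'.1.val ≠ x := by have := e'.1.2; omega
        have h2 : e'.2.val ≠ x := by have := e'.2.2; omega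
        simp [h1, h2])
      simp only [beq_self_eq_true] at this
      exact hne (beq_iff_eq.1 this.symm).symm
    obtain ⟨hx, -⟩ := iso x y hne hxy
    obtain ⟨hy, -⟩ := iso y x (Ne.symm hne) hxy.symm
    obtain ⟨V, hxV, hyV, hV⟩ := h.exists_cut (x := (⟨x, hx⟩ : Fin n)) (y := ⟨y, hy⟩)
      (fun h => hne (Fin.mk.inj_iff.1 h))
    classical
    have hU : ∀ z : Fin n, (fun z : ℕ => decide (∃ h : z < n, (⟨z, h⟩ : Fin n) ∈ V)) z = true
        ↔ z ∈ V := by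
      intro z; simp
    rw [encard_cross E X p (fun z => decide (∃ h : z < n, (⟨z, h⟩ : Fin n) ∈ V)) V hp hU] at hV
    have := hxy _ (by exact_mod_cast hV)
    rw [decide_eq_decide] at this
    exact hyV (by simpa [hy] using this.1 ⟨hx, hxV⟩)
  · intro h
    refine uniqueCycles_of_cuts fun x _ y _ hne => ?_
    have : ¬ EC 2 (ind p (natEdges E)) x y := fun hE => hne (Fin.ext (h _ _ hE))
    unfold EC at this
    push Not at this
    obtain ⟨U, hU, hUxy⟩ := this
    by_cases hx : U x = true
    · refine ⟨{z | U z = true}, hx, fun hy => hUxy (hx.trans hy.symm), ?_⟩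
      rw [encard_cross E X p U {z | U z = true} hp fun z => Iff.rfl]
      exact_mod_cast hU
    · refine ⟨{z | (!U z) = true}, by simpa using hx, fun hy => hUxy ?_, ?_⟩
      · simp at hx hy; rw [hx, hy]
      · rw [encard_cross E X p (fun z => !U z) {z | (!U z) = true} hp fun z => Iff.rfl, cut_not]
        exact_mod_cast hU

/-! ### Polynomial-time functions -/

/-- The number of nodes of a tree. -/
def Val.size : Val → ℕ
  | Val.nil => 1
  | Val.cons a b => a.size + b.size + 1

/-- Types whose elements are encoded as trees. -/
class Enc (α : Type) where
  /-- the encoding -/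
  enc : α → Val

open Enc (enc)

instance : Enc Unit := ⟨fun _ => Val.nil⟩
instance : Enc Bool := ⟨Val.ofBool⟩
instance : Enc ℕ := ⟨Val.ofNat⟩
instance {α β : Type} [Enc α] [Enc β] : Enc (α × β) := ⟨fun x => Val.cons (enc x.1) (enc x.2)⟩
instance {α : Type} [Enc α] : Enc (List α) := ⟨fun l => Val.ofList (l.map enc)⟩
instance {α : Type} [Enc α] : Enc (Option α) :=
  ⟨fun o => o.elim Val.nil fun a => Val.cons Val.nil (enc a)⟩

/-- The size of the encoding. -/
def sz {α : Type} [Enc α] (a : α) : ℕ := (enc a).size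

section Sizes

variable {α β : Type} [Enc α] [Enc β]

theorem sz_pair (a : α) (b : β) : sz (a, b) = sz a + sz b + 1 := rfl
theorem sz_nil : sz ([] : List α) = 1 := rfl
theorem sz_cons (a : α) (l : List α) : sz (a :: l) = sz a + sz l + 1 := rfl

theorem sz_nat (n : ℕ) : sz n = 2 * n + 1 := by
  induction n with
  | zero => rfl
  | succ n ih =>
    have : sz (n + 1) = 1 + sz n + 1 := rfl
    omega

theorem sz_bool_le (b : Bool) : sz b ≤ 3 := by cases b <;> decide

theorem sz_pos (a : α) : 1 ≤ sz a := by
  unfold sz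
  cases enc a <;> simp [Val.size]

theorem length_lt_sz (l : List α) : l.length < sz l := by
  induction l with
  | nil => simp [sz_nil]
  | cons a l ih => rw [sz_cons, List.length_cons]; omega

theorem sz_mem_lt {l : List α} {a : α} (h : a ∈ l) : sz a < sz l := by
  induction l with
  | nil => simp at h
  | cons b l ih =>
    rw [sz_cons]
    rcases List.mem_cons.1 h with rfl | h
    · have := sz_pos l; omega
    · have := ih h; omega

theorem sz_list_le {l : List α} {m : ℕ} (h : ∀ a ∈ l, sz a ≤ m) :
    sz l ≤ l.length * (m + 1) + 1 := by
  induction l with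
  | nil => simp [sz_nil]
  | cons a l ih =>
    rw [sz_cons, List.length_cons, Nat.add_mul]
    have := ih fun b hb => h b (List.mem_cons_of_mem _ hb)
    have := h a List.mem_cons_self
    omega

theorem sz_sublist {l l' : List α} (h : l.Sublist l') : sz l ≤ sz l' := by
  induction h with
  | slnil => exact le_rfl
  | cons a _ ih => rw [sz_cons]; omega
  | cons_cons a _ ih => rw [sz_cons, sz_cons]; omega

theorem sz_append (l l' : List α) : sz (l ++ l') + 1 = sz l + sz l' := by
  induction l with
  | nil => rw [List.nil_append, sz_nil]; omega
  | cons a l ih => rw [List.cons_append, sz_cons, sz_cons]; omega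

end Sizes

/-- Bounded by a polynomial in the size of the argument. -/
def Bdd {α : Type} [Enc α] (g : α → ℕ) : Prop := ∃ d, ∀ a, g a ≤ (sz a + 2) ^ d

namespace Bdd

variable {α β : Type} [Enc α] [Enc β]

theorem mono {g g' : α → ℕ} (h : Bdd g') (hg : ∀ a, g a ≤ g' a) : Bdd g :=
  h.imp fun _ hd a => (hg a).trans (hd a)

theorem const (c : ℕ) : Bdd fun _ : α => c :=
  ⟨c, fun a => (Nat.lt_pow_self (by omega)).le⟩

theorem size : Bdd fun a : α => sz a := ⟨1, fun a => by rw [pow_one]; exact Nat.le_add_right _ _⟩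

theorem mul {g g' : α → ℕ} (h : Bdd g) (h' : Bdd g') : Bdd fun a => g a * g' a := by
  obtain ⟨d, hd⟩ := h
  obtain ⟨d', hd'⟩ := h'
  exact ⟨d + d', fun a => by rw [pow_add]; exact Nat.mul_le_mul (hd a) (hd' a)⟩

theorem add {g g' : α → ℕ} (h : Bdd g) (h' : Bdd g') : Bdd fun a => g a + g' a := by
  obtain ⟨d, hd⟩ := h
  obtain ⟨d', hd'⟩ := h'
  refine ⟨d + d' + 1, fun a => ?_⟩
  have h1 : (sz a + 2) ^ d ≤ (sz a + 2) ^ (d + d') := Nat.pow_le_pow_right (by omega) (by omega)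
  have h2 : (sz a + 2) ^ d' ≤ (sz a + 2) ^ (d + d') := Nat.pow_le_pow_right (by omega) (by omega)
  have := hd a
  have := hd' a
  rw [pow_succ]
  nlinarith [Nat.zero_le (sz a)]

theorem pow {g : α → ℕ} (h : Bdd g) (e : ℕ) : Bdd fun a => g a ^ e := by
  obtain ⟨d, hd⟩ := h
  exact ⟨d * e, fun a => by rw [pow_mul]; exact Nat.pow_le_pow_left (hd a) e⟩

theorem comp {g : β → ℕ} (h : Bdd g) {f : α → β} (hf : Bdd fun a => sz (f a)) :
    Bdd fun a => g (f a) := by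
  obtain ⟨d, hd⟩ := h
  exact ((hf.add (const 2)).pow d).mono fun a => hd (f a)

end Bdd

/-- Add `d` to the numbers of all called functions. -/
def Expr.shift (d : ℕ) : Expr → Expr
  | Expr.var i => Expr.var i
  | Expr.nil => Expr.nil
  | Expr.cons e₁ e₂ => Expr.cons (e₁.shift d) (e₂.shift d)
  | Expr.case e e₁ e₂ => Expr.case (e.shift d) (e₁.shift d) (e₂.shift d)
  | Expr.bind e e' => Expr.bind (e.shift d) (e'.shift d)
  | Expr.call f e => Expr.call (f + d) (e.shift d)

theorem Eval.shift {P Q : Program} {d : ℕ}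
    (hQ : ∀ f body, P[f]? = some body → Q[f + d]? = some (body.shift d)) {env : List Val}
    {e : Expr} {v : Val} {t : ℕ} (h : Eval P env e v t) : Eval Q env (e.shift d) v t := by
  induction h with
  | var => exact .var _ _
  | nil => exact .nil _
  | cons _ _ ih₁ ih₂ => exact .cons ih₁ ih₂
  | caseNil _ _ ih₁ ih₂ => exact .caseNil ih₁ ih₂
  | caseCons _ _ ih₁ ih₂ => exact .caseCons ih₁ ih₂
  | bind _ _ ih₁ ih₂ => exact .bind ih₁ ih₂
  | call hf _ _ ih₁ ih₂ => exact .call (hQ _ _ hf) ih₁ ih₂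

theorem Eval.extend {P : Program} (B : Program) {env : List Val} {e : Expr} {v : Val} {t : ℕ}
    (h : Eval P env e v t) : Eval (P ++ B) env e v t := by
  induction h with
  | var => exact .var _ _
  | nil => exact .nil _
  | cons _ _ ih₁ ih₂ => exact .cons ih₁ ih₂
  | caseNil _ _ ih₁ ih₂ => exact .caseNil ih₁ ih₂
  | caseCons _ _ ih₁ ih₂ => exact .caseCons ih₁ ih₂
  | bind _ _ ih₁ ih₂ => exact .bind ih₁ ih₂
  | call hf _ _ ih₁ ih₂ =>
    refine .call ?_ ih₁ ih₂
    rw [List.getElem?_append_left (List.getElem?_eq_some_iff.1 hf).1, hf]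

/-- Function number `i` of `Q` computes `f` in polynomial time. -/
def Computes {α β : Type} [Enc α] [Enc β] (Q : Program) (i d : ℕ) (f : α → β) : Prop :=
  ∃ body, Q[i]? = some body ∧ ∀ a, sz (f a) ≤ (sz a + 2) ^ d ∧
    ∃ t ≤ (sz a + 2) ^ d, Eval Q [enc a] body (enc (f a)) t

/-- `f` is computable in polynomial time. -/
def PT {α β : Type} [Enc α] [Enc β] (f : α → β) : Prop := ∃ Q i d, Computes Q i d f

/-! ### Closure properties of polynomial-time functions -/

section Framework

variable {α β γ δ : Type} [Enc α] [Enc β] [Enc γ] [Enc δ]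

theorem Computes.extend {Q : Program} {i d : ℕ} {f : α → β} (h : Computes Q i d f) (B : Program) :
    Computes (Q ++ B) i d f := by
  obtain ⟨body, hb, h⟩ := h
  refine ⟨body, ?_, fun a => ⟨(h a).1, ?_⟩⟩
  · rw [List.getElem?_append_left (List.getElem?_eq_some_iff.1 hb).1, hb]
  · obtain ⟨t, ht, he⟩ := (h a).2
    exact ⟨t, ht, he.extend B⟩

/-- Programs are linked by concatenation, the calls in the appended program being renumbered. This
brings several subroutines into one program. -/
theorem PT.adjoin {f : α → β} (h : PT f) (Q₀ : Program) :
    ∃ B i d, Computes (Q₀ ++ B) i d f := by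
  obtain ⟨Q, i, d, body, hb, h⟩ := h
  have hQ : ∀ f body, Q[f]? = some body →
      (Q₀ ++ Q.map (Expr.shift Q₀.length))[f + Q₀.length]? = some (body.shift Q₀.length) := by
    intro f body hf
    rw [List.getElem?_append_right (by omega), Nat.add_sub_cancel, List.getElem?_map, hf]
    rfl
  refine ⟨Q.map (Expr.shift Q₀.length), i + Q₀.length, d, body.shift Q₀.length, hQ _ _ hb,
    fun a => ⟨(h a).1, ?_⟩⟩
  obtain ⟨t, ht, he⟩ := (h a).2
  exact ⟨t, ht, he.shift hQ⟩

theorem Computes.call {Q : Program} {i d : ℕ} {f : α → β} (h : Computes Q i d f) {env : List Val}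
    {e : Expr} {a : α} {t : ℕ} (he : Eval Q env e (enc a) t) :
    ∃ t' ≤ t + (sz a + 2) ^ d + 1, Eval Q env (Expr.call i e) (enc (f a)) t' := by
  obtain ⟨body, hb, h⟩ := h
  obtain ⟨s, hs, hev⟩ := (h a).2
  exact ⟨t + s + 1, by omega, .call hb he hev⟩

theorem Computes.bdd {Q : Program} {i d : ℕ} {f : α → β} (h : Computes Q i d f) :
    Bdd fun a => sz (f a) := by
  obtain ⟨body, -, h⟩ := h
  exact ⟨d, fun a => (h a).1⟩

theorem PT.bdd {f : α → β} (h : PT f) : Bdd fun a => sz (f a) := by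
  obtain ⟨Q, i, d, h⟩ := h
  exact h.bdd

theorem PT.mk {f : α → β} (Q : Program) (e : Expr) (time : α → ℕ) (ht : Bdd time)
    (hs : Bdd fun a => sz (f a))
    (h : ∀ a, ∃ t ≤ time a, Eval Q [enc a] e (enc (f a)) t) : PT f := by
  obtain ⟨d, hd⟩ := ht
  obtain ⟨d', hd'⟩ := hs
  have hpow : ∀ (a : α) (k k' : ℕ), k ≤ k' → (sz a + 2) ^ k ≤ (sz a + 2) ^ k' :=
    fun a k k' hk => Nat.pow_le_pow_right (by omega) hk
  refine ⟨Q ++ [e], Q.length, max d d', e, by simp, fun a => ⟨?_, ?_⟩⟩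
  · exact (hd' a).trans (hpow a _ _ (le_max_right _ _))
  · obtain ⟨t, ht, he⟩ := h a
    exact ⟨t, ht.trans ((hd a).trans (hpow a _ _ (le_max_left _ _))), he.extend _⟩

theorem bdd_time (d : ℕ) : Bdd fun a : α => (sz a + 2) ^ d := ⟨d, fun _ => le_rfl⟩

/-- Values are untyped trees, and different types share encodings: a nonempty list is a pair, `some`
is a pair with the atom, and a number is a list of units. Passing between such views costs one step.
-/
theorem PT.of_enc_eq {f : α → β} (h : ∀ a, enc (f a) = enc a) : PT f :=
  .mk [] (Expr.var 0) (fun _ => 1) (.const 1) (Bdd.size.mono fun a => by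
    unfold sz; rw [h]) fun a => ⟨1, le_rfl, by rw [h]; exact .var [enc a] 0⟩

theorem PT.id : PT fun a : α => a := .of_enc_eq fun _ => rfl

theorem PT.comp {g : β → γ} {f : α → β} (hg : PT g) (hf : PT f) : PT fun a => g (f a) := by
  obtain ⟨Q, i, d, hf⟩ := hf
  obtain ⟨B, j, d', hg⟩ := hg.adjoin Q
  replace hf := hf.extend B
  refine .mk (Q ++ B) (Expr.call j (Expr.call i (Expr.var 0)))
    (fun a => 1 + (sz a + 2) ^ d + 1 + (sz (f a) + 2) ^ d' + 1)
    (((((Bdd.const 1).add (bdd_time d)).add (.const 1)).add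
      ((bdd_time d').comp hf.bdd)).add (.const 1)) (hg.bdd.comp hf.bdd) fun a => ?_
  obtain ⟨t, ht, h⟩ := hf.call (a := a) (.var [enc a] 0)
  obtain ⟨t', ht', h'⟩ := hg.call h
  exact ⟨t', by omega, h'⟩

theorem PT.pair {f : α → β} {g : α → γ} (hf : PT f) (hg : PT g) : PT fun a => (f a, g a) := by
  obtain ⟨Q, i, d, hf⟩ := hf
  obtain ⟨B, j, d', hg⟩ := hg.adjoin Q
  replace hf := hf.extend B
  refine .mk (Q ++ B) (Expr.cons (Expr.call i (Expr.var 0)) (Expr.call j (Expr.var 0)))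
    (fun a => (sz a + 2) ^ d + (sz a + 2) ^ d' + 5)
    (((bdd_time d).add (bdd_time d')).add (.const 5))
    (((hf.bdd.add hg.bdd).add (.const 1)).mono fun a => (sz_pair _ _).le) fun a => ?_
  obtain ⟨t, ht, h⟩ := hf.call (a := a) (.var [enc a] 0)
  obtain ⟨t', ht', h'⟩ := hg.call (a := a) (.var [enc a] 0)
  exact ⟨t + t' + 1, by omega, .cons h h'⟩

theorem PT.fst : PT (Prod.fst : α × β → α) := by
  refine .mk [] (Expr.case (Expr.var 0) Expr.nil (Expr.var 0)) (fun _ => 3) (.const 3)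
    (Bdd.size.mono fun a => ?_) fun a => ⟨3, le_rfl, ?_⟩
  · have := sz_pair a.1 a.2; change sz a = _ at this; omega
  · exact .caseCons (.var [enc a] 0) (.var [enc a.1, enc a.2, enc a] 0)

theorem PT.snd : PT (Prod.snd : α × β → β) := by
  refine .mk [] (Expr.case (Expr.var 0) Expr.nil (Expr.var 1)) (fun _ => 3) (.const 3)
    (Bdd.size.mono fun a => ?_) fun a => ⟨3, le_rfl, ?_⟩
  · have := sz_pair a.1 a.2; change sz a = _ at this; omega
  · exact .caseCons (.var [enc a] 0) (.var [enc a.1, enc a.2, enc a] 1)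

theorem PT.fst' {f : α → β × γ} (h : PT f) : PT fun a => (f a).1 := PT.fst.comp h

theorem PT.snd' {f : α → β × γ} (h : PT f) : PT fun a => (f a).2 := PT.snd.comp h

/-- The expression with value `v`. -/
def Expr.lit : Val → Expr
  | Val.nil => Expr.nil
  | Val.cons a b => Expr.cons (Expr.lit a) (Expr.lit b)

theorem eval_lit (P : Program) (env : List Val) (v : Val) : Eval P env (Expr.lit v) v v.size := by
  induction v with
  | nil => exact .nil _
  | cons a b iha ihb => exact .cons iha ihb

theorem PT.const (b : β) : PT fun _ : α => b :=
  .mk [] (Expr.lit (enc b)) (fun _ => sz b) (.const _) (.const _)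
    fun _ => ⟨_, le_rfl, eval_lit _ _ _⟩

theorem PT.cons {f : α → β} {g : α → List β} (hf : PT f) (hg : PT g) :
    PT fun a => f a :: g a :=
  (PT.of_enc_eq (f := fun x : β × List β => x.1 :: x.2) fun _ => rfl).comp (hf.pair hg)

theorem PT.some {f : α → β} (hf : PT f) : PT fun a => some (f a) :=
  (PT.of_enc_eq (f := fun x : Unit × β => Option.some x.2) fun _ => rfl).comp
    ((PT.const ()).pair hf)

theorem PT.succ {f : α → ℕ} (hf : PT f) : PT fun a => f a + 1 :=
  (PT.of_enc_eq (f := fun x : Unit × ℕ => x.2 + 1) fun _ => rfl).comp ((PT.const ()).pair hf)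

theorem PT.ite {p : α → Bool} {f g : α → β} (hp : PT p) (hf : PT f) (hg : PT g) :
    PT fun a => if p a = true then f a else g a := by
  obtain ⟨Q, i, d, hp⟩ := hp
  obtain ⟨B, j, d', hf⟩ := hf.adjoin Q
  replace hp := hp.extend B
  obtain ⟨B', k, d'', hg⟩ := hg.adjoin (Q ++ B)
  replace hp := hp.extend B'
  replace hf := hf.extend B'
  -- Opening the pair that encodes `true` binds two new variables, so the argument becomes variable
  -- `2` in that branch.
  refine .mk (Q ++ B ++ B') (Expr.case (Expr.call i (Expr.var 0)) (Expr.call k (Expr.var 0))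
    (Expr.call j (Expr.var 2))) (fun a => (sz a + 2) ^ d + (sz a + 2) ^ d' + (sz a + 2) ^ d'' + 5)
    ((((bdd_time d).add (bdd_time d')).add (bdd_time d'')).add (.const 5))
    ((hf.bdd.add hg.bdd).mono fun a => by split_ifs <;> omega) fun a => ?_
  obtain ⟨t, ht, h⟩ := hp.call (a := a) (.var [enc a] 0)
  cases hpa : p a
  · obtain ⟨t', ht', h'⟩ := hg.call (a := a) (.var [enc a] 0)
    rw [hpa] at h
    exact ⟨t + t' + 1, by omega, .caseNil h h'⟩
  · obtain ⟨t', ht', h'⟩ := hf.call (a := a) (.var [Val.nil, Val.nil, enc a] 2)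
    rw [hpa] at h
    exact ⟨t + t' + 1, by omega, .caseCons h h'⟩

/-- Case distinction on a list. -/
def listCase (n : β) (c : α → List α → β) : List α → β
  | [] => n
  | a :: l => c a l

theorem PT.listCase {l : γ → List α} {n : γ → β} {c : γ → α → List α → β} (hl : PT l) (hn : PT n)
    (hc : PT fun x : γ × α × List α => c x.1 x.2.1 x.2.2) :
    PT fun x => listCase (n x) (c x) (l x) := by
  obtain ⟨Q, i, d, hl⟩ := hl
  obtain ⟨B, j, d', hn⟩ := hn.adjoin Q
  replace hl := hl.extend B
  obtain ⟨B', k, d'', hc⟩ := hc.adjoin (Q ++ B)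
  replace hl := hl.extend B'
  replace hn := hn.extend B'
  have hb : ∀ {x a t}, l x = a :: t → sz (x, a, t) = sz x + sz (l x) + 1 := by
    intro x a t h
    rw [sz_pair, sz_pair, h, sz_cons]
  have hbd : ∀ e, Bdd fun x => (sz x + sz (l x) + 1 + 2) ^ e := fun e =>
    (((Bdd.size.add hl.bdd).add (.const 1)).add (.const 2)).pow e
  obtain ⟨e, he⟩ := hc.bdd
  refine .mk (Q ++ B ++ B') (Expr.case (Expr.call i (Expr.var 0)) (Expr.call j (Expr.var 0))
    (Expr.call k (Expr.cons (Expr.var 2) (Expr.cons (Expr.var 0) (Expr.var 1)))))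
    (fun x => (sz x + 2) ^ d + (sz x + 2) ^ d' + (sz x + sz (l x) + 1 + 2) ^ d'' + 9)
    ((((bdd_time d).add (bdd_time d')).add (hbd d'')).add (.const 9))
    ((hn.bdd.add (hbd e)).mono fun x => ?_) fun x => ?_
  · cases h : l x with
    | nil => simp only [CactusDeletion.listCase]; omega
    | cons a t =>
      have := he (x, a, t)
      rw [hb h, h] at this
      simp only [CactusDeletion.listCase] at this ⊢; omega
  · obtain ⟨t, ht, hev⟩ := hl.call (a := x) (.var [enc x] 0)
    cases h : l x with
    | nil =>
      obtain ⟨t', ht', h'⟩ := hn.call (a := x) (.var [enc x] 0)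
      rw [h] at hev
      exact ⟨t + t' + 1, by omega, .caseNil hev h'⟩
    | cons a s =>
      obtain ⟨t', ht', h'⟩ := hc.call (a := (x, a, s)) (.cons (.var [enc a, enc s, enc x] 2)
        (.cons (.var [enc a, enc s, enc x] 0) (.var [enc a, enc s, enc x] 1)))
      rw [hb h] at ht'
      rw [h] at hev
      rw [h] at ht'
      exact ⟨t + t' + 1, by omega, .caseCons hev h'⟩

/-- Primitive recursion on lists. -/
def para (s : γ → β) (f : γ × α × List α × β → β) (c : γ) : List α → β
  | [] => s c
  | a :: l => f (c, a, l, para s f c l)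

/-- Iterating a polynomial-time function may produce large values, so a bound on all results is
assumed in `hb`. It also bounds every intermediate result, since these are the results for the
suffixes of the list. -/
theorem PT.para {s : γ → β} {f : γ × α × List α × β → β} (hs : PT s) (hf : PT f)
    (hb : Bdd fun x : γ × List α => sz (para s f x.1 x.2)) :
    PT fun x : γ × List α => para s f x.1 x.2 := by
  obtain ⟨Q, i, d, hs⟩ := hs
  obtain ⟨B, j, d', hf⟩ := hf.adjoin Q
  replace hs := hs.extend B
  obtain ⟨e, he⟩ := hb
  set Q₁ := Q ++ B
  let r := Q₁.length
  -- After both tests succeed, variables `0`, `1` and `2` are the head, the tail and the parameter.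
  let body := Expr.case (Expr.var 0) Expr.nil (Expr.case (Expr.var 1) (Expr.call i (Expr.var 0))
    (Expr.call j (Expr.cons (Expr.var 2) (Expr.cons (Expr.var 0) (Expr.cons (Expr.var 1)
      (Expr.call r (Expr.cons (Expr.var 2) (Expr.var 1))))))))
  replace hs := hs.extend [body]
  replace hf := hf.extend [body]
  have hr : (Q₁ ++ [body])[r]? = .some body := by simp [r]
  -- The bound `N` for the whole input is kept fixed during the induction, which gives every round
  -- the same time bound.
  have main : ∀ (c : γ) (N : ℕ) (l : List α), sz (c, l) ≤ N →
      ∃ t ≤ sz l * ((N + 2) ^ d + (N + (N + 2) ^ e + 5) ^ d' + 20),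
        Eval (Q₁ ++ [body]) [enc (c, l)] body (enc (CactusDeletion.para s f c l)) t := by
    intro c N l
    induction l with
    | nil =>
      intro hN
      obtain ⟨t, ht, h⟩ := hs.call (a := c) (.var [enc c, Val.nil, enc (c, ([] : List α))] 0)
      have : (sz c + 2) ^ d ≤ (N + 2) ^ d := Nat.pow_le_pow_left (by
        rw [sz_pair] at hN; omega) d
      refine ⟨1 + (1 + t + 1) + 1, ?_, .caseCons (.var _ 0) (.caseNil (.var _ 1) h)⟩
      rw [sz_nil]
      omega
    | cons a l ih =>
      intro hN
      have hN' : sz (c, l) ≤ N := by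
        rw [sz_pair] at hN ⊢
        rw [sz_cons] at hN
        omega
      obtain ⟨t, ht, h⟩ := ih hN'
      obtain ⟨t', ht', h'⟩ := hf.call (a := (c, a, l, CactusDeletion.para s f c l))
        (.cons (.var [enc a, enc l, enc c, enc (a :: l), enc (c, a :: l)] 2)
        (.cons (.var _ 0) (.cons (.var _ 1)
          (.call hr (.cons (.var [enc a, enc l, enc c, enc (a :: l), enc (c, a :: l)] 2)
            (.var _ 1)) h))))
      refine ⟨1 + (1 + t' + 1) + 1, ?_, .caseCons (.var _ 0) (.caseCons (.var _ 1) h')⟩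
      have h1 : sz (CactusDeletion.para s f c l) ≤ (N + 2) ^ e :=
        (he (c, l)).trans (Nat.pow_le_pow_left (by omega) e)
      have h2 : (sz (c, a, l, CactusDeletion.para s f c l) + 2) ^ d'
          ≤ (N + (N + 2) ^ e + 5) ^ d' := by
        refine Nat.pow_le_pow_left ?_ d'
        rw [sz_pair, sz_pair, sz_pair]
        rw [sz_pair, sz_cons] at hN
        omega
      rw [sz_cons, Nat.add_mul, Nat.add_mul, Nat.one_mul]
      omega
  refine .mk (Q₁ ++ [body]) (Expr.call r (Expr.var 0))
    (fun x => sz x * ((sz x + 2) ^ d + (sz x + (sz x + 2) ^ e + 5) ^ d' + 20) + 2)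
    ((Bdd.size.mul (((bdd_time d).add (((Bdd.size.add (bdd_time e)).add (.const 5)).pow d')).add
      (.const 20))).add (.const 2)) ⟨e, he⟩ fun x => ?_
  obtain ⟨t, ht, h⟩ := main x.1 (sz x) x.2 le_rfl
  refine ⟨1 + t + 1, ?_, .call hr (.var _ 0) h⟩
  have : sz x.2 ≤ sz x := by
    have := sz_pair x.1 x.2
    change sz x = _ at this
    omega
  have := Nat.mul_le_mul_right ((sz x + 2) ^ d + (sz x + (sz x + 2) ^ e + 5) ^ d' + 20) this
  omega

end Framework

/-! ### Polynomial-time list functions -/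

section Derived

variable {α β γ δ : Type} [Enc α] [Enc β] [Enc γ] [Enc δ]

theorem PT.of_para {l : γ → List α} {g : γ → List α → β} (s : γ → β)
    (f : γ × α × List α × β → β) (hs : PT s) (hf : PT f) (hl : PT l)
    (hg : ∀ c l, CactusDeletion.para s f c l = g c l)
    (hb : Bdd fun x : γ × List α => sz (g x.1 x.2)) : PT fun c => g c (l c) := by
  have := (PT.para hs hf (hb.mono fun x => by rw [hg])).comp (PT.id.pair hl)
  simpa only [hg] using this

theorem Bdd.snd {g : β → ℕ} (h : Bdd g) : Bdd fun x : α × β => g x.2 :=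
  h.comp (f := Prod.snd) PT.snd.bdd

theorem Bdd.fst {g : α → ℕ} (h : Bdd g) : Bdd fun x : α × β => g x.1 :=
  h.comp (f := Prod.fst) PT.fst.bdd

theorem sz_fst_le (x : α × β) : sz x.1 ≤ sz x := by
  have := sz_pair x.1 x.2
  change sz x = _ at this
  omega

theorem PT.map {l : γ → List α} {f : γ → α → β} (hf : PT fun x : γ × α => f x.1 x.2)
    (hl : PT l) : PT fun c => (l c).map (f c) := by
  refine .of_para (g := fun c l => l.map (f c)) (fun _ => []) (fun y => f y.1 y.2.1 :: y.2.2.2)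
    (.const _) ((hf.comp (PT.fst.pair PT.snd.fst')).cons PT.snd.snd'.snd') hl ?_ ?_
  · intro c l
    induction l with
    | nil => rfl
    | cons a l ih => simp only [CactusDeletion.para, ih, List.map_cons]
  · obtain ⟨d, hd⟩ := hf.bdd
    refine ((Bdd.size.mul ((bdd_time d).add (.const 1))).add (.const 1)).mono fun x => ?_
    refine (sz_list_le (m := (sz x + 2) ^ d) fun b hb => ?_).trans ?_
    · obtain ⟨a, ha, rfl⟩ := List.mem_map.1 hb
      refine (hd (x.1, a)).trans (Nat.pow_le_pow_left ?_ d)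
      have h1 := sz_mem_lt ha
      have h2 := sz_pair x.1 x.2
      change sz x = _ at h2
      rw [sz_pair]
      omega
    · rw [List.length_map]
      have h1 := length_lt_sz x.2
      have h2 := sz_pair x.1 x.2
      change sz x = _ at h2
      exact Nat.add_le_add_right (Nat.mul_le_mul_right _ (by omega)) 1

theorem PT.filter {l : γ → List α} {p : γ → α → Bool} (hp : PT fun x : γ × α => p x.1 x.2)
    (hl : PT l) : PT fun c => (l c).filter (p c) := by
  refine .of_para (g := fun c l => l.filter (p c)) (fun _ => [])
    (fun y => if p y.1 y.2.1 = true then y.2.1 :: y.2.2.2 else y.2.2.2) (.const _)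
    ((hp.comp (PT.fst.pair PT.snd.fst')).ite (PT.snd.fst'.cons PT.snd.snd'.snd')
      PT.snd.snd'.snd') hl ?_ ?_
  · intro c l
    induction l with
    | nil => rfl
    | cons a l ih => simp only [CactusDeletion.para, ih, List.filter_cons]
  · exact Bdd.size.snd.mono fun x => sz_sublist List.filter_sublist

theorem bdd_bool (f : α → Bool) : Bdd fun a => sz (f a) :=
  (Bdd.const 3).mono fun a => sz_bool_le (f a)

theorem PT.any {l : γ → List α} {p : γ → α → Bool} (hp : PT fun x : γ × α => p x.1 x.2)
    (hl : PT l) : PT fun c => (l c).any (p c) := by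
  refine .of_para (g := fun c l => l.any (p c)) (fun _ => false)
    (fun y => if p y.1 y.2.1 = true then true else y.2.2.2) (.const _)
    ((hp.comp (PT.fst.pair PT.snd.fst')).ite (.const _) PT.snd.snd'.snd') hl ?_ (bdd_bool _)
  intro c l
  induction l with
  | nil => rfl
  | cons a l ih => simp only [CactusDeletion.para, ih, List.any_cons]; cases p c a <;> simp

theorem PT.all {l : γ → List α} {p : γ → α → Bool} (hp : PT fun x : γ × α => p x.1 x.2)
    (hl : PT l) : PT fun c => (l c).all (p c) := by
  refine .of_para (g := fun c l => l.all (p c)) (fun _ => true)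
    (fun y => if p y.1 y.2.1 = true then y.2.2.2 else false) (.const _)
    ((hp.comp (PT.fst.pair PT.snd.fst')).ite PT.snd.snd'.snd' (.const _)) hl ?_ (bdd_bool _)
  intro c l
  induction l with
  | nil => rfl
  | cons a l ih => simp only [CactusDeletion.para, ih, List.all_cons]; cases p c a <;> simp

theorem PT.append {l l' : γ → List α} (hl : PT l) (hl' : PT l') : PT fun c => l c ++ l' c := by
  refine .of_para (g := fun c l => l ++ l' c) l' (fun y => y.2.1 :: y.2.2.2) hl'
    (PT.snd.fst'.cons PT.snd.snd'.snd') hl ?_ ?_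
  · intro c l
    induction l with
    | nil => rfl
    | cons a l ih => simp only [CactusDeletion.para, ih, List.cons_append]
  · refine (Bdd.size.snd.add hl'.bdd.fst).mono fun x => ?_
    have := sz_append x.2 (l' x.1)
    omega

theorem sz_flatten_le (l : List (List α)) : sz l.flatten ≤ sz l := by
  induction l with
  | nil => exact le_rfl
  | cons a l ih =>
    rw [List.flatten_cons, sz_cons]
    have := sz_append a l.flatten
    omega

theorem PT.flatten {l : γ → List (List α)} (hl : PT l) : PT fun c => (l c).flatten := by
  refine .of_para (g := fun _ l => l.flatten) (fun _ => []) (fun y => y.2.1 ++ y.2.2.2) (.const _)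
    (PT.snd.fst'.append PT.snd.snd'.snd') hl ?_ ?_
  · intro c l
    induction l with
    | nil => rfl
    | cons a l ih => simp only [CactusDeletion.para, ih, List.flatten_cons]
  · exact Bdd.size.snd.mono fun x => sz_flatten_le x.2

theorem PT.product {l : γ → List α} {l' : γ → List β} (hl : PT l) (hl' : PT l') :
    PT fun c => l c ×ˢ l' c :=
  (PT.flatten (PT.map (f := fun c a => (l' c).map fun b => (a, b))
    (PT.map (f := fun (x : γ × α) b => (x.2, b)) (PT.fst.snd'.pair PT.snd) (hl'.comp PT.fst)) hl) :)

theorem PT.and {p q : γ → Bool} (hp : PT p) (hq : PT q) : PT fun c => p c && q c := by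
  have := hp.ite hq (.const false)
  refine cast (congrArg PT (funext fun c => ?_)) this
  cases p c <;> simp

theorem PT.or {p q : γ → Bool} (hp : PT p) (hq : PT q) : PT fun c => p c || q c := by
  have := hp.ite (.const true) hq
  refine cast (congrArg PT (funext fun c => ?_)) this
  cases p c <;> simp

theorem PT.not {p : γ → Bool} (hp : PT p) : PT fun c => !p c := by
  have := hp.ite (.const false) (.const true)
  refine cast (congrArg PT (funext fun c => ?_)) this
  cases p c <;> simp

theorem PT.length {l : γ → List α} (hl : PT l) : PT fun c => (l c).length := by
  have h : PT fun l : List Unit => l.length := by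
    refine .of_enc_eq fun l => ?_
    induction l with
    | nil => rfl
    | cons a l ih => exact congrArg (Val.cons Val.nil) ih
  have := h.comp (PT.map (f := fun _ _ => ()) (.const _) hl)
  simpa only [List.length_map] using this

theorem PT.replicate {m : γ → ℕ} {f : γ → α} (hm : PT m) (hf : PT f) :
    PT fun c => List.replicate (m c) (f c) := by
  have h : PT fun n : ℕ => List.replicate n () := by
    refine .of_enc_eq fun n => ?_
    induction n with
    | zero => rfl
    | succ n ih => exact congrArg (Val.cons Val.nil) ih
  have := PT.map (f := fun c _ => f c) (hf.comp PT.fst) (h.comp hm)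
  simpa only [List.map_replicate] using this

theorem PT.tail {l : γ → List α} (hl : PT l) : PT fun c => (l c).tail := by
  have := PT.listCase (c := fun _ _ t => t) hl (.const ([] : List α)) PT.snd.snd'
  refine cast (congrArg PT (funext fun c => ?_)) this
  cases l c <;> rfl

theorem PT.isEmpty {l : γ → List α} (hl : PT l) : PT fun c => (l c).isEmpty := by
  have := PT.listCase (c := fun _ _ _ => false) hl (.const true) (.const _)
  refine cast (congrArg PT (funext fun c => ?_)) this
  cases l c <;> rfl

/-- A number serves as a list of units, so that recursion on lists covers recursion on numbers. -/
theorem PT.drop {m : γ → ℕ} {l : γ → List α} (hm : PT m) (hl : PT l) :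
    PT fun c => (l c).drop (m c) := by
  have := PT.of_para (g := fun (c : γ) (u : List Unit) => (l c).drop u.length) l
    (fun y => y.2.2.2.tail) hl PT.snd.snd'.snd'.tail (hm.replicate (.const ())) ?_ ?_
  · simpa only [List.length_replicate] using this
  · intro c u
    induction u with
    | nil => rfl
    | cons a u ih => simp only [CactusDeletion.para, ih, List.tail_drop, List.length_cons]
  · exact hl.bdd.fst.mono fun x => sz_sublist (List.drop_sublist _ _)

theorem PT.sub {m m' : γ → ℕ} (hm : PT m) (hm' : PT m') : PT fun c => m c - m' c := by
  have := (hm'.drop (hm.replicate (.const ()))).length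
  simpa only [List.length_drop, List.length_replicate] using this

theorem PT.beq {m m' : γ → ℕ} (hm : PT m) (hm' : PT m') : PT fun c => m c == m' c := by
  have := ((((hm.sub hm').replicate (.const ())).append
    ((hm'.sub hm).replicate (.const ())))).isEmpty
  refine cast (congrArg PT (funext fun c => ?_)) this
  rw [Bool.eq_iff_iff, beq_iff_eq, List.isEmpty_iff, ← List.length_eq_zero_iff, List.length_append,
    List.length_replicate, List.length_replicate]
  omega

theorem PT.max {m m' : γ → ℕ} (hm : PT m) (hm' : PT m') : PT fun c => max (m c) (m' c) := by
  have := (hm.replicate (.const ())).append ((hm'.sub hm).replicate (.const ())) |>.length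
  refine cast (congrArg PT (funext fun c => ?_)) this
  simp only [List.length_append, List.length_replicate]
  omega

theorem PT.beq_edge {e e' : γ → ℕ × ℕ} (he : PT e) (he' : PT e') : PT fun c => e c == e' c := by
  have := (he.fst'.beq he'.fst').and (he.snd'.beq he'.snd')
  refine cast (congrArg PT (funext fun c => ?_)) this
  rw [Bool.eq_iff_iff]
  simp [Prod.ext_iff]

theorem PT.erase {l : γ → Edges} {e : γ → ℕ × ℕ} (hl : PT l) (he : PT e) :
    PT fun c => (l c).erase (e c) := by
  refine .of_para (g := fun c l => l.erase (e c)) (fun _ => [])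
    (fun y => if (y.2.1 == e y.1) = true then y.2.2.1 else y.2.1 :: y.2.2.2) (.const _)
    ((PT.snd.fst'.beq_edge (he.comp .fst)).ite PT.snd.snd'.fst'
      (PT.snd.fst'.cons PT.snd.snd'.snd')) hl ?_ ?_
  · intro c l
    induction l with
    | nil => rfl
    | cons a l ih =>
      simp only [CactusDeletion.para, ih, List.erase_cons]
  · exact Bdd.size.snd.mono fun x => sz_sublist List.erase_sublist

theorem PT.contains {l : γ → List ℕ} {m : γ → ℕ} (hl : PT l) (hm : PT m) :
    PT fun c => (l c).any fun z => z == m c :=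
  PT.any (p := fun c z => z == m c) (PT.snd.beq (hm.comp .fst)) hl

theorem PT.range {m : γ → ℕ} (hm : PT m) : PT fun c => List.range (m c) := by
  have := PT.of_para (g := fun (_ : γ) (u : List Unit) => List.range u.length) (fun _ => [])
    (fun y => 0 :: y.2.2.2.map (· + 1)) (.const _)
    ((PT.const 0).cons (PT.map (f := fun _ a => a + 1) PT.snd.succ PT.snd.snd'.snd'))
    (hm.replicate (.const ())) ?_ ?_
  · simpa only [List.length_replicate] using this
  · intro c u
    induction u with
    | nil => rfl
    | cons a u ih => simp only [CactusDeletion.para, ih, List.length_cons, List.range_succ_eq_map]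
  · refine ((Bdd.size.mul ((Bdd.size.mul (.const 2)).add (.const 2))).add (.const 1)).mono
      fun x => ?_
    have h1 := length_lt_sz x.2
    have h2 := sz_pair x.1 x.2
    change sz x = _ at h2
    refine (sz_list_le (m := 2 * x.2.length + 1) fun a ha => ?_).trans ?_
    · have := List.mem_range.1 ha
      rw [sz_nat]; omega
    · rw [List.length_range]
      exact Nat.add_le_add_right (Nat.mul_le_mul (by omega) (by omega)) 1

end Derived

/-! ### Search trees -/

/-- A depth-first search whose steps take polynomial time runs in time linear in the weight of the
roots, if the weight of a node exceeds the total weight of its children by at least one. -/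
theorem exists_search_program {ι σ ρ : Type} [Enc ι] [Enc σ] [Enc ρ]
    {step : σ → Option ρ × List σ} {init : ι → List σ} (hstep : PT step) (hinit : PT init) :
    ∃ (P : Program) (d : ℕ), ∀ (x : ι) (Inv Solvable : σ → Prop) (Good : ρ → Prop) (w : σ → ℝ)
      (M : ℕ), (∀ s ∈ init x, Inv s) → (∀ s, Inv s → sz s ≤ M) → (∀ s, Inv s → 1 ≤ w s) →
      (∀ s, Inv s → ∀ r, (step s).1 = some r → Good r) →
      (∀ s, Inv s → (step s).1 = none → (∀ c ∈ (step s).2, Inv c) ∧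
        ((step s).2.map w).sum + 1 ≤ w s ∧ (Solvable s → ∃ c ∈ (step s).2, Solvable c)) →
      ∃ (o : Option ρ) (t : ℕ), P.RunsTo (enc x) (enc o) t ∧
        (t : ℝ) ≤ ((sz x : ℝ) + 2) ^ d + (((M : ℝ) + 2) ^ d + 30) * ((init x).map w).sum + 10 ∧
        (∀ r, o = some r → Good r) ∧ (o = none → ∀ s ∈ init x, ¬ Solvable s) := by
  obtain ⟨Q, i, d, hinit⟩ := hinit
  obtain ⟨B, j, d', hstep⟩ := hstep.adjoin Q
  replace hinit := hinit.extend B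
  set Q₁ := Q ++ B
  let r := Q₁.length
  -- Function `r` searches a list of nodes. It runs the step on the first node and searches the
  -- children unless the step has given an answer. The rest of the list, variable `5` at that point,
  -- is searched only if this yields `none`.
  let body := Expr.case (Expr.var 0) Expr.nil (Expr.bind (Expr.call j (Expr.var 0))
    (Expr.case (Expr.var 0) Expr.nil (Expr.bind
      (Expr.case (Expr.var 0) (Expr.call r (Expr.var 1)) (Expr.var 2))
      (Expr.case (Expr.var 0) (Expr.call r (Expr.var 5)) (Expr.var 2)))))
  replace hstep := hstep.extend [body]
  replace hinit := hinit.extend [body]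
  have hr : (Q₁ ++ [body])[r]? = .some body := by simp [r]
  set Q₂ := Q₁ ++ [body]
  -- The main function must have number `0`, so all other functions move up by one.
  refine ⟨(Expr.call r (Expr.call i (Expr.var 0))).shift 1 :: Q₂.map (Expr.shift 1), d + d', ?_⟩
  intro x Inv Solvable Good w M hroot hsize hw hgood hchild
  -- `K` bounds the cost of one node: its step and the constant overhead of the search function.
  let K : ℝ := ((M : ℝ) + 2) ^ d' + 30
  have hM : (1 : ℝ) ≤ (M : ℝ) + 2 := by have : (0 : ℝ) ≤ M := Nat.cast_nonneg M; linarith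
  have hK : 30 ≤ K := by
    have : (0 : ℝ) ≤ ((M : ℝ) + 2) ^ d' := by positivity
    simp only [K]; linarith
  -- Induction on an integer bound for the total weight: the children of the first node and the rest
  -- of the list each weigh at least one less than the whole list.
  have main : ∀ (n : ℕ) (l : List σ), (∀ s ∈ l, Inv s) → (l.map w).sum < n →
      ∃ (o : Option ρ) (t : ℕ), Eval Q₂ [enc l] body (enc o) t ∧
        (t : ℝ) ≤ K * (l.map w).sum + 3 ∧
        (∀ r, o = some r → Good r) ∧ (o = none → ∀ s ∈ l, ¬ Solvable s) := by
    intro n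
    induction n with
    | zero =>
      intro l hl hs
      exfalso
      have : 0 ≤ (l.map w).sum := List.sum_nonneg fun y hy => by
        obtain ⟨s, hs, rfl⟩ := List.mem_map.1 hy
        linarith [hw s (hl s hs)]
      simp at hs
      linarith
    | succ n ih =>
      intro l hl hs
      cases l with
      | nil =>
        refine ⟨none, 3, .caseNil (.var _ 0) (.nil _), by simp, by simp, by simp⟩
      | cons s l =>
        have hInv := hl s List.mem_cons_self
        have hInvl : ∀ s ∈ l, Inv s := fun s' h => hl s' (List.mem_cons_of_mem _ h)
        have hws := hw s hInv
        rw [List.map_cons, List.sum_cons] at hs ⊢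
        push_cast at hs
        have hl0 : 0 ≤ (l.map w).sum := List.sum_nonneg fun y hy => by
          obtain ⟨s, hs, rfl⟩ := List.mem_map.1 hy
          linarith [hw s (hInvl s hs)]
        obtain ⟨ts, hts, hevs⟩ := hstep.call (a := s) (.var [enc s, enc l, enc (s :: l)] 0)
        have hts' : (ts : ℝ) ≤ K - 28 := by
          have h1 : (sz s + 2) ^ d' ≤ (M + 2) ^ d' :=
            Nat.pow_le_pow_left (Nat.add_le_add_right (hsize s hInv) 2) d'
          have h2 : ts ≤ (M + 2) ^ d' + 2 := by omega
          have h3 : (ts : ℝ) ≤ ((M : ℝ) + 2) ^ d' + 2 := by exact_mod_cast h2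
          simp only [K]; linarith
        obtain ⟨ol, tl, hevl, htl, hgl, hsl⟩ := ih l hInvl (by linarith)
        -- the answer for the first node
        obtain ⟨o, t, hev, ht, hg, hsv⟩ : ∃ (o : Option ρ) (t : ℕ),
            Eval Q₂ [enc (step s).1, enc (step s).2, enc (step s), enc s, enc l, enc (s :: l)]
              (Expr.case (Expr.var 0) (Expr.call r (Expr.var 1)) (Expr.var 2)) (enc o) t ∧
            (t : ℝ) ≤ K * (w s - 1) + 7 ∧ (∀ r, o = some r → Good r) ∧
            (o = none → ¬ Solvable s) := by
          cases hst : (step s).1 with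
          | some ρ =>
            refine ⟨some ρ, 3, .caseCons (.var _ 0) (.var _ 2), ?_, fun r hr => ?_, by simp⟩
            · have : 0 ≤ K * (w s - 1) := mul_nonneg (by linarith) (by linarith)
              push_cast; linarith
            · exact hgood s hInv r (by rw [hst, hr])
          | none =>
            obtain ⟨h1, h2, h3⟩ := hchild s hInv hst
            obtain ⟨o, t, hev, ht, hg, hsv⟩ := ih (step s).2 h1 (by linarith)
            refine ⟨o, 1 + (1 + t + 1) + 1, .caseNil (.var _ 0) (.call hr (.var _ 1) hev), ?_, hg,
              fun ho hS => ?_⟩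
            · push_cast
              have : K * ((step s).2.map w).sum ≤ K * (w s - 1) :=
                mul_le_mul_of_nonneg_left (by linarith) (by linarith)
              linarith
            · obtain ⟨c, hc, hcS⟩ := h3 hS
              exact hsv ho c hc hcS
        have hexp : K * (w s + (l.map w).sum) = K * (w s - 1) + K + K * (l.map w).sum := by ring
        have hKl : 0 ≤ K * (l.map w).sum := mul_nonneg (by linarith) hl0
        cases o with
        | some ρ =>
          refine ⟨some ρ, 1 + (ts + (1 + (t + (1 + 1 + 1) + 1) + 1) + 1) + 1,
            .caseCons (.var _ 0) (.bind hevs (.caseCons (.var _ 0) (.bind hev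
              (.caseCons (.var _ 0) (.var _ 2))))), ?_, hg, by simp⟩
          push_cast
          rw [hexp]
          linarith
        | none =>
          refine ⟨ol, 1 + (ts + (1 + (t + (1 + (1 + tl + 1) + 1) + 1) + 1) + 1) + 1,
            .caseCons (.var _ 0) (.bind hevs (.caseCons (.var _ 0) (.bind hev
              (.caseNil (.var _ 0) (.call hr (.var _ 5) hevl))))), ?_, hgl, fun ho => ?_⟩
          · push_cast
            rw [hexp]
            linarith
          · intro s' hs'
            rcases List.mem_cons.1 hs' with rfl | hs'
            · exact hsv rfl
            · exact hsl ho s' hs'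
  obtain ⟨n, hn⟩ := exists_nat_gt ((init x).map w).sum
  obtain ⟨o, t, hev, ht, hg, hsv⟩ := main n (init x) hroot hn
  obtain ⟨ti, hti, hevi⟩ := hinit.call (a := x) (.var [enc x] 0)
  have hQ : ∀ f body, Q₂[f]? = some body →
      ((Expr.call r (Expr.call i (Expr.var 0))).shift 1 :: Q₂.map (Expr.shift 1))[f + 1]?
        = some (body.shift 1) := by
    intro f body hf
    rw [List.getElem?_cons_succ, List.getElem?_map, hf]
    rfl
  refine ⟨o, 1 + (ti + t + 1) + 1,
    .call rfl (.var _ 0) ((Eval.call hr hevi hev).shift hQ), ?_, hg, hsv⟩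
  have h1 : (ti : ℝ) ≤ ((sz x : ℝ) + 2) ^ d + 2 := by
    have : ti ≤ (sz x + 2) ^ d + 2 := by omega
    exact_mod_cast this
  have h0 : 0 ≤ ((init x).map w).sum := List.sum_nonneg fun y hy => by
    obtain ⟨s, hs, rfl⟩ := List.mem_map.1 hy
    linarith [hw s (hroot s hs)]
  have hx : (1 : ℝ) ≤ (sz x : ℝ) + 2 := by
    have : (0 : ℝ) ≤ sz x := Nat.cast_nonneg _
    linarith
  have h2 : ((sz x : ℝ) + 2) ^ d ≤ ((sz x : ℝ) + 2) ^ (d + d') :=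
    pow_le_pow_right₀ hx (by omega)
  have h3 : ((M : ℝ) + 2) ^ d' ≤ ((M : ℝ) + 2) ^ (d + d') := pow_le_pow_right₀ hM (by omega)
  have h4 : K * ((init x).map w).sum
      ≤ (((M : ℝ) + 2) ^ (d + d') + 30) * ((init x).map w).sum :=
    mul_le_mul_of_nonneg_right (by simp only [K]; linarith) h0
  push_cast
  linarith

/-! ### Connectivity tests -/

/-- Contract the first edge of the graph, keeping track of two vertices. -/
def contractFirst (s : Edges × ℕ × ℕ) : Edges × ℕ × ℕ :=
  listCase s (fun e L => (L.map fun f => (contract e.1 e.2 f.1, contract e.1 e.2 f.2),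
    contract e.1 e.2 s.2.1, contract e.1 e.2 s.2.2)) s.1

/-- Contract all edges. -/
def contractAll (s : Edges × ℕ × ℕ) : Edges × ℕ × ℕ := contractFirst^[s.1.length] s

def ec0 (L : Edges) (x y : ℕ) : Bool :=
  (contractAll (L, x, y)).2.1 == (contractAll (L, x, y)).2.2

def ec1 (L : Edges) (x y : ℕ) : Bool := ec0 L x y && L.all fun e => ec0 (L.erase e) x y

def ec2 (L : Edges) (x y : ℕ) : Bool := ec1 L x y && L.all fun e => ec1 (L.erase e) x y

/-- Whether `z` occurs in `l`. -/
def memb (l : List ℕ) (z : ℕ) : Bool := l.any fun y => y == z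

/-- Whether the subgraph induced by `V` is a cactus forest. -/
def cactusTest (L : Edges) (V : List ℕ) : Bool :=
  V.all fun x => V.all fun y => x == y || !ec2 (ind (memb V) L) x y

theorem memb_iff {l : List ℕ} {z : ℕ} : memb l z = true ↔ z ∈ l := by
  simp [memb]

theorem ec0_iff {L : Edges} {x y : ℕ} : ec0 L x y = true ↔ EC 0 L x y := by
  unfold ec0 contractAll
  simp only
  generalize hn : L.length = n
  induction n generalizing L x y with
  | zero =>
    rw [List.length_eq_zero_iff] at hn
    subst hn
    simp [EC_nil_iff]
  | succ n ih =>
    cases L with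
    | nil => simp at hn
    | cons e L =>
      simp only [List.length_cons, Nat.add_right_cancel_iff] at hn
      rw [Function.iterate_succ_apply]
      exact (ih (by rw [List.length_map, hn])).trans EC_zero_cons_iff.symm

theorem ec1_iff {L : Edges} {x y : ℕ} : ec1 L x y = true ↔ EC 1 L x y := by
  rw [EC_succ_iff]
  simp only [ec1, Bool.and_eq_true, List.all_eq_true, ec0_iff]

theorem ec2_iff {L : Edges} {x y : ℕ} : ec2 L x y = true ↔ EC 2 L x y := by
  rw [EC_succ_iff]
  simp only [ec2, Bool.and_eq_true, List.all_eq_true, ec1_iff]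

theorem indSet_toFinset (l : List ℕ) (L : Edges) : indSet l.toFinset L = ind (memb l) L := by
  unfold indSet
  congr 1
  funext z
  rw [Bool.eq_iff_iff, memb_iff]
  simp

/-- Vertices outside `V` are isolated in the induced subgraph, so only pairs from `V` have to be
tested. -/
theorem cactusTest_iff {L : Edges} {V : List ℕ} :
    cactusTest L V = true ↔ Cactus (indSet V.toFinset L) := by
  have h1 : cactusTest L V = true ↔
      ∀ x ∈ V, ∀ y ∈ V, EC 2 (indSet V.toFinset L) x y → x = y := by
    rw [indSet_toFinset]
    simp only [cactusTest, List.all_eq_true, Bool.or_eq_true, beq_iff_eq, Bool.not_eq_true',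
      ← Bool.not_eq_true, ec2_iff]
    refine forall₄_congr fun x _ y _ => ?_
    tauto
  rw [h1]
  refine ⟨fun h x y hxy => ?_, fun h x _ y _ hxy => h x y hxy⟩
  have iso : ∀ x y, EC 2 (indSet V.toFinset L) x y → x ∉ V → x = y := by
    intro x y hxy hx
    have := hxy (fun z => z == x) (by
      refine le_trans (le_of_eq ?_) (Nat.zero_le 2)
      rw [cut_eq_zero]
      intro e he
      obtain ⟨-, h1, h2⟩ := mem_indSet.1 he
      rw [List.mem_toFinset] at h1 h2
      have h1 : e.1 ≠ x := fun h => hx (h ▸ h1)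
      have h2 : e.2 ≠ x := fun h => hx (h ▸ h2)
      simp [h1, h2])
    simp only [beq_self_eq_true] at this
    exact (beq_iff_eq.1 this.symm).symm
  by_cases hx : x ∈ V
  · by_cases hy : y ∈ V
    · exact h x hx y hy hxy
    · exact (iso y x hxy.symm hy).symm
  · exact iso x y hxy hx

/-! ### The algorithm -/

/-- A node of the search tree: the current graph, the undecided vertices, the vertices to be kept,
the vertices deleted so far, the remaining budget and the order of the original graph. -/
structure State where
  /-- the edges of the current graph -/
  L : Edges
  /-- the undecided vertices -/
  R : List ℕ
  /-- the vertices to be kept -/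
  F : List ℕ
  /-- the deleted vertices -/
  X : List ℕ
  /-- the number of further vertices that may be deleted -/
  k : ℕ
  /-- the order of the original graph -/
  n : ℕ

namespace State

/-- Discard the undecided vertex `v` from the graph. -/
def remove (s : State) (v : ℕ) : State :=
  { s with L := ind (fun z => !(z == v)) s.L, R := s.R.filter fun z => !(z == v) }

/-- Bypass the undecided vertex `v` with the neighbours `u` and `w`. -/
def shortcut (s : State) (v u w : ℕ) : State :=
  { s with L := bypass s.L v u w, R := s.R.filter fun z => !(z == v) }

/-- Put `v` into the solution, if the budget allows it. -/
def delete (s : State) (v : ℕ) : List State :=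
  if s.k == 0 then [] else [{ s.remove v with X := v :: s.X, k := s.k - 1 }]

/-- Decide to keep the vertices in `W`, if they form a cactus with those kept so far. -/
def keep (s : State) (W : List ℕ) : List State :=
  if cactusTest s.L (W ++ s.F) then
    [{ s with R := s.R.filter fun z => !memb W z, F := W ++ s.F }] else []

/-- Delete one of the vertices in `W` or keep all of them. -/
def branch (s : State) (W : List ℕ) : List State := (W.map s.delete).flatten ++ s.keep W

/-- Triples of undecided vertices one of which must be deleted. -/
def conflicts (s : State) : List (ℕ × ℕ × ℕ) :=
  (s.R ×ˢ s.R ×ˢ s.R).filter fun x => !cactusTest s.L ([x.1, x.2.1, x.2.2] ++ s.F)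

/-- Undecided vertices with at most one neighbour. -/
def pendants (s : State) : List (ℕ × ℕ) :=
  (s.R ×ˢ (s.R ++ s.F)).filter fun x => (s.R ++ s.F).all fun z => !adj s.L x.1 z || z == x.2

/-- Undecided vertices with two neighbours, one of them undecided. -/
def bypassables (s : State) : List (ℕ × ℕ × ℕ) :=
  (s.R ×ˢ s.R ×ˢ (s.R ++ s.F)).filter fun x =>
    (adj s.L x.1 x.2.1 && (adj s.L x.1 x.2.2 && !(x.2.1 == x.2.2))) &&
      (s.R ++ s.F).all fun z => !adj s.L x.1 z || (z == x.2.1 || z == x.2.2)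

/-- Undecided vertices with two kept neighbours. -/
def attached (s : State) : List (ℕ × ℕ × ℕ) :=
  (s.R ×ˢ s.F ×ˢ s.F).filter fun x =>
    adj s.L x.1 x.2.1 && (adj s.L x.1 x.2.2 && !(x.2.1 == x.2.2))

/-- Adjacent undecided vertices with neighbours in different components of the kept graph. -/
def linking (s : State) : List ((ℕ × ℕ) × ℕ × ℕ) :=
  ((s.R ×ˢ s.R) ×ˢ s.F ×ˢ s.F).filter fun x =>
    adj s.L x.1.1 x.1.2 && (adj s.L x.1.1 x.2.1 && (adj s.L x.1.2 x.2.2 &&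
      !ec0 (ind (memb s.F) s.L) x.2.1 x.2.2))

def children (s : State) : List State :=
  listCase (listCase (listCase (listCase (listCase []
    (fun x _ => s.branch [x.1.1, x.1.2]) s.linking)
    (fun x _ => s.branch [x.1]) s.attached)
    (fun x _ => [s.shortcut x.1 x.2.1 x.2.2]) s.bypassables)
    (fun x _ => [s.remove x.1]) s.pendants)
    (fun x _ => s.branch [x.1, x.2.1, x.2.2]) s.conflicts

/-- Either an answer or the children of a node. -/
def step (s : State) : Option (List Bool) × List State :=
  if s.R.isEmpty then (some ((List.range s.n).map (memb s.X)), []) else (none, s.children)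

/-- The root of the search tree, if the vertices to be kept form a cactus forest. -/
def init (x : Edges × List Bool × ℕ) : List State :=
  let S := (List.range x.2.1.length).filter fun i => listCase false (fun b _ => b) (x.2.1.drop i)
  if cactusTest x.1 S then
    [⟨x.1, (List.range x.2.1.length).filter fun i => !memb S i, S, [], x.2.2, x.2.1.length⟩] else []

instance : Enc State := ⟨fun s => enc (s.L, s.R, s.F, s.X, s.k, s.n)⟩

end State

/-! ### The algorithm takes polynomial time per node -/

section

variable {γ : Type} [Enc γ]

theorem PT.contract {a b z : γ → ℕ} (ha : PT a) (hb : PT b) (hz : PT z) :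
    PT fun c => contract (a c) (b c) (z c) := (hz.beq hb).ite ha hz

theorem PT.contractFirst : PT contractFirst := by
  have hs : PT fun x : (Edges × ℕ × ℕ) × (ℕ × ℕ) × Edges => x.1 := .fst
  have he1 : PT fun x : (Edges × ℕ × ℕ) × (ℕ × ℕ) × Edges => x.2.1.1 := PT.snd.fst'.fst'
  have he2 : PT fun x : (Edges × ℕ × ℕ) × (ℕ × ℕ) × Edges => x.2.1.2 := PT.snd.fst'.snd'
  refine PT.listCase (l := fun s : Edges × ℕ × ℕ => s.1) (n := fun s => s)
    (c := fun s e L => (L.map fun f => (CactusDeletion.contract e.1 e.2 f.1,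
      CactusDeletion.contract e.1 e.2 f.2), CactusDeletion.contract e.1 e.2 s.2.1,
      CactusDeletion.contract e.1 e.2 s.2.2)) .fst .id ?_
  refine .pair (PT.map (f := fun (x : (Edges × ℕ × ℕ) × (ℕ × ℕ) × Edges) f =>
    (CactusDeletion.contract x.2.1.1 x.2.1.2 f.1, CactusDeletion.contract x.2.1.1 x.2.1.2 f.2))
    ?_ PT.snd.snd') (.pair (.contract he1 he2 hs.snd'.fst') (.contract he1 he2 hs.snd'.snd'))
  exact .pair (.contract (he1.comp .fst) (he2.comp .fst) PT.snd.fst')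
    (.contract (he1.comp .fst) (he2.comp .fst) PT.snd.snd')

/-- Contraction creates neither larger vertex numbers nor additional edges. This is the size bound
that the iteration in `PT.contractAll` requires. -/
theorem contractFirst_bounded (m l : ℕ) (s : Edges × ℕ × ℕ)
    (hs : (∀ e ∈ s.1, e.1 ≤ m ∧ e.2 ≤ m) ∧ s.1.length ≤ l ∧ s.2.1 ≤ m ∧ s.2.2 ≤ m) :
    (∀ e ∈ (contractFirst s).1, e.1 ≤ m ∧ e.2 ≤ m) ∧ (contractFirst s).1.length ≤ l ∧
      (contractFirst s).2.1 ≤ m ∧ (contractFirst s).2.2 ≤ m := by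
  obtain ⟨L, x, y⟩ := s
  cases L with
  | nil => exact hs
  | cons e L =>
    obtain ⟨h1, h2, h3, h4⟩ := hs
    have he := h1 e List.mem_cons_self
    have hc : ∀ z, z ≤ m → contract e.1 e.2 z ≤ m := by
      intro z hz; unfold contract; split_ifs <;> omega
    simp only [contractFirst, listCase, List.length_map]
    refine ⟨fun f hf => ?_, ?_, hc _ h3, hc _ h4⟩
    · obtain ⟨g, hg, rfl⟩ := List.mem_map.1 hf
      have := h1 g (List.mem_cons_of_mem _ hg)
      exact ⟨hc _ this.1, hc _ this.2⟩
    · rw [List.length_cons] at h2; omega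

theorem sz_edges_le {L : Edges} {m l : ℕ} (h : ∀ e ∈ L, e.1 ≤ m ∧ e.2 ≤ m) (hl : L.length ≤ l) :
    sz L ≤ l * (4 * m + 4) + 1 := by
  refine (sz_list_le (m := 4 * m + 3) fun e he => ?_).trans
    (Nat.add_le_add_right (Nat.mul_le_mul_right _ hl) 1)
  have := h e he
  have h2 := sz_pair e.1 e.2
  change sz e = _ at h2
  rw [h2, sz_nat, sz_nat]
  omega

theorem PT.contractAll : PT contractAll := by
  refine PT.of_para (γ := Edges × ℕ × ℕ) (l := fun s => s.1)
    (g := fun s (l : Edges) => CactusDeletion.contractFirst^[l.length] s) (fun s => s)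
    (fun y => CactusDeletion.contractFirst y.2.2.2) .id
    (PT.contractFirst.comp PT.snd.snd'.snd') .fst ?_ ?_
  · intro c l
    induction l with
    | nil => rfl
    | cons a l ih =>
      simp only [CactusDeletion.para, ih, List.length_cons, Function.iterate_succ_apply']
  · refine ((Bdd.size.mul ((Bdd.size.mul (.const 4)).add (.const 4))).add
      ((Bdd.size.mul (.const 4)).add (.const 5))).mono fun x => ?_
    obtain ⟨s, l⟩ := x
    have hsz : sz s ≤ sz (s, l) := sz_fst_le (s, l)
    have h0 : (∀ e ∈ s.1, e.1 ≤ sz (s, l) ∧ e.2 ≤ sz (s, l)) ∧ s.1.length ≤ sz (s, l) ∧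
        s.2.1 ≤ sz (s, l) ∧ s.2.2 ≤ sz (s, l) := by
      have h1 := sz_pair s.1 s.2
      have h2 := sz_pair s.2.1 s.2.2
      change sz s = _ at h1
      change sz s.2 = _ at h2
      rw [sz_nat, sz_nat] at h2
      refine ⟨fun e he => ?_, ?_, by omega, by omega⟩
      · have h3 := sz_mem_lt he
        have h4 := sz_pair e.1 e.2
        change sz e = _ at h4
        rw [sz_nat, sz_nat] at h4
        omega
      · have := length_lt_sz s.1
        omega
    have hinv : ∀ i, (∀ e ∈ (CactusDeletion.contractFirst^[i] s).1,
        e.1 ≤ sz (s, l) ∧ e.2 ≤ sz (s, l)) ∧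
        (CactusDeletion.contractFirst^[i] s).1.length ≤ sz (s, l) ∧
        (CactusDeletion.contractFirst^[i] s).2.1 ≤ sz (s, l) ∧
        (CactusDeletion.contractFirst^[i] s).2.2 ≤ sz (s, l) := by
      intro i
      induction i with
      | zero => exact h0
      | succ i ih =>
        rw [Function.iterate_succ_apply']
        exact contractFirst_bounded _ _ _ ih
    obtain ⟨h1, h2, h3, h4⟩ := hinv l.length
    have h5 := sz_edges_le h1 h2
    simp only
    set r := CactusDeletion.contractFirst^[l.length] s
    have h6 := sz_pair r.1 r.2
    have h7 := sz_pair r.2.1 r.2.2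
    change sz r = _ at h6
    change sz r.2 = _ at h7
    rw [sz_nat, sz_nat] at h7
    rw [Nat.mul_comm (sz (s, l)) 4] 
    omega

theorem PT.ec0 {L : γ → Edges} {x y : γ → ℕ} (hL : PT L) (hx : PT x) (hy : PT y) :
    PT fun c => ec0 (L c) (x c) (y c) := by
  have := PT.contractAll.comp (hL.pair (hx.pair hy))
  exact this.snd'.fst'.beq this.snd'.snd'

theorem PT.ec1 {L : γ → Edges} {x y : γ → ℕ} (hL : PT L) (hx : PT x) (hy : PT y) :
    PT fun c => ec1 (L c) (x c) (y c) :=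
  (PT.ec0 hL hx hy).and (PT.all (p := fun c e => CactusDeletion.ec0 ((L c).erase e) (x c) (y c))
    (.ec0 ((hL.comp .fst).erase .snd) (hx.comp .fst) (hy.comp .fst)) hL)

theorem PT.ec2 {L : γ → Edges} {x y : γ → ℕ} (hL : PT L) (hx : PT x) (hy : PT y) :
    PT fun c => ec2 (L c) (x c) (y c) :=
  (PT.ec1 hL hx hy).and (PT.all (p := fun c e => CactusDeletion.ec1 ((L c).erase e) (x c) (y c))
    (.ec1 ((hL.comp .fst).erase .snd) (hx.comp .fst) (hy.comp .fst)) hL)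

theorem PT.memb {l : γ → List ℕ} {z : γ → ℕ} (hl : PT l) (hz : PT z) :
    PT fun c => memb (l c) (z c) := PT.contains hl hz

theorem PT.ind {p : γ → ℕ → Bool} {L : γ → Edges} (hp : PT fun x : γ × ℕ => p x.1 x.2)
    (hL : PT L) : PT fun c => ind (p c) (L c) :=
  PT.filter (p := fun c (e : ℕ × ℕ) => p c e.1 && p c e.2)
    ((hp.comp (PT.fst.pair PT.snd.fst')).and (hp.comp (PT.fst.pair PT.snd.snd'))) hL

theorem PT.cactusTest {L : γ → Edges} {V : γ → List ℕ} (hL : PT L) (hV : PT V) :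
    PT fun c => cactusTest (L c) (V c) := by
  refine PT.all (p := fun c x => (V c).all fun y => x == y ||
    !CactusDeletion.ec2 (CactusDeletion.ind (CactusDeletion.memb (V c)) (L c)) x y) ?_ hV
  refine PT.all (p := fun (c : γ × ℕ) y => c.2 == y ||
    !CactusDeletion.ec2 (CactusDeletion.ind (CactusDeletion.memb (V c.1)) (L c.1)) c.2 y) ?_
    (hV.comp .fst)
  have hL' : PT fun c => CactusDeletion.ind (CactusDeletion.memb (V c)) (L c) :=
    PT.ind (.memb (hV.comp .fst) .snd) hL
  exact (PT.fst.snd'.beq .snd).or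
    (PT.ec2 (hL'.comp PT.fst.fst') PT.fst.snd' .snd).not

theorem PT.adj {L : γ → Edges} {a b : γ → ℕ} (hL : PT L) (ha : PT a) (hb : PT b) :
    PT fun c => adj (L c) (a c) (b c) :=
  (ha.beq hb).not.and (PT.any (p := fun c e => e == (a c, b c) || e == (b c, a c))
    ((PT.snd.beq_edge ((ha.pair hb).comp .fst)).or (PT.snd.beq_edge ((hb.pair ha).comp .fst))) hL)

theorem PT.mult {L : γ → Edges} {a b : γ → ℕ} (hL : PT L) (ha : PT a) (hb : PT b) :
    PT fun c => mult (L c) (a c) (b c) := by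
  have := (PT.filter (p := fun c e => e == (a c, b c) || e == (b c, a c))
    ((PT.snd.beq_edge ((ha.pair hb).comp .fst)).or (PT.snd.beq_edge ((hb.pair ha).comp .fst)))
    hL).length
  simp only [← List.countP_eq_length_filter] at this
  exact this

theorem PT.ind_ne {L : γ → Edges} {v : γ → ℕ} (hL : PT L) (hv : PT v) :
    PT fun c => CactusDeletion.ind (fun z => !(z == v c)) (L c) :=
  PT.ind (p := fun c z => !(z == v c)) (PT.snd.beq (hv.comp .fst)).not hL

theorem PT.bypass {L : γ → Edges} {v u w : γ → ℕ} (hL : PT L) (hv : PT v) (hu : PT u)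
    (hw : PT w) : PT fun c => bypass (L c) (v c) (u c) (w c) :=
  (hL.ind_ne hv).append (((hL.mult hv hu).max (hL.mult hv hw)).replicate (hu.pair hw))

theorem PT.list_two {α : Type} [Enc α] {a b : γ → α} (ha : PT a) (hb : PT b) :
    PT fun c => [a c, b c] := ha.cons (hb.cons (.const []))

theorem PT.list_three {α : Type} [Enc α] {a b d : γ → α} (ha : PT a) (hb : PT b) (hd : PT d) :
    PT fun c => [a c, b c, d c] := ha.cons (hb.cons (hd.cons (.const [])))

end

namespace State

section

variable {γ : Type} [Enc γ] {s : γ → State}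

theorem pt_tuple (hs : PT s) :
    PT fun c => ((s c).L, (s c).R, (s c).F, (s c).X, (s c).k, (s c).n) :=
  (PT.of_enc_eq (f := fun s : State => (s.L, s.R, s.F, s.X, s.k, s.n)) fun _ => rfl).comp hs

theorem pt_L (hs : PT s) : PT fun c => (s c).L := (pt_tuple hs).fst'
theorem pt_R (hs : PT s) : PT fun c => (s c).R := (pt_tuple hs).snd'.fst'
theorem pt_F (hs : PT s) : PT fun c => (s c).F := (pt_tuple hs).snd'.snd'.fst'
theorem pt_X (hs : PT s) : PT fun c => (s c).X := (pt_tuple hs).snd'.snd'.snd'.fst'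
theorem pt_k (hs : PT s) : PT fun c => (s c).k := (pt_tuple hs).snd'.snd'.snd'.snd'.fst'
theorem pt_n (hs : PT s) : PT fun c => (s c).n := (pt_tuple hs).snd'.snd'.snd'.snd'.snd'

theorem pt_mk {L : γ → Edges} {R F X : γ → List ℕ} {k n : γ → ℕ} (hL : PT L) (hR : PT R)
    (hF : PT F) (hX : PT X) (hk : PT k) (hn : PT n) :
    PT fun c => (⟨L c, R c, F c, X c, k c, n c⟩ : State) :=
  (PT.of_enc_eq (f := fun x : Edges × List ℕ × List ℕ × List ℕ × ℕ × ℕ =>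
    (⟨x.1, x.2.1, x.2.2.1, x.2.2.2.1, x.2.2.2.2.1, x.2.2.2.2.2⟩ : State)) fun _ => rfl).comp
    (hL.pair (hR.pair (hF.pair (hX.pair (hk.pair hn)))))

theorem pt_filter_ne {l : γ → List ℕ} {v : γ → ℕ} (hl : PT l) (hv : PT v) :
    PT fun c => (l c).filter fun z => !(z == v c) :=
  PT.filter (p := fun c z => !(z == v c)) (PT.snd.beq (hv.comp .fst)).not hl

theorem pt_remove (hs : PT s) {v : γ → ℕ} (hv : PT v) : PT fun c => (s c).remove (v c) :=
  pt_mk ((pt_L hs).ind_ne hv) (pt_filter_ne (pt_R hs) hv) (pt_F hs) (pt_X hs) (pt_k hs) (pt_n hs)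

theorem pt_shortcut (hs : PT s) {v u w : γ → ℕ} (hv : PT v) (hu : PT u) (hw : PT w) :
    PT fun c => (s c).shortcut (v c) (u c) (w c) :=
  pt_mk ((pt_L hs).bypass hv hu hw) (pt_filter_ne (pt_R hs) hv) (pt_F hs) (pt_X hs) (pt_k hs)
    (pt_n hs)

theorem pt_delete (hs : PT s) {v : γ → ℕ} (hv : PT v) : PT fun c => (s c).delete (v c) :=
  ((pt_k hs).beq (.const 0)).ite (.const []) <| .cons
    (pt_mk (pt_L (pt_remove hs hv)) (pt_R (pt_remove hs hv)) (pt_F (pt_remove hs hv))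
      (hv.cons (pt_X hs)) ((pt_k hs).sub (.const 1)) (pt_n (pt_remove hs hv))) (.const [])

theorem pt_keep (hs : PT s) {W : γ → List ℕ} (hW : PT W) : PT fun c => (s c).keep (W c) :=
  (PT.cactusTest (pt_L hs) (hW.append (pt_F hs))).ite (.cons
    (pt_mk (pt_L hs) (PT.filter (p := fun c z => !memb (W c) z)
      (PT.memb (hW.comp .fst) .snd).not (pt_R hs)) (hW.append (pt_F hs)) (pt_X hs) (pt_k hs)
      (pt_n hs)) (.const [])) (.const [])

theorem pt_branch (hs : PT s) {W : γ → List ℕ} (hW : PT W) : PT fun c => (s c).branch (W c) :=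
  (PT.flatten (PT.map (f := fun c v => (s c).delete v) (pt_delete (hs.comp .fst) .snd) hW)).append
    (pt_keep hs hW)

end

theorem pt_conflicts : PT conflicts := by
  refine PT.filter (p := fun (s : State) (x : ℕ × ℕ × ℕ) =>
    !cactusTest s.L ([x.1, x.2.1, x.2.2] ++ s.F)) ?_
    ((pt_R .id).product ((pt_R .id).product (pt_R .id)))
  exact (PT.cactusTest (pt_L .fst) ((PT.list_three PT.snd.fst' PT.snd.snd'.fst'
    PT.snd.snd'.snd').append (pt_F .fst))).not

theorem pt_pendants : PT pendants := by
  have hV : PT fun s : State => s.R ++ s.F := (pt_R .id).append (pt_F .id)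
  refine PT.filter (p := fun (s : State) (x : ℕ × ℕ) =>
    (s.R ++ s.F).all fun z => !adj s.L x.1 z || z == x.2) ?_ ((pt_R .id).product hV)
  refine PT.all (p := fun (c : State × ℕ × ℕ) z => !adj c.1.L c.2.1 z || z == c.2.2) ?_
    (hV.comp .fst)
  exact (PT.adj (pt_L PT.fst.fst') PT.fst.snd'.fst' .snd).not.or (PT.snd.beq PT.fst.snd'.snd')

theorem pt_two_neighbours : PT fun c : State × ℕ × ℕ × ℕ =>
    adj c.1.L c.2.1 c.2.2.1 && (adj c.1.L c.2.1 c.2.2.2 && !(c.2.2.1 == c.2.2.2)) :=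
  (PT.adj (pt_L .fst) PT.snd.fst' PT.snd.snd'.fst').and
    ((PT.adj (pt_L .fst) PT.snd.fst' PT.snd.snd'.snd').and
      (PT.snd.snd'.fst'.beq PT.snd.snd'.snd').not)

theorem pt_bypassables : PT bypassables := by
  have hV : PT fun s : State => s.R ++ s.F := (pt_R .id).append (pt_F .id)
  refine PT.filter (p := fun (s : State) (x : ℕ × ℕ × ℕ) =>
    (adj s.L x.1 x.2.1 && (adj s.L x.1 x.2.2 && !(x.2.1 == x.2.2))) &&
      (s.R ++ s.F).all fun z => !adj s.L x.1 z || (z == x.2.1 || z == x.2.2)) ?_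
    ((pt_R .id).product ((pt_R .id).product hV))
  refine pt_two_neighbours.and (PT.all (p := fun (c : State × ℕ × ℕ × ℕ) z =>
    !adj c.1.L c.2.1 z || (z == c.2.2.1 || z == c.2.2.2)) ?_ (hV.comp .fst))
  exact (PT.adj (pt_L PT.fst.fst') PT.fst.snd'.fst' .snd).not.or
    ((PT.snd.beq PT.fst.snd'.snd'.fst').or (PT.snd.beq PT.fst.snd'.snd'.snd'))

theorem pt_attached : PT attached :=
  PT.filter (p := fun (s : State) (x : ℕ × ℕ × ℕ) =>
    adj s.L x.1 x.2.1 && (adj s.L x.1 x.2.2 && !(x.2.1 == x.2.2))) pt_two_neighbours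
    ((pt_R .id).product ((pt_F .id).product (pt_F .id)))

theorem pt_linking : PT linking := by
  refine PT.filter (p := fun (s : State) (x : (ℕ × ℕ) × ℕ × ℕ) =>
    adj s.L x.1.1 x.1.2 && (adj s.L x.1.1 x.2.1 && (adj s.L x.1.2 x.2.2 &&
      !ec0 (ind (memb s.F) s.L) x.2.1 x.2.2))) ?_
    (((pt_R .id).product (pt_R .id)).product ((pt_F .id).product (pt_F .id)))
  have hL : PT fun c : State × (ℕ × ℕ) × ℕ × ℕ => c.1.L := pt_L .fst
  have hF : PT fun c : State × (ℕ × ℕ) × ℕ × ℕ => ind (memb c.1.F) c.1.L :=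
    PT.ind (p := fun (c : State × (ℕ × ℕ) × ℕ × ℕ) z => memb c.1.F z)
      (PT.memb (pt_F PT.fst.fst') .snd) hL
  exact (hL.adj PT.snd.fst'.fst' PT.snd.fst'.snd').and ((hL.adj PT.snd.fst'.fst'
    PT.snd.snd'.fst').and ((hL.adj PT.snd.fst'.snd' PT.snd.snd'.snd').and
      (hF.ec0 PT.snd.snd'.fst' PT.snd.snd'.snd').not))

theorem pt_children : PT children := by
  refine PT.listCase (l := conflicts) (c := fun s x _ => s.branch [x.1, x.2.1, x.2.2])
    pt_conflicts ?_ (pt_branch .fst (PT.list_three PT.snd.fst'.fst' PT.snd.fst'.snd'.fst'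
      PT.snd.fst'.snd'.snd'))
  refine PT.listCase (l := pendants) (c := fun s x _ => [s.remove x.1]) pt_pendants ?_
    ((pt_remove .fst PT.snd.fst'.fst').cons (.const []))
  refine PT.listCase (l := bypassables) (c := fun s x _ => [s.shortcut x.1 x.2.1 x.2.2])
    pt_bypassables ?_ ((pt_shortcut .fst PT.snd.fst'.fst' PT.snd.fst'.snd'.fst'
      PT.snd.fst'.snd'.snd').cons (.const []))
  refine PT.listCase (l := attached) (c := fun s x _ => s.branch [x.1]) pt_attached ?_
    (pt_branch .fst (PT.snd.fst'.fst'.cons (.const [])))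
  exact PT.listCase (l := linking) (c := fun s x _ => s.branch [x.1.1, x.1.2]) pt_linking
    (.const []) (pt_branch .fst (PT.list_two PT.snd.fst'.fst'.fst' PT.snd.fst'.fst'.snd'))

theorem pt_step : PT step :=
  (pt_R .id).isEmpty.ite
    ((PT.map (f := fun (s : State) i => memb s.X i) (PT.memb (pt_X .fst) .snd)
      (pt_n .id).range).some.pair (.const []))
    ((PT.const none).pair pt_children)

theorem pt_init : PT init := by
  have hn : PT fun x : Edges × List Bool × ℕ => List.range x.2.1.length := PT.snd.fst'.length.range
  have hS : PT fun x : Edges × List Bool × ℕ => (List.range x.2.1.length).filter fun i =>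
      listCase false (fun b _ => b) (x.2.1.drop i) := by
    refine PT.filter (p := fun (x : Edges × List Bool × ℕ) i =>
      listCase false (fun b _ => b) (x.2.1.drop i)) ?_ hn
    exact PT.listCase (l := fun c : (Edges × List Bool × ℕ) × ℕ => c.1.2.1.drop c.2)
      (n := fun _ => false) (c := fun _ b _ => b) (PT.drop .snd PT.fst.snd'.fst') (.const _)
      PT.snd.fst'
  exact (PT.cactusTest .fst hS).ite (.cons (pt_mk .fst
    (PT.filter (p := fun (x : Edges × List Bool × ℕ) i => !memb ((List.range x.2.1.length).filter
      fun i => listCase false (fun b _ => b) (x.2.1.drop i)) i)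
      (PT.memb (hS.comp .fst) .snd).not hn) hS (.const []) PT.snd.snd' PT.snd.fst'.length)
    (.const [])) (.const [])

end State

/-! ### Deleting vertices from a list of edges -/

/-- The edges that avoid `Y`. -/
def without (Y : Finset ℕ) (L : Edges) : Edges := ind (fun z => !decide (z ∈ Y)) L

theorem indSet_sublist_without {A Y : Finset ℕ} (h : Disjoint A Y) (L : Edges) :
    (indSet A L).Sublist (without Y L) :=
  ind_sublist_ind fun e _ h1 h2 => by
    have h1 := Finset.disjoint_left.1 h (of_decide_eq_true h1)
    have h2 := Finset.disjoint_left.1 h (of_decide_eq_true h2)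
    simp [h1, h2]

/-! ### Adjacency and multiplicity in subgraphs -/

theorem mult_le_of_sublist {L L' : Edges} (h : L'.Sublist L) (a b : ℕ) : mult L' a b ≤ mult L a b :=
  h.countP_le

theorem mult_ind {p : ℕ → Bool} {L : Edges} {a b : ℕ} (ha : p a = true) (hb : p b = true) :
    mult (ind p L) a b = mult L a b := by
  unfold mult ind
  rw [List.countP_filter]
  refine List.countP_congr fun e _ => ?_
  constructor
  · intro h
    exact (Bool.and_eq_true_iff.1 h).1
  · intro h
    rw [Bool.and_eq_true]
    refine ⟨h, ?_⟩
    simp only [Bool.or_eq_true, beq_iff_eq] at h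
    rcases h with rfl | rfl <;> simp [ha, hb]

theorem mult_le_two {L : Edges} (hC : Cactus L) {a b : ℕ} (hab : a ≠ b) : mult L a b ≤ 2 := by
  by_contra h
  refine hab (hC a b fun U hU => ?_)
  by_contra hne
  refine h (le_trans (List.countP_mono_left fun e _ he => ?_) hU)
  simp only [Bool.or_eq_true, beq_iff_eq] at he
  rcases he with rfl | rfl
  · simpa using hne
  · simpa using Ne.symm hne

theorem mult_eq_zero {L : Edges} {a b : ℕ} (hab : a ≠ b) (h : ¬ adj L a b = true) :
    mult L a b = 0 := by
  rw [adj_iff] at h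
  refine List.countP_eq_zero.2 fun e he => ?_
  simp only [Bool.or_eq_true, beq_iff_eq]
  rintro (rfl | rfl)
  · exact h ⟨hab, Or.inl he⟩
  · exact h ⟨hab, Or.inr he⟩

theorem adj_of_sublist {L L' : Edges} (h : L'.Sublist L) {a b : ℕ} (hab : adj L' a b = true) :
    adj L a b = true := by
  rw [adj_iff] at hab ⊢
  exact ⟨hab.1, hab.2.imp (fun h' => h.subset h') (fun h' => h.subset h')⟩

theorem adj_ind {p : ℕ → Bool} {L : Edges} {a b : ℕ} (ha : p a = true) (hb : p b = true)
    (hab : adj L a b = true) : adj (ind p L) a b = true := by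
  rw [adj_iff] at hab ⊢
  exact ⟨hab.1, hab.2.imp (fun h => mem_ind.2 ⟨h, ha, hb⟩) (fun h => mem_ind.2 ⟨h, hb, ha⟩)⟩

theorem of_adj_ind {p : ℕ → Bool} {L : Edges} {a b : ℕ} (h : adj (ind p L) a b = true) :
    p a = true ∧ p b = true := by
  rcases (adj_iff.1 h).2 with h | h
  · exact (mem_ind.1 h).2
  · exact (mem_ind.1 h).2.symm

/-- A vertex without neighbours outside `{u}` can be put back. -/
theorem Cactus.of_remove {L : Edges} {v u : ℕ} (h : ∀ z, adj L v z = true → z = u)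
    (hm : adj L v u = true → mult L v u ≤ 2) (hC : Cactus (ind (fun z => !(z == v)) L)) :
    Cactus L := by
  by_cases hvu : adj L v u = true
  · exact Cactus.of_remove_pendant h (hm hvu) hC
  · have hno : ∀ z, ¬ adj L v z = true := fun z hz => hvu (h z hz ▸ hz)
    refine Cactus.of_remove_pendant (u := v + 1) (fun z hz => absurd hz (hno z)) ?_ hC
    rw [mult_eq_zero (by omega) (hno _)]
    omega

theorem ind_comm (p q : ℕ → Bool) (L : Edges) : ind p (ind q L) = ind q (ind p L) := by
  simp only [ind_ind, Bool.and_comm]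

theorem ind_append (p : ℕ → Bool) (L L' : Edges) : ind p (L ++ L') = ind p L ++ ind p L' :=
  List.filter_append ..

theorem ind_bypass {p : ℕ → Bool} (L : Edges) {v u w : ℕ} (hv : p v = true) (hu : p u = true)
    (hw : p w = true) : ind p (bypass L v u w) = bypass (ind p L) v u w := by
  unfold bypass
  rw [ind_append, ind_comm, mult_ind hv hu, mult_ind hv hw]
  congr 1
  exact List.filter_eq_self.2 fun e he => by simp [List.eq_of_mem_replicate he, hu, hw]

theorem ind_bypass_of_not {p : ℕ → Bool} (L : Edges) {v u w : ℕ}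
    (h : ¬ (p u = true ∧ p w = true)) :
    ind p (bypass L v u w) = ind p (ind (fun z => !(z == v)) L) := by
  unfold bypass
  rw [ind_append]
  convert List.append_nil _
  refine List.filter_eq_nil_iff.2 fun e he => ?_
  rw [List.eq_of_mem_replicate he]
  simpa using h

/-- The new bundle is as large as the larger of the two bundles removed at `v`. Hence the graph does
not grow along the search. -/
theorem length_bypass_le {L : Edges} {v u w : ℕ} (huw : u ≠ w) (hu : v ≠ u) (hw : v ≠ w) :
    (bypass L v u w).length ≤ L.length := by
  unfold bypass
  rw [List.length_append, List.length_replicate]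
  refine (Nat.add_le_add_left (max_le_add_of_nonneg (Nat.zero_le _) (Nat.zero_le _)) _).trans ?_
  change (L.filter fun e => !(e.1 == v) && !(e.2 == v)).length + (L.countP _ + L.countP _) ≤ _
  induction L with
  | nil => simp
  | cons e L ih =>
    obtain ⟨a, b⟩ := e
    simp only [List.countP_cons, List.filter_cons, Bool.and_eq_true, Bool.not_eq_true',
      beq_eq_false_iff_ne, Bool.or_eq_true, beq_iff_eq, Prod.mk.injEq]
    rw [List.length_cons]
    split_ifs <;> first | omega | (simp only [List.length_cons]; omega)

theorem indSet_remove {A : Finset ℕ} {v : ℕ} (hv : v ∉ A) (L : Edges) :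
    indSet A (ind (fun z => !(z == v)) L) = indSet A L := by
  unfold indSet
  rw [ind_ind]
  congr 1
  funext z
  by_cases hz : z = v
  · simp [hz, hv]
  · simp [hz]

/-! ### Feasible sets -/

/-- `Y` consists of at most `k` vertices of `R` and meets all obstructions. -/
structure Feasible (L : Edges) (R : Finset ℕ) (k : ℕ) (Y : Finset ℕ) : Prop where
  subset : Y ⊆ R
  card_le : Y.card ≤ k
  cactus : Cactus (without Y L)

theorem Feasible.remove {L : Edges} {R : Finset ℕ} {k v : ℕ} {Y : Finset ℕ}
    (h : Feasible L R k Y) (hv : v ∉ Y) :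
    Feasible (ind (fun z => !(z == v)) L) (R.erase v) k Y where
  subset := Finset.subset_erase.2 ⟨h.subset, hv⟩
  card_le := h.card_le
  cactus := h.cactus.mono ((ind_sublist _ _).filter _)

theorem Feasible.delete {L : Edges} {R : Finset ℕ} {k v : ℕ} {Y : Finset ℕ}
    (h : Feasible L R k Y) (hv : v ∈ Y) :
    k ≠ 0 ∧ Feasible (ind (fun z => !(z == v)) L) (R.erase v) (k - 1) (Y.erase v) := by
  have h1 := Finset.card_erase_of_mem hv
  have h2 : 0 < Y.card := Finset.card_pos.2 ⟨v, hv⟩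
  have h3 := h.card_le
  refine ⟨by omega, Finset.erase_subset_erase _ h.subset, by omega, h.cactus.mono ?_⟩
  unfold without
  rw [ind_ind]
  refine ind_sublist_ind fun e _ => ?_
  simp only [Finset.mem_erase, Bool.and_eq_true, Bool.not_eq_true', decide_eq_false_iff_not,
    beq_eq_false_iff_ne]
  tauto

theorem Feasible.of_delete {L : Edges} {R : Finset ℕ} {k v : ℕ} {Y : Finset ℕ} (hk : k ≠ 0)
    (hv : v ∈ R) (h : Feasible (ind (fun z => !(z == v)) L) (R.erase v) (k - 1) Y) :
    Feasible L R k (insert v Y) where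
  subset := Finset.insert_subset hv (h.subset.trans (Finset.erase_subset _ _))
  card_le := by
    have h1 := Finset.card_insert_le v Y
    have h2 := h.card_le
    omega
  cactus := by
    refine h.cactus.mono ?_
    unfold without
    rw [ind_ind]
    refine ind_sublist_ind fun e _ => ?_
    simp only [Finset.mem_insert, Bool.and_eq_true, Bool.not_eq_true', decide_eq_false_iff_not,
      beq_eq_false_iff_ne]
    tauto

theorem Feasible.of_remove {L : Edges} {R : Finset ℕ} {k v u : ℕ} {Y : Finset ℕ}
    (hn : ∀ z, z ∉ Y → adj L v z = true → z = u) (hm : adj L v u = true → mult L v u ≤ 2)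
    (h : Feasible (ind (fun z => !(z == v)) L) (R.erase v) k Y) : Feasible L R k Y where
  subset := h.subset.trans (Finset.erase_subset _ _)
  card_le := h.card_le
  cactus := by
    have hs : (without Y L).Sublist L := ind_sublist _ _
    refine Cactus.of_remove (v := v) (u := u) (fun z hz => ?_) (fun hvu => ?_) ?_
    · exact hn z (by simpa using (of_adj_ind hz).2) (adj_of_sublist hs hz)
    · exact (mult_le_of_sublist hs _ _).trans (hm (adj_of_sublist hs hvu))
    · rw [without, ind_comm]
      exact h.cactus

/-- If `Y` contains `u` or `w`, the bypass edges disappear with it, and `v` can be put back as a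
vertex with at most one neighbour. Otherwise `v` still has both neighbours and `cactus_bypass_iff`
applies to the remaining graph. -/
theorem Feasible.of_bypass {L : Edges} {R : Finset ℕ} {k v u w : ℕ} {Y : Finset ℕ}
    (huw : u ≠ w) (hu : adj L v u = true) (hw : adj L v w = true)
    (hn : ∀ z, adj L v z = true → z = u ∨ z = w) (hmu : mult L v u ≤ 2) (hmw : mult L v w ≤ 2)
    (h : Feasible (bypass L v u w) (R.erase v) k Y) : Feasible L R k Y := by
  have hv : v ∉ Y := fun h' => absurd (h.subset h') (by simp)
  by_cases huY : u ∈ Y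
  · refine Feasible.of_remove (v := v) (u := w)
      (fun z hz hvz => (hn z hvz).resolve_left fun h' => hz (h' ▸ huY)) (fun _ => hmw)
      ⟨h.subset, h.card_le, ?_⟩
    have := h.cactus
    rwa [without, ind_bypass_of_not _ (by simp [huY])] at this
  by_cases hwY : w ∈ Y
  · refine Feasible.of_remove (v := v) (u := u)
      (fun z hz hvz => (hn z hvz).resolve_right fun h' => hz (h' ▸ hwY)) (fun _ => hmu)
      ⟨h.subset, h.card_le, ?_⟩
    have := h.cactus
    rwa [without, ind_bypass_of_not _ (by simp [hwY])] at this
  refine ⟨h.subset.trans (Finset.erase_subset _ _), h.card_le, ?_⟩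
  have := h.cactus
  rw [without, ind_bypass L (by simp [hv]) (by simp [huY]) (by simp [hwY])] at this
  exact (cactus_bypass_iff huw (adj_ind (by simp [hv]) (by simp [huY]) hu)
    (adj_ind (by simp [hv]) (by simp [hwY]) hw)
    fun z hz => hn z (adj_of_sublist (ind_sublist _ _) hz)).1 this

/-- In a solution `v` can be exchanged for the undecided neighbour `u`: deleting `u` destroys all
bypass edges, and `v` is absent from the bypassed graph anyway. -/
theorem Feasible.bypass {L : Edges} {R : Finset ℕ} {k v u w : ℕ} {Y : Finset ℕ}
    (huw : u ≠ w) (hu : adj L v u = true) (hw : adj L v w = true)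
    (hn : ∀ z, adj L v z = true → z = u ∨ z = w) (huR : u ∈ R) (h : Feasible L R k Y) :
    ∃ Y', Feasible (bypass L v u w) (R.erase v) k Y' := by
  by_cases hv : v ∈ Y
  · refine ⟨insert u (Y.erase v), ?_, ?_, ?_⟩
    · exact Finset.insert_subset (Finset.mem_erase.2 ⟨(adj_iff.1 hu).1.symm, huR⟩)
        (Finset.erase_subset_erase _ h.subset)
    · have h1 := Finset.card_insert_le u (Y.erase v)
      have h2 := Finset.card_erase_of_mem hv
      have h3 : 0 < Y.card := Finset.card_pos.2 ⟨v, hv⟩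
      have h4 := h.card_le
      omega
    · rw [without, ind_bypass_of_not _ (by simp), ind_ind]
      refine h.cactus.mono (ind_sublist_ind fun e _ => ?_)
      simp only [Finset.mem_insert, Finset.mem_erase, Bool.and_eq_true, Bool.not_eq_true',
        decide_eq_false_iff_not, beq_eq_false_iff_ne]
      tauto
  · refine ⟨Y, Finset.subset_erase.2 ⟨h.subset, hv⟩, h.card_le, ?_⟩
    by_cases hY : u ∉ Y ∧ w ∉ Y
    · rw [without, ind_bypass L (by simp [hv]) (by simp [hY.1]) (by simp [hY.2])]
      exact (cactus_bypass_iff huw (adj_ind (by simp [hv]) (by simp [hY.1]) hu)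
        (adj_ind (by simp [hv]) (by simp [hY.2]) hw)
        fun z hz => hn z (adj_of_sublist (ind_sublist _ _) hz)).2 h.cactus
    · rw [without, ind_bypass_of_not _ (by simpa using hY)]
      exact (h.remove hv).cactus

/-! ### The potential -/

/-- Weights for the numbers of components and of two-edge-connected components. -/
noncomputable def potential (L : Edges) (F : Finset ℕ) : ℝ :=
  (54 / 25) ^ rank 0 (indSet F L) F * (6 / 5) ^ rank 1 (indSet F L) F

theorem one_le_potential (L : Edges) (F : Finset ℕ) : 1 ≤ potential L F :=
  one_le_mul_of_one_le_of_one_le (one_le_pow₀ (by norm_num)) (one_le_pow₀ (by norm_num))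

theorem potential_le (L : Edges) (F : Finset ℕ) : potential L F ≤ (324 / 125) ^ F.card := by
  have : (324 / 125 : ℝ) = 54 / 25 * (6 / 5) := by norm_num
  rw [this, mul_pow]
  exact mul_le_mul (pow_le_pow_right₀ (by norm_num) (rank_le_card ..))
    (pow_le_pow_right₀ (by norm_num) (rank_le_card ..)) (by positivity) (by positivity)

/-- The factor is at most `(6/5) / (54/25) = 5/9` if components are joined, and at most `5/6` if
2-edge-connected components are merged. -/
theorem potential_keep_one {L : Edges} {F : Finset ℕ} {v f g : ℕ} (hv : v ∉ F) (hf : f ∈ F)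
    (hg : g ∈ F) (hfg : f ≠ g) (hvf : adj L v f = true) (hvg : adj L v g = true)
    (hC : Cactus (indSet (F ∪ {v}) L)) : potential L (F ∪ {v}) ≤ 5 / 6 * potential L F := by
  unfold potential
  generalize h0 : rank 0 (indSet F L) F = a
  generalize h1 : rank 1 (indSet F L) F = b
  have := rank_keep_one hv hf hg hfg hvf hvg hC
  rw [h0, h1] at this
  rcases this with ⟨h, h'⟩ | ⟨h, h'⟩
  · have e1 := pow_le_pow_right₀ (a := (54 / 25 : ℝ)) (by norm_num) h
    have e2 := pow_le_pow_right₀ (a := (6 / 5 : ℝ)) (by norm_num) h'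
    rw [pow_succ] at e1 e2
    have := mul_le_mul e1 e2 (by positivity) (by positivity)
    have : (0 : ℝ) < (54 / 25) ^ a * (6 / 5) ^ b := by positivity
    nlinarith
  · have e1 := pow_le_pow_right₀ (a := (54 / 25 : ℝ)) (by norm_num) h
    have e2 := pow_le_pow_right₀ (a := (6 / 5 : ℝ)) (by norm_num) h'
    rw [pow_succ] at e2
    have := mul_le_mul e1 e2 (by positivity) (by positivity)
    nlinarith

/-- The factor is at most `(6/5)^2 / (54/25)`, which is exactly `2/3`. -/
theorem potential_keep_two {L : Edges} {F : Finset ℕ} {v w f g : ℕ} (hf : f ∈ F) (hg : g ∈ F)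
    (hvw : adj L v w = true) (hvf : adj L v f = true) (hwg : adj L w g = true)
    (hE : ¬ EC 0 (indSet F L) f g) : potential L (F ∪ {v, w}) ≤ 2 / 3 * potential L F := by
  unfold potential
  generalize h0 : rank 0 (indSet F L) F = a
  generalize h1 : rank 1 (indSet F L) F = b
  have := rank_keep_two hf hg hvw hvf hwg hE
  rw [h0, h1] at this
  obtain ⟨h, h'⟩ := this
  have e1 := pow_le_pow_right₀ (a := (54 / 25 : ℝ)) (by norm_num) h
  have e2 := pow_le_pow_right₀ (a := (6 / 5 : ℝ)) (by norm_num) h'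
  rw [pow_succ] at e1
  rw [pow_add] at e2
  have := mul_le_mul e1 e2 (by positivity) (by positivity)
  nlinarith

/-! ### Correctness of the branching -/

namespace State

/-- The part of the search tree below `s` contains at most this many nodes. -/
noncomputable def weight (s : State) : ℝ :=
  6 ^ s.k * potential s.L s.F.toFinset * (s.R.length + 1)

def Solvable (s : State) : Prop := ∃ Y, Feasible s.L s.R.toFinset s.k Y

/-- The invariant of the nodes of the search tree for the instance `L₀, R₀, k₀` of order `n`. -/
structure Invariant (L₀ : Edges) (R₀ : Finset ℕ) (k₀ n : ℕ) (s : State) : Prop where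
  order : s.n = n
  budget : s.k ≤ k₀
  length_L : s.L.length ≤ L₀.length
  length_le : s.F.length + s.X.length + 3 * s.R.length ≤ 4 * n
  lt_R : ∀ v ∈ s.R, v < n
  lt_F : ∀ v ∈ s.F, v < n
  lt_X : ∀ v ∈ s.X, v < n
  disj : ∀ v ∈ s.R, v ∉ s.F
  ends : ∀ e ∈ s.L, (e.1 ∈ s.R ∨ e.1 ∈ s.F) ∧ (e.2 ∈ s.R ∨ e.2 ∈ s.F)
  cactus_R : Cactus (indSet s.R.toFinset s.L)
  cactus_F : Cactus (indSet s.F.toFinset s.L)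
  sound : ∀ Y, Feasible s.L s.R.toFinset s.k Y → Feasible L₀ R₀ k₀ (Y ∪ s.X.toFinset)

theorem one_le_weight (s : State) : 1 ≤ s.weight :=
  one_le_mul_of_one_le_of_one_le (one_le_mul_of_one_le_of_one_le (one_le_pow₀ (by norm_num))
    (one_le_potential _ _)) (by simp)

theorem toFinset_filter_ne (l : List ℕ) (v : ℕ) :
    (l.filter fun z => !(z == v)).toFinset = l.toFinset.erase v := by
  ext z
  simp [and_comm]

theorem length_filter_ne {l : List ℕ} {v : ℕ} (hv : v ∈ l) :
    (l.filter fun z => !(z == v)).length + 1 ≤ l.length :=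
  List.length_filter_lt_length_iff_exists.2 ⟨v, hv, by simp⟩

/-- The list `l` is a correct list of children of `s`. -/
structure Refines (L₀ : Edges) (R₀ : Finset ℕ) (k₀ n : ℕ) (s : State) (l : List State) :
    Prop where
  invariant : ∀ c ∈ l, Invariant L₀ R₀ k₀ n c
  weight_le : (l.map weight).sum + 1 ≤ s.weight
  complete : s.Solvable → ∃ c ∈ l, c.Solvable

variable {L₀ : Edges} {R₀ : Finset ℕ} {k₀ n : ℕ} {s : State}

theorem Invariant.ends_remove (h : Invariant L₀ R₀ k₀ n s) (v : ℕ) :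
    ∀ e ∈ ind (fun z => !(z == v)) s.L, (e.1 ∈ (s.R.filter fun z => !(z == v)) ∨ e.1 ∈ s.F) ∧
      (e.2 ∈ (s.R.filter fun z => !(z == v)) ∨ e.2 ∈ s.F) := by
  intro e he
  obtain ⟨he, h1, h2⟩ := mem_ind.1 he
  have := h.ends e he
  simp only [List.mem_filter, h1, h2, and_true]
  exact this

theorem Invariant.cactus_remove (h : Invariant L₀ R₀ k₀ n s) (v : ℕ) :
    Cactus (indSet (s.R.filter fun z => !(z == v)).toFinset (ind (fun z => !(z == v)) s.L)) := by
  rw [toFinset_filter_ne]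
  refine h.cactus_R.mono (List.Sublist.trans ?_ (indSet_sublist (Finset.erase_subset v _) _))
  exact (ind_sublist _ _).filter _

/-- A state with an undecided vertex less whose potential has not changed. -/
theorem weight_reduce {c : State} (hk : c.k = s.k)
    (hF : potential c.L c.F.toFinset = potential s.L s.F.toFinset)
    (hR : c.R.length + 1 ≤ s.R.length) : ([c].map weight).sum + 1 ≤ s.weight := by
  simp only [List.map_cons, List.map_nil, List.sum_cons, List.sum_nil, add_zero, weight, hk, hF]
  have h1 : (1 : ℝ) ≤ 6 ^ s.k * potential s.L s.F.toFinset :=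
    one_le_mul_of_one_le_of_one_le (one_le_pow₀ (by norm_num)) (one_le_potential _ _)
  have h2 : (c.R.length : ℝ) + 1 ≤ s.R.length := by exact_mod_cast hR
  nlinarith

theorem potential_remove {v : ℕ} (hv : v ∉ s.F) :
    potential (ind (fun z => !(z == v)) s.L) s.F.toFinset = potential s.L s.F.toFinset := by
  unfold potential
  rw [indSet_remove (by simpa using hv)]

theorem refines_remove (h : Invariant L₀ R₀ k₀ n s) {v u : ℕ} (hv : v ∈ s.R)
    (hn : ∀ z, adj s.L v z = true → z = u) (hm : adj s.L v u = true → mult s.L v u ≤ 2) :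
    Refines L₀ R₀ k₀ n s [s.remove v] where
  invariant c hc := by
    rw [List.mem_singleton.1 hc]
    have hlen := length_filter_ne hv
    have hvF : v ∉ s.F.toFinset := by simpa using h.disj v hv
    exact {
      order := h.order
      budget := h.budget
      length_L := ((ind_sublist (fun z => !(z == v)) s.L).length_le).trans h.length_L
      length_le := by
        have := h.length_le
        simp only [remove]
        omega
      lt_R := fun v hv => h.lt_R v (List.mem_of_mem_filter hv)
      lt_F := h.lt_F
      lt_X := h.lt_X
      disj := fun v hv => h.disj v (List.mem_of_mem_filter hv)
      ends := h.ends_remove v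
      cactus_R := h.cactus_remove v
      cactus_F := by simpa only [remove, indSet_remove hvF] using h.cactus_F
      sound := fun Y hY => h.sound Y (by
        simp only [remove, toFinset_filter_ne] at hY
        exact hY.of_remove (fun z _ => hn z) hm) }
  weight_le := weight_reduce rfl (potential_remove (h.disj v hv)) (length_filter_ne hv)
  complete := by
    rintro ⟨Y, hY⟩
    refine ⟨_, List.mem_singleton_self _, Y.erase v, ?_⟩
    simp only [remove, toFinset_filter_ne]
    by_cases hv : v ∈ Y
    · have := (hY.delete hv).2
      exact ⟨this.subset, this.card_le.trans (Nat.sub_le _ _), this.cactus⟩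
    · rw [Finset.erase_eq_of_notMem hv]
      exact hY.remove hv

theorem refines_shortcut (h : Invariant L₀ R₀ k₀ n s) {v u w : ℕ} (hv : v ∈ s.R) (hu : u ∈ s.R)
    (hw : w ∈ s.R ∨ w ∈ s.F) (huw : u ≠ w) (hvu : adj s.L v u = true) (hvw : adj s.L v w = true)
    (hn : ∀ z, adj s.L v z = true → z = u ∨ z = w) (hmu : mult s.L v u ≤ 2)
    (hmw : mult s.L v w ≤ 2) : Refines L₀ R₀ k₀ n s [s.shortcut v u w] := by
  have hlen := length_filter_ne hv
  have hvF : v ∉ s.F.toFinset := by simpa using h.disj v hv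
  have huF : u ∉ s.F.toFinset := by simpa using h.disj u hu
  have hne1 := (adj_iff.1 hvu).1
  have hne2 := (adj_iff.1 hvw).1
  have hF : indSet s.F.toFinset (bypass s.L v u w) = indSet s.F.toFinset s.L := by
    rw [indSet, ind_bypass_of_not _ (by simp only [decide_eq_true_eq]; tauto)]
    exact indSet_remove hvF _
  refine ⟨fun c hc => ?_, weight_reduce rfl ?_ hlen, ?_⟩
  · rw [List.mem_singleton.1 hc]
    exact {
      order := h.order
      budget := h.budget
      length_L := (length_bypass_le huw hne1 hne2).trans h.length_L
      length_le := by
        have := h.length_le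
        simp only [shortcut]
        omega
      lt_R := fun v hv => h.lt_R v (List.mem_of_mem_filter hv)
      lt_F := h.lt_F
      lt_X := h.lt_X
      disj := fun v hv => h.disj v (List.mem_of_mem_filter hv)
      ends := by
        intro e he
        rcases List.mem_append.1 he with he | he
        · exact h.ends_remove v e he
        · rw [List.eq_of_mem_replicate he]
          simp only [shortcut, List.mem_filter, Bool.not_eq_true', beq_eq_false_iff_ne]
          exact ⟨Or.inl ⟨hu, hne1.symm⟩, hw.imp (fun hw => ⟨hw, hne2.symm⟩) id⟩
      cactus_R := by
        simp only [shortcut]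
        -- If `w` is kept, the bypass edges leave `R`, and inside `R` only the removal of `v` is
        -- visible.
        by_cases hwR : w ∈ s.R
        · rw [toFinset_filter_ne]
          have hp : ∀ z ∈ s.R, (fun z => decide (z ∈ s.R.toFinset)) z = true := by simp
          refine Cactus.mono (indSet_sublist (Finset.erase_subset v _) _) ?_
          rw [indSet, ind_bypass s.L (hp v hv) (hp u hu) (hp w hwR)]
          exact (cactus_bypass_iff huw (adj_ind (hp v hv) (hp u hu) hvu)
            (adj_ind (hp v hv) (hp w hwR) hvw)
            fun z hz => hn z (adj_of_sublist (ind_sublist _ _) hz)).2 h.cactus_R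
        · rw [indSet, ind_bypass_of_not _ (by simp [hwR])]
          exact h.cactus_remove v
      cactus_F := by simpa only [shortcut, hF] using h.cactus_F
      sound := fun Y hY => h.sound Y (by
        simp only [shortcut, toFinset_filter_ne] at hY
        exact hY.of_bypass huw hvu hvw hn hmu hmw) }
  · simp only [potential, shortcut, hF]
  · rintro ⟨Y, hY⟩
    obtain ⟨Y', hY'⟩ := hY.bypass huw hvu hvw hn (by simpa using hu)
    refine ⟨_, List.mem_singleton_self _, Y', ?_⟩
    simpa only [shortcut, toFinset_filter_ne] using hY'

theorem invariant_delete (h : Invariant L₀ R₀ k₀ n s) {v : ℕ} (hv : v ∈ s.R) :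
    ∀ c ∈ s.delete v, Invariant L₀ R₀ k₀ n c := by
  intro c hc
  unfold delete at hc
  split_ifs at hc with hk
  · simp at hc
  have hk : s.k ≠ 0 := by simpa using hk
  rw [List.mem_singleton.1 hc]
  have hlen := length_filter_ne hv
  have hvF : v ∉ s.F.toFinset := by simpa using h.disj v hv
  exact {
    order := h.order
    budget := (Nat.sub_le _ _).trans h.budget
    length_L := ((ind_sublist (fun z => !(z == v)) s.L).length_le).trans h.length_L
    length_le := by
      have := h.length_le
      simp only [remove, List.length_cons]
      omega
    lt_R := fun v hv => h.lt_R v (List.mem_of_mem_filter hv)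
    lt_F := h.lt_F
    lt_X := by
      intro x hx
      rcases List.mem_cons.1 hx with rfl | hx
      · exact h.lt_R _ hv
      · exact h.lt_X x hx
    disj := fun v hv => h.disj v (List.mem_of_mem_filter hv)
    ends := h.ends_remove v
    cactus_R := h.cactus_remove v
    cactus_F := by simpa only [remove, indSet_remove hvF] using h.cactus_F
    sound := fun Y hY => by
      simp only [remove, toFinset_filter_ne] at hY
      have := h.sound _ (hY.of_delete hk (by simpa using hv))
      simpa only [List.toFinset_cons, Finset.union_insert, Finset.insert_union] using this }

theorem toFinset_filter_memb (l W : List ℕ) :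
    (l.filter fun z => !memb W z).toFinset = l.toFinset \ W.toFinset := by
  ext z
  simp [← memb_iff]

theorem length_filter_memb {l W : List ℕ} (hW : W ≠ []) (hl : ∀ z ∈ W, z ∈ l) :
    (l.filter fun z => !memb W z).length + 1 ≤ l.length := by
  obtain ⟨z, hz⟩ := List.exists_mem_of_ne_nil W hW
  exact List.length_filter_lt_length_iff_exists.2 ⟨z, hl z hz, by simp [memb_iff.2 hz]⟩

theorem invariant_keep (h : Invariant L₀ R₀ k₀ n s) {W : List ℕ} (hW : W ≠ [])
    (hlen : W.length ≤ 3) (hR : ∀ z ∈ W, z ∈ s.R) :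
    ∀ c ∈ s.keep W, Invariant L₀ R₀ k₀ n c := by
  intro c hc
  unfold keep at hc
  split_ifs at hc with ht
  swap
  · simp at hc
  rw [List.mem_singleton.1 hc]
  exact {
    order := h.order
    budget := h.budget
    length_L := h.length_L
    -- `W` may repeat a vertex: up to three entries join `F` while perhaps only one leaves `R`. This
    -- is why `R` counts threefold in the invariant.
    length_le := by
      have := h.length_le
      have := length_filter_memb hW hR
      simp only [List.length_append]
      omega
    lt_R := fun v hv => h.lt_R v (List.mem_of_mem_filter hv)
    lt_F := by
      intro x hx
      rcases List.mem_append.1 hx with hx | hx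
      · exact h.lt_R x (hR x hx)
      · exact h.lt_F x hx
    lt_X := h.lt_X
    disj := by
      intro v hv hv'
      simp only [List.mem_filter] at hv
      rcases List.mem_append.1 hv' with hv' | hv'
      · simp [memb_iff.2 hv'] at hv
      · exact h.disj v hv.1 hv'
    ends := by
      intro e he
      have := h.ends e he
      have key : ∀ z, (z ∈ s.R ∨ z ∈ s.F) →
          (z ∈ (s.R.filter fun z => !memb W z) ∨ z ∈ W ++ s.F) := by
        intro z hz
        simp only [List.mem_filter, List.mem_append, Bool.not_eq_true', ← Bool.not_eq_true,
          memb_iff]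
        tauto
      exact ⟨key _ this.1, key _ this.2⟩
    cactus_R := h.cactus_R.mono (indSet_sublist (by
      rw [toFinset_filter_memb]; exact Finset.sdiff_subset) _)
    cactus_F := cactusTest_iff.1 ht
    sound := fun Y hY => h.sound Y ⟨hY.subset.trans (by
      simp only [toFinset_filter_memb]; exact Finset.sdiff_subset), hY.card_le, hY.cactus⟩ }

/-- A solution meeting `W` survives in the child that deletes such a vertex. A solution avoiding `W`
leaves all of `W` and `F` in a cactus forest, so the test in `keep` succeeds. -/
theorem complete_branch (h : Invariant L₀ R₀ k₀ n s) (W : List ℕ) (hs : s.Solvable) :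
    ∃ c ∈ s.branch W, c.Solvable := by
  obtain ⟨Y, hY⟩ := hs
  by_cases hW : ∃ v ∈ W, v ∈ Y
  · obtain ⟨v, hvW, hv⟩ := hW
    obtain ⟨hk, hY'⟩ := hY.delete hv
    have : s.delete v = [{ s.remove v with X := v :: s.X, k := s.k - 1 }] := by
      simp [delete, hk]
    refine ⟨_, List.mem_append_left _ (List.mem_flatten.2
      ⟨_, List.mem_map_of_mem hvW, this ▸ List.mem_singleton_self _⟩), Y.erase v, ?_⟩
    simpa only [remove, toFinset_filter_ne] using hY'
  · push Not at hW
    have hdis : Disjoint (W ++ s.F).toFinset Y := by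
      refine Finset.disjoint_left.2 fun z hz hzY => ?_
      rcases List.mem_append.1 (List.mem_toFinset.1 hz) with hz | hz
      · exact hW z hz hzY
      · exact h.disj z (List.mem_toFinset.1 (hY.subset hzY)) hz
    have ht : cactusTest s.L (W ++ s.F) = true :=
      cactusTest_iff.2 (hY.cactus.mono (indSet_sublist_without hdis _))
    have : s.keep W = [{ s with R := s.R.filter fun z => !memb W z, F := W ++ s.F }] := by
      simp [keep, ht]
    refine ⟨{ s with R := s.R.filter fun z => !memb W z, F := W ++ s.F },
      List.mem_append_right _ (by rw [this]; exact List.mem_singleton_self _), Y, ?_,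
      hY.card_le, hY.cactus⟩
    simp only [toFinset_filter_memb]
    exact Finset.subset_sdiff.2 ⟨hY.subset, Finset.disjoint_left.2 fun z hz hzW =>
      hW z (List.mem_toFinset.1 hzW) hz⟩

theorem weight_delete_le {v : ℕ} (hv : v ∈ s.R) (hvF : v ∉ s.F) :
    ((s.delete v).map weight).sum ≤
      1 / 6 * (6 ^ s.k * potential s.L s.F.toFinset * s.R.length) := by
  have h0 := one_le_potential s.L s.F.toFinset
  unfold delete
  split_ifs with hk
  · simp only [List.map_nil, List.sum_nil]
    positivity
  obtain ⟨j, hj⟩ := Nat.exists_eq_succ_of_ne_zero (by simpa using hk : s.k ≠ 0)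
  have h1 : (((s.R.filter fun z => !(z == v)).length : ℕ) : ℝ) + 1 ≤ s.R.length := by
    exact_mod_cast length_filter_ne hv
  simp only [List.map_cons, List.map_nil, List.sum_cons, List.sum_nil, add_zero, weight, remove,
    potential_remove hvF, hj, Nat.succ_eq_add_one, Nat.add_sub_cancel]
  rw [pow_succ]
  have h2 : (0 : ℝ) ≤ 6 ^ j * potential s.L s.F.toFinset := by positivity
  have := mul_le_mul_of_nonneg_left h1 h2
  linarith

/-- With `μ` the weight without its last factor, every deletion contributes at most `μ * |R| / 6`
and keeping at most `c * μ * |R|`, since every child has fewer undecided vertices. As `s` weighs `μ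
* (|R| + 1)`, the remaining `μ ≥ 1` pays for the node. -/
theorem weight_branch_le (h : Invariant L₀ R₀ k₀ n s) {W : List ℕ} (hW : W ≠ [])
    (hR : ∀ z ∈ W, z ∈ s.R) {c : ℝ} (hc : W.length / 6 + c ≤ 1) (hc0 : 0 ≤ c)
    (hkeep : cactusTest s.L (W ++ s.F) = true →
      potential s.L (W ++ s.F).toFinset ≤ c * potential s.L s.F.toFinset) :
    ((s.branch W).map weight).sum + 1 ≤ s.weight := by
  have h0 := one_le_potential s.L s.F.toFinset
  have hμ : (1 : ℝ) ≤ 6 ^ s.k * potential s.L s.F.toFinset :=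
    one_le_mul_of_one_le_of_one_le (one_le_pow₀ (by norm_num)) h0
  set μ : ℝ := 6 ^ s.k * potential s.L s.F.toFinset with hμd
  have h1 : (((W.map s.delete).flatten).map weight).sum ≤ W.length / 6 * (μ * s.R.length) := by
    clear hW hc hkeep
    induction W with
    | nil => simp
    | cons v W ih =>
      have hv := hR v List.mem_cons_self
      have h1 := weight_delete_le hv (h.disj v hv)
      have h2 := ih fun z hz => hR z (List.mem_cons_of_mem _ hz)
      rw [← hμd] at h1
      simp only [List.map_cons, List.flatten_cons, List.map_append, List.sum_append,
        List.length_cons, Nat.cast_add, Nat.cast_one]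
      linarith
  have h2 : ((s.keep W).map weight).sum ≤ c * (μ * s.R.length) := by
    unfold keep
    split_ifs with ht
    · have h3 : (((s.R.filter fun z => !memb W z).length : ℕ) : ℝ) + 1 ≤ s.R.length := by
        exact_mod_cast length_filter_memb hW hR
      simp only [List.map_cons, List.map_nil, List.sum_cons, List.sum_nil, add_zero, weight]
      have h4 := mul_le_mul_of_nonneg_left (hkeep ht) (by positivity : (0 : ℝ) ≤ 6 ^ s.k)
      calc _ ≤ 6 ^ s.k * (c * potential s.L s.F.toFinset) * (s.R.length : ℝ) :=
            mul_le_mul h4 h3 (by positivity) (by positivity)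
        _ = _ := by rw [hμd]; ring
    · simp only [List.map_nil, List.sum_nil]
      positivity
  have h3 : s.weight = μ * (s.R.length + 1) := rfl
  rw [branch, List.map_append, List.sum_append, h3]
  have h4 := mul_le_mul_of_nonneg_right hc (by positivity : (0 : ℝ) ≤ μ * s.R.length)
  linarith

theorem refines_branch (h : Invariant L₀ R₀ k₀ n s) {W : List ℕ} (hW : W ≠ [])
    (hlen : W.length ≤ 3) (hR : ∀ z ∈ W, z ∈ s.R) {c : ℝ} (hc : W.length / 6 + c ≤ 1)
    (hc0 : 0 ≤ c) (hkeep : cactusTest s.L (W ++ s.F) = true →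
      potential s.L (W ++ s.F).toFinset ≤ c * potential s.L s.F.toFinset) :
    Refines L₀ R₀ k₀ n s (s.branch W) where
  invariant d hd := by
    rcases List.mem_append.1 hd with hd | hd
    · obtain ⟨l, hl, hd⟩ := List.mem_flatten.1 hd
      obtain ⟨v, hv, rfl⟩ := List.mem_map.1 hl
      exact invariant_delete h (hR v hv) d hd
    · exact invariant_keep h hW hlen hR d hd
  weight_le := weight_branch_le h hW hR hc hc0 hkeep
  complete := complete_branch h W

end State

/-! ### Every inner node has a correct list of children -/

namespace State

variable {L₀ : Edges} {R₀ : Finset ℕ} {k₀ n : ℕ} {s : State}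

theorem mem_sprod {α β : Type} {a : α} {b : β} {l : List α} {l' : List β} :
    (a, b) ∈ l ×ˢ l' ↔ a ∈ l ∧ b ∈ l' := List.pair_mem_product

theorem mult_le_two_of_mem {A : Finset ℕ} {L : Edges} (hC : Cactus (indSet A L)) {a b : ℕ}
    (ha : a ∈ A) (hb : b ∈ A) (hab : a ≠ b) : mult L a b ≤ 2 := by
  have := mult_le_two hC hab
  rwa [indSet, mult_ind (by simpa using ha) (by simpa using hb)] at this

theorem Invariant.mem_of_adj (h : Invariant L₀ R₀ k₀ n s) {v z : ℕ} (hz : adj s.L v z = true) :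
    z ∈ s.R ∨ z ∈ s.F := by
  rcases (adj_iff.1 hz).2 with hz | hz
  · exact (h.ends _ hz).2
  · exact (h.ends _ hz).1

theorem refines_children (h : Invariant L₀ R₀ k₀ n s) (hR : s.R ≠ []) :
    Refines L₀ R₀ k₀ n s s.children := by
  unfold children
  rcases hD : s.conflicts with _ | ⟨⟨u, v, w⟩, l⟩
  swap
  · have hx : (u, v, w) ∈ s.conflicts := hD ▸ List.mem_cons_self
    simp only [conflicts, List.mem_filter, mem_sprod, Bool.not_eq_true'] at hx
    -- Keeping the whole triple is impossible, so its share of the weight is `0` and only `3/6` is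
    -- spent.
    refine refines_branch h (W := [u, v, w]) (c := 0) (by simp) (by simp) ?_ (by norm_num) le_rfl
      fun ht => ?_
    · simp only [List.mem_cons, List.not_mem_nil, or_false]
      rintro z (rfl | rfl | rfl)
      exacts [hx.1.1, hx.1.2.1, hx.1.2.2]
    · rw [hx.2] at ht
      exact absurd ht (by simp)
  have hC : ∀ u ∈ s.R, ∀ v ∈ s.R, ∀ w ∈ s.R, Cactus (indSet ([u, v, w] ++ s.F).toFinset s.L) := by
    intro u hu v hv w hw
    rw [← cactusTest_iff]
    by_contra ht
    have : (u, v, w) ∈ s.conflicts := by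
      simp only [conflicts, List.mem_filter, mem_sprod, Bool.not_eq_true']
      exact ⟨⟨hu, hv, hw⟩, by simpa using ht⟩
    rw [hD] at this
    simp at this
  -- For a kept neighbour the bound comes from the absence of conflicts, applied to the degenerate
  -- triple `v, v, v`.
  have hm : ∀ v ∈ s.R, ∀ z, adj s.L v z = true → mult s.L v z ≤ 2 := by
    intro v hv z hz
    rcases h.mem_of_adj hz with hz' | hz'
    · exact mult_le_two_of_mem h.cactus_R (by simpa using hv) (by simpa using hz') (adj_iff.1 hz).1
    · exact mult_le_two_of_mem (hC v hv v hv v hv) (by simp) (by simp [hz']) (adj_iff.1 hz).1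
  rcases hA1 : s.pendants with _ | ⟨⟨v, u⟩, l⟩
  swap
  · have hx : (v, u) ∈ s.pendants := hA1 ▸ List.mem_cons_self
    simp only [pendants, List.mem_filter, mem_sprod, List.all_eq_true,
      List.mem_append, Bool.or_eq_true, Bool.not_eq_true', beq_iff_eq] at hx
    refine refines_remove h (u := u) hx.1.1 (fun z hz => ?_) (hm v hx.1.1 u)
    exact (hx.2 z (h.mem_of_adj hz)).resolve_left (by simp [hz])
  rcases hA2 : s.bypassables with _ | ⟨⟨v, u, w⟩, l⟩
  swap
  · have hx : (v, u, w) ∈ s.bypassables := hA2 ▸ List.mem_cons_self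
    simp only [bypassables, List.mem_filter, mem_sprod, List.all_eq_true,
      List.mem_append, Bool.and_eq_true, Bool.or_eq_true, Bool.not_eq_true', beq_iff_eq,
      beq_eq_false_iff_ne] at hx
    obtain ⟨⟨hv, hu, hw⟩, ⟨hvu, hvw, huw⟩, hn⟩ := hx
    refine refines_shortcut h hv hu hw huw hvu hvw (fun z hz => ?_) (hm v hv u hvu) (hm v hv w hvw)
    exact (hn z (h.mem_of_adj hz)).resolve_left (by simp [hz])
  rcases hB : s.attached with _ | ⟨⟨v, f, g⟩, l⟩
  swap
  · have hx : (v, f, g) ∈ s.attached := hB ▸ List.mem_cons_self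
    simp only [attached, List.mem_filter, mem_sprod, Bool.and_eq_true,
      Bool.not_eq_true', beq_eq_false_iff_ne] at hx
    obtain ⟨⟨hv, hf, hg⟩, hvf, hvg, hfg⟩ := hx
    refine refines_branch h (W := [v]) (c := 5 / 6) (by simp) (by simp) (by simpa using hv)
      (by norm_num) (by norm_num) fun ht => ?_
    have hF : ([v] ++ s.F).toFinset = s.F.toFinset ∪ {v} := by
      rw [List.toFinset_append, Finset.union_comm]; simp
    rw [cactusTest_iff, hF] at ht
    rw [hF]
    exact potential_keep_one (by simpa using h.disj v hv) (by simpa using hf) (by simpa using hg)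
      hfg hvf hvg ht
  rcases hK : s.linking with _ | ⟨⟨⟨v, w⟩, f, g⟩, l⟩
  swap
  · have hx : ((v, w), f, g) ∈ s.linking := hK ▸ List.mem_cons_self
    simp only [linking, List.mem_filter, mem_sprod, Bool.and_eq_true,
      Bool.not_eq_true', ← Bool.not_eq_true, ec0_iff] at hx
    obtain ⟨⟨⟨hv, hw⟩, hf, hg⟩, hvw, hvf, hwg, hE⟩ := hx
    refine refines_branch h (W := [v, w]) (c := 2 / 3) (by simp) (by simp) (by simp [hv, hw])
      (by norm_num) (by norm_num) fun ht => ?_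
    have hF : ([v, w] ++ s.F).toFinset = s.F.toFinset ∪ {v, w} := by
      rw [List.toFinset_append, Finset.union_comm]; simp
    rw [hF]
    rw [← indSet_toFinset] at hE
    exact potential_keep_two (by simpa using hf) (by simpa using hg) hvw hvf hwg hE
  -- All five lists are empty, so no rule applies and `R` would be empty.
  exfalso
  refine hR (List.toFinset_eq_empty_iff _ |>.1 (eq_empty_of_no_rule (L := s.L) (F := s.F.toFinset)
    ?_ ?_ h.cactus_R ?_ ?_ ?_ ?_ ?_))
  · exact Finset.disjoint_left.2 fun v hv => by simpa using h.disj v (by simpa using hv)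
  · intro v _ z hz
    simpa using h.mem_of_adj hz
  · intro u hu v hv w hw
    have := hC u (by simpa using hu) v (by simpa using hv) w (by simpa using hw)
    rw [List.toFinset_append, Finset.union_comm] at this
    simpa using this
  · intro v hv u hu
    simp only [Finset.mem_union, List.mem_toFinset] at hv hu
    by_contra! hn
    have : (v, u) ∈ s.pendants := by
      simp only [pendants, List.mem_filter, mem_sprod, List.all_eq_true,
        List.mem_append, Bool.or_eq_true, Bool.not_eq_true', beq_iff_eq]
      refine ⟨⟨hv, hu⟩, fun z _ => ?_⟩
      cases hz : adj s.L v z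
      · exact Or.inl rfl
      · exact Or.inr (hn z hz)
    rw [hA1] at this
    simp at this
  · intro v hv u hu w hw hvu hvw huw
    simp only [Finset.mem_union, List.mem_toFinset] at hv hu hw
    by_contra! hn
    have : (v, u, w) ∈ s.bypassables := by
      simp only [bypassables, List.mem_filter, mem_sprod, List.all_eq_true,
        List.mem_append, Bool.and_eq_true, Bool.or_eq_true, Bool.not_eq_true', beq_iff_eq,
        beq_eq_false_iff_ne]
      refine ⟨⟨hv, hu, hw⟩, ⟨hvu, hvw, huw⟩, fun z _ => ?_⟩
      cases hz : adj s.L v z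
      · exact Or.inl rfl
      · exact Or.inr (or_iff_not_imp_left.2 (hn z hz))
    rw [hA2] at this
    simp at this
  · intro v hv f hf g hg hvf hvg
    simp only [List.mem_toFinset] at hv hf hg
    by_contra hfg
    have : (v, f, g) ∈ s.attached := by
      simp only [attached, List.mem_filter, mem_sprod, Bool.and_eq_true,
        Bool.not_eq_true', beq_eq_false_iff_ne]
      exact ⟨⟨hv, hf, hg⟩, hvf, hvg, hfg⟩
    rw [hB] at this
    simp at this
  · intro v hv w hw f hf g hg hvw hvf hwg
    simp only [List.mem_toFinset] at hv hw hf hg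
    by_contra hE
    have : ((v, w), f, g) ∈ s.linking := by
      simp only [linking, List.mem_filter, mem_sprod, Bool.and_eq_true,
        Bool.not_eq_true', ← Bool.not_eq_true, ec0_iff]
      rw [← indSet_toFinset]
      exact ⟨⟨⟨hv, hw⟩, hf, hg⟩, hvw, hvf, hwg, hE⟩
    rw [hK] at this
    simp at this

/-- An answer is given only when `R` is empty. Then all edges lie inside `F`, nothing more has to be
deleted, and soundness with `Y = ∅` shows that the deleted vertices are feasible. -/
theorem feasible_of_step (h : Invariant L₀ R₀ k₀ n s) {r : List Bool} (hr : s.step.1 = some r) :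
    ∃ Y, Feasible L₀ R₀ k₀ Y ∧ r = (List.range n).map fun i => decide (i ∈ Y) := by
  unfold step at hr
  split_ifs at hr with hR
  rw [List.isEmpty_iff] at hR
  refine ⟨s.X.toFinset, ?_, ?_⟩
  · have := h.sound ∅ ⟨Finset.empty_subset _, Nat.zero_le _, ?_⟩
    · rwa [Finset.empty_union] at this
    · refine h.cactus_F.mono ?_
      rw [show indSet s.F.toFinset s.L = s.L from List.filter_eq_self.2 fun e he => ?_]
      · exact ind_sublist _ _
      · have := h.ends e he
        simp only [hR, List.not_mem_nil, false_or] at this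
        simp [this.1, this.2]
  · rw [← Option.some.inj hr, h.order]
    refine List.map_congr_left fun i _ => ?_
    rw [Bool.eq_iff_iff, memb_iff]
    simp

theorem sz_list_nat_le {l : List ℕ} {m b : ℕ} (h : ∀ v ∈ l, v < m) (hl : l.length ≤ b) :
    sz l ≤ b * (2 * m + 2) + 1 :=
  (sz_list_le (m := 2 * m + 1) fun v hv => by
    rw [sz_nat]; have := h v hv; omega).trans
    (Nat.add_le_add_right (Nat.mul_le_mul_right _ hl) 1)

theorem Invariant.sz_le (h : Invariant L₀ R₀ k₀ n s) :
    sz s ≤ 60 * (n + L₀.length + k₀ + 1) ^ 2 := by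
  have h0 : sz s = sz s.L + (sz s.R + (sz s.F + (sz s.X + (sz s.k + sz s.n + 1) + 1) + 1) + 1) + 1 :=
    rfl
  have hlt : ∀ z, (z ∈ s.R ∨ z ∈ s.F) → z ≤ n := fun z hz =>
    hz.elim (fun hz => (h.lt_R z hz).le) (fun hz => (h.lt_F z hz).le)
  have hlen := h.length_le
  have h1 := sz_edges_le (fun e he => ⟨hlt _ (h.ends e he).1, hlt _ (h.ends e he).2⟩) h.length_L
  have h2 := sz_list_nat_le h.lt_R (show _ ≤ 4 * n by omega)
  have h3 := sz_list_nat_le h.lt_F (show _ ≤ 4 * n by omega)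
  have h4 := sz_list_nat_le h.lt_X (show _ ≤ 4 * n by omega)
  have h5 := h.budget
  rw [h0, sz_nat, sz_nat, h.order]
  nlinarith

end State

/-! ### The root of the search tree -/

section Root

variable {n : ℕ} (E : List (Fin n × Fin n)) (S : Finset (Fin n)) (k : ℕ)

/-- The vertices outside `S`. -/
def outside : Finset ℕ := Sᶜ.map Fin.valEmbedding

/-- The instance in terms of natural numbers. -/
def rawInstance : Edges × List Bool × ℕ := (natEdges E, List.ofFn fun i => decide (i ∈ S), k)

theorem enc_rawInstance : enc (rawInstance E S k) = encodeInstance E S k := by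
  change Val.cons (Val.ofList _) (Val.cons (Val.ofList _) (Val.ofNat k)) = _
  simp only [rawInstance, encodeInstance, Val.ofFinset, natEdges, List.map_map, List.map_ofFn]
  rfl

theorem mem_outside {z : ℕ} : z ∈ outside S ↔ ∃ h : z < n, (⟨z, h⟩ : Fin n) ∉ S := by
  simp only [outside, Finset.mem_map, Finset.mem_compl, Fin.valEmbedding_apply]
  constructor
  · rintro ⟨x, hx, rfl⟩
    exact ⟨x.2, hx⟩
  · rintro ⟨h, hz⟩
    exact ⟨⟨z, h⟩, hz, rfl⟩

theorem lt_of_mem_natEdges {e : ℕ × ℕ} (he : e ∈ natEdges E) : e.1 < n ∧ e.2 < n := by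
  obtain ⟨f, -, rfl⟩ := List.mem_map.1 he
  exact ⟨f.1.2, f.2.2⟩

theorem sz_rawInstance_le :
    sz (rawInstance E S k) ≤ 60 * (n + (natEdges E).length + k + 1) ^ 2 := by
  have h0 : sz (rawInstance E S k) = sz (natEdges E) +
    (sz (List.ofFn fun i => decide (i ∈ S)) + sz k + 1) + 1 := rfl
  have h1 := sz_edges_le (L := natEdges E) (m := n)
    (fun e he => (lt_of_mem_natEdges E he).imp le_of_lt le_of_lt) le_rfl
  have h2 := sz_list_le (l := List.ofFn fun i => decide (i ∈ S)) fun b _ => sz_bool_le b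
  rw [List.length_ofFn] at h2
  rw [h0, sz_nat]
  nlinarith

/-- The elements of `S` in increasing order. -/
def kept : List ℕ :=
  (List.range n).filter fun i =>
    listCase false (fun b _ => b) ((List.ofFn fun i : Fin n => decide (i ∈ S)).drop i)

theorem mem_kept {z : ℕ} : z ∈ kept S ↔ ∃ h : z < n, (⟨z, h⟩ : Fin n) ∈ S := by
  simp only [kept, List.mem_filter, List.mem_range]
  refine ⟨fun ⟨h, h'⟩ => ⟨h, ?_⟩, fun ⟨h, h'⟩ => ⟨h, ?_⟩⟩
  all_goals
    have hz : z < (List.ofFn fun i : Fin n => decide (i ∈ S)).length := by simpa using h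
    rw [List.drop_eq_getElem_cons hz] at *
    simpa [listCase] using h'

theorem mem_range_filter_kept {z : ℕ} :
    z ∈ ((List.range n).filter fun i => !memb (kept S) i) ↔ z ∈ outside S := by
  simp only [List.mem_filter, List.mem_range, Bool.not_eq_true', ← Bool.not_eq_true, memb_iff,
    mem_kept, mem_outside, not_exists]
  exact ⟨fun ⟨h, h'⟩ => ⟨h, h' h⟩, fun ⟨h, h'⟩ => ⟨h, fun _ => h'⟩⟩

/-- The root of the search tree. -/
def root : State :=
  ⟨natEdges E, (List.range n).filter fun i => !memb (kept S) i, kept S, [], k, n⟩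

theorem init_rawInstance : State.init (rawInstance E S k) =
    if cactusTest (natEdges E) (kept S) then [root E S k] else [] := by
  simp only [State.init, rawInstance, List.length_ofFn]
  rfl

theorem toFinset_root_R : (root E S k).R.toFinset = outside S := by
  ext z
  rw [List.mem_toFinset]
  exact mem_range_filter_kept S

theorem isSolution_iff (X : Finset (Fin n)) : IsSolution E S k X ↔
    Feasible (natEdges E) (outside S) k (X.map Fin.valEmbedding) := by
  have h1 := isCactusForest_deleteVerts_iff E (X : Set (Fin n))
    (fun z => !decide (z ∈ X.map Fin.valEmbedding)) fun x => by
      simp [Fin.val_inj]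
  have h2 : Disjoint X S ↔ X.map Fin.valEmbedding ⊆ outside S := by
    rw [outside, Finset.map_subset_map, Finset.subset_compl_iff_disjoint_right]
  have h3 := Finset.card_map (s := X) Fin.valEmbedding
  unfold IsSolution
  rw [h1, h2, ← h3]
  exact ⟨fun ⟨a, b, c⟩ => ⟨a, b, c⟩, fun ⟨a, b, c⟩ => ⟨a, b, c⟩⟩

theorem invariant_root (hG : IsCactusForest ((multigraph E).deleteVerts (S : Set (Fin n))))
    (ht : cactusTest (natEdges E) (kept S) = true) :
    State.Invariant (natEdges E) (outside S) k n (root E S k) where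
  order := rfl
  budget := le_rfl
  length_L := le_rfl
  length_le := by
    have h1 := List.length_filter_le (fun i => !memb (kept S) i) (List.range n)
    have h2 : (kept S).length ≤ _ := List.length_filter_le _ (List.range n)
    rw [List.length_range] at h1 h2
    simp only [root, List.length_nil]
    omega
  lt_R v hv := ((mem_outside S).1 ((mem_range_filter_kept S).1 hv)).1
  lt_F v hv := ((mem_kept S).1 hv).1
  lt_X v hv := by simp [root] at hv
  disj v hv hv' := by
    obtain ⟨h, h'⟩ := (mem_outside S).1 ((mem_range_filter_kept S).1 hv)
    obtain ⟨_, h''⟩ := (mem_kept S).1 hv'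
    exact h' h''
  ends e he := by
    have key : ∀ z, z < n → (z ∈ (root E S k).R ∨ z ∈ (root E S k).F) := by
      intro z hz
      by_cases h : (⟨z, hz⟩ : Fin n) ∈ S
      · exact Or.inr ((mem_kept S).2 ⟨hz, h⟩)
      · exact Or.inl ((mem_range_filter_kept S).2 ((mem_outside S).2 ⟨hz, h⟩))
    have := lt_of_mem_natEdges E he
    exact ⟨key _ this.1, key _ this.2⟩
  cactus_R := by
    rw [toFinset_root_R]
    refine (isCactusForest_deleteVerts_iff E (S : Set (Fin n)) _ fun x => ?_).1 hG
    simp [mem_outside]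
  cactus_F := cactusTest_iff.1 ht
  sound Y hY := by
    rw [toFinset_root_R] at hY
    simpa [root] using hY

/-- Both ranks are at most `|S| ≤ k + 1`, and `6 * (324/125) = 1944/125`. The excess factor
`324/125` is rounded up to `3`. -/
theorem weight_root_le (hS : S.card ≤ k + 1) :
    (root E S k).weight ≤ 3 * (1944 / 125) ^ k * (n + 1) := by
  have hc : (kept S).toFinset.card ≤ k + 1 := by
    refine le_trans (le_of_eq ?_) hS
    rw [← Finset.card_map (s := S) Fin.valEmbedding]
    congr 1
    ext z
    simp only [List.mem_toFinset, mem_kept, Finset.mem_map, Fin.valEmbedding_apply]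
    exact ⟨fun ⟨h, h'⟩ => ⟨_, h', rfl⟩, by rintro ⟨x, hx, rfl⟩; exact ⟨x.2, hx⟩⟩
  have h1 : potential (natEdges E) (kept S).toFinset ≤ (324 / 125) ^ (k + 1) :=
    (potential_le _ _).trans (pow_le_pow_right₀ (by norm_num) hc)
  have h2 : (((root E S k).R.length : ℕ) : ℝ) ≤ n := by
    have := List.length_filter_le (fun i => !memb (kept S) i) (List.range n)
    rw [List.length_range] at this
    exact_mod_cast this
  calc (root E S k).weight ≤ 6 ^ k * (324 / 125) ^ (k + 1) * ((n : ℝ) + 1) :=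
        mul_le_mul (mul_le_mul_of_nonneg_left h1 (by positivity)) (by linarith) (by positivity)
          (by positivity)
    _ = 324 / 125 * (6 * (324 / 125)) ^ k * ((n : ℝ) + 1) := by rw [mul_pow]; ring
    _ ≤ _ := by
        rw [show (6 * (324 / 125) : ℝ) = 1944 / 125 by norm_num]
        gcongr
        norm_num

end Root

/-! ### The running time -/

theorem exists_growth_const (D : ℕ) :
    ∃ C : ℕ, ∀ k : ℕ, ((k : ℝ) + 1) ^ D * (1944 / 125) ^ k ≤ C * 16.64 ^ k := by
  -- Since `1944/125 = 15.552 < 16.64`, the quotient is an exponential base above 1 and absorbs any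
  -- power of `k + 1`.
  have hr : (1 : ℝ) < 16.64 / (1944 / 125) := by norm_num
  obtain ⟨B, hB⟩ := (tendsto_pow_const_div_const_pow_of_one_lt D hr).bddAbove_range
  obtain ⟨C, hC⟩ := exists_nat_ge (B * (16.64 / (1944 / 125)))
  refine ⟨C, fun k => ?_⟩
  have h1 := hB ⟨k + 1, rfl⟩
  rw [div_le_iff₀ (by positivity)] at h1
  push_cast at h1
  calc ((k : ℝ) + 1) ^ D * (1944 / 125) ^ k
      ≤ B * (16.64 / (1944 / 125)) ^ (k + 1) * (1944 / 125) ^ k :=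
        mul_le_mul_of_nonneg_right h1 (by positivity)
    _ = B * (16.64 / (1944 / 125)) * ((16.64 / (1944 / 125)) * (1944 / 125)) ^ k := by
        rw [mul_pow]; ring
    _ = B * (16.64 / (1944 / 125)) * 16.64 ^ k := by norm_num
    _ ≤ C * 16.64 ^ k := mul_le_mul_of_nonneg_right hC (by positivity)

/-- The budget need not be bounded by the size of the graph. The estimate `n + m + k + 1 ≤ (n + m +
1) * (k + 1)` splits the polynomial cost into a part for the polynomial `p` and a power of `k + 1`
that joins the exponential. The constants are `62 = 60 + 2` and `104 = 1 + 31 * 3 + 10`. -/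
theorem time_bound {d n m k : ℕ} {x M : ℕ} {t w : ℝ} (hx : x ≤ 60 * (n + m + k + 1) ^ 2)
    (hM : M = 60 * (n + m + k + 1) ^ 2) (hw : w ≤ 3 * (1944 / 125) ^ k * (n + 1))
    (ht : t ≤ ((x : ℝ) + 2) ^ d + (((M : ℝ) + 2) ^ d + 30) * w + 10) :
    t ≤ 104 * 62 ^ d * ((n : ℝ) + m + 1) ^ (2 * d + 1) *
      (((k : ℝ) + 1) ^ (2 * d + 1) * (1944 / 125) ^ k) := by
  set N : ℝ := (n : ℝ) + m + k + 1 with hN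
  have hn : (0 : ℝ) ≤ n := Nat.cast_nonneg n
  have hm : (0 : ℝ) ≤ m := Nat.cast_nonneg m
  have hk : (0 : ℝ) ≤ k := Nat.cast_nonneg k
  have hN1 : 1 ≤ N := by rw [hN]; linarith
  have hN2 : 1 ≤ N ^ 2 := one_le_pow₀ hN1
  have hx' : (x : ℝ) ≤ 60 * N ^ 2 := by rw [hN]; exact_mod_cast hx
  have hM' : (M : ℝ) = 60 * N ^ 2 := by rw [hN]; exact_mod_cast hM
  set A : ℝ := (62 * N ^ 2) ^ d with hA
  have hA1 : 1 ≤ A := one_le_pow₀ (by linarith)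
  set b : ℝ := (1944 / 125) ^ k with hb
  have hb1 : 1 ≤ b := one_le_pow₀ (by norm_num)
  have h1 : ((x : ℝ) + 2) ^ d ≤ A := pow_le_pow_left₀ (by positivity) (by linarith) d
  have h2 : ((M : ℝ) + 2) ^ d ≤ A := pow_le_pow_left₀ (by positivity) (by linarith) d
  have hbN : 1 ≤ b * N := one_le_mul_of_one_le_of_one_le hb1 hN1
  have hw' : w ≤ 3 * (b * N) := by
    refine hw.trans ?_
    have : (n : ℝ) + 1 ≤ N := by rw [hN]; linarith
    nlinarith
  have h3 : t ≤ 104 * A * (b * N) := by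
    have e1 : (((M : ℝ) + 2) ^ d + 30) * w ≤ (31 * A) * (3 * (b * N)) := by
      refine (mul_le_mul_of_nonneg_left hw' (by positivity)).trans ?_
      exact mul_le_mul_of_nonneg_right (by linarith) (by linarith)
    have e2 : A ≤ A * (b * N) := le_mul_of_one_le_right (by linarith) hbN
    linarith
  have h4 : A * N = 62 ^ d * N ^ (2 * d + 1) := by
    rw [hA, mul_pow, ← pow_mul, pow_succ]; ring
  have h5 : N ^ (2 * d + 1) ≤ (((n : ℝ) + m + 1) * (k + 1)) ^ (2 * d + 1) :=
    pow_le_pow_left₀ (by linarith) (by rw [hN]; nlinarith) _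
  calc t ≤ 104 * (A * N) * b := by linarith
    _ ≤ 104 * (62 ^ d * (((n : ℝ) + m + 1) * (k + 1)) ^ (2 * d + 1)) * b := by
        rw [h4]; gcongr
    _ = _ := by rw [mul_pow]; ring

end CactusDeletion

open CactusDeletion in
theorem lemma3 :
    ∃ (P : CactusDeletion.Program) (p : Polynomial ℕ),
      ∀ (n : ℕ) (E : List (Fin n × Fin n)) (S : Finset (Fin n)) (k : ℕ),
        (∀ e ∈ E, e.1 ≠ e.2) →
        CactusDeletion.IsCactusForest
          ((CactusDeletion.multigraph E).deleteVerts (S : Set (Fin n))) →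
        S.card ≤ k + 1 →
        ∃ (answer : Option (Finset (Fin n))) (t : ℕ),
          P.RunsTo (CactusDeletion.encodeInstance E S k)
            (CactusDeletion.encodeAnswer answer) t ∧
          (t : ℝ) ≤ (16.64 : ℝ) ^ k * ((p.eval (n + E.length) : ℕ) : ℝ) ∧
          (∀ X, answer = some X → CactusDeletion.IsSolution E S k X) ∧
          (answer = none → ¬ ∃ X, CactusDeletion.IsSolution E S k X) := by
  obtain ⟨P, d, hP⟩ := exists_search_program State.pt_step State.pt_init
  obtain ⟨C, hC⟩ := exists_growth_const (2 * d + 1)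
  refine ⟨P, Polynomial.C (104 * 62 ^ d * C) * (Polynomial.X + 1) ^ (2 * d + 1), ?_⟩
  intro n E S k _ hG hS
  have hlen : (natEdges E).length = E.length := List.length_map _
  obtain ⟨o, t, hrun, ht, hsome, hnone⟩ := hP (rawInstance E S k)
    (State.Invariant (natEdges E) (outside S) k n) State.Solvable
    (fun r => ∃ Y, Feasible (natEdges E) (outside S) k Y ∧
      r = (List.range n).map fun i => decide (i ∈ Y)) State.weight
    (60 * (n + (natEdges E).length + k + 1) ^ 2)
    (by
      intro s hs
      rw [init_rawInstance] at hs
      split_ifs at hs with htest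
      · rw [List.mem_singleton.1 hs]
        exact invariant_root E S k hG htest
      · simp at hs)
    (fun s h => h.sz_le) (fun s _ => s.one_le_weight) (fun s h r hr => State.feasible_of_step h hr)
    (by
      intro s h hs
      unfold State.step at hs ⊢
      split_ifs at hs ⊢ with hR
      have := State.refines_children h (by simpa using hR)
      exact ⟨this.invariant, this.weight_le, this.complete⟩)
  have htime : (t : ℝ) ≤ (16.64 : ℝ) ^ k * ((Polynomial.eval (n + E.length)
      (Polynomial.C (104 * 62 ^ d * C) * (Polynomial.X + 1) ^ (2 * d + 1)) : ℕ) : ℝ) := by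
    refine (time_bound (n := n) (m := (natEdges E).length) (k := k) (sz_rawInstance_le E S k) rfl
      ?_ ht).trans ?_
    · rw [init_rawInstance]
      split_ifs
      · simpa using weight_root_le E S k hS
      · simp only [List.map_nil, List.sum_nil]
        positivity
    · refine (mul_le_mul_of_nonneg_left (hC k) (by positivity)).trans (le_of_eq ?_)
      rw [hlen]
      simp only [Polynomial.eval_mul, Polynomial.eval_C, Polynomial.eval_pow, Polynomial.eval_add,
        Polynomial.eval_X, Polynomial.eval_one]
      push_cast
      ring
  rw [enc_rawInstance] at hrun
  cases o with
  | none =>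
    refine ⟨none, t, hrun, htime, by simp, fun _ ⟨X, hX⟩ => ?_⟩
    have hX := (isSolution_iff E S k X).1 hX
    -- A solution guarantees that the search has a root: `S` avoids `X`, so it induces a subgraph of
    -- a cactus forest and passes the initial test.
    refine hnone rfl (root E S k) ?_ ⟨_, by rw [toFinset_root_R]; exact hX⟩
    rw [init_rawInstance, if_pos]
    · exact List.mem_singleton_self _
    · refine cactusTest_iff.2 (hX.cactus.mono (indSet_sublist_without ?_ _))
      refine Finset.disjoint_left.2 fun z hz hzX => ?_
      obtain ⟨_, h⟩ := (mem_kept S).1 (List.mem_toFinset.1 hz)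
      obtain ⟨_, h'⟩ := (mem_outside S).1 (hX.subset hzX)
      exact h' h
  | some r =>
    obtain ⟨Y, hY, rfl⟩ := hsome r rfl
    have hmap : (Finset.univ.filter fun i : Fin n => (i : ℕ) ∈ Y).map Fin.valEmbedding = Y := by
      ext z
      simp only [Finset.mem_map, Finset.mem_filter, Finset.mem_univ, true_and,
        Fin.valEmbedding_apply]
      refine ⟨by rintro ⟨i, hi, rfl⟩; exact hi, fun hz => ?_⟩
      obtain ⟨h, -⟩ := (mem_outside S).1 (hY.subset hz)
      exact ⟨⟨z, h⟩, hz, rfl⟩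
    refine ⟨some (Finset.univ.filter fun i : Fin n => (i : ℕ) ∈ Y), t, ?_, htime, ?_, by simp⟩
    · convert hrun using 1
      change Val.cons Val.nil (Val.ofList _) = Val.cons Val.nil (Val.ofList _)
      congr 2
      refine List.ext_getElem (by simp) fun i _ _ => ?_
      simp only [List.getElem_ofFn, List.getElem_map, List.getElem_range, Finset.mem_filter,
        Finset.mem_univ, true_and]
      rfl
    · rintro X hX
      rw [← Option.some.inj hX, isSolution_iff, hmap]
      exact hY
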